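/- Let $\mathfrak g$ be a finite-dimensional real Lie algebra, and let $\pi_{\mathfrak g}$ be the linear Poisson structure on $\mathfrak g^*$, $\pi_{\mathfrak g,\xi}=\xi\circ[\cdot,\cdot]$. Conventions: $\pi^\sharp(\alpha)=\pi(\alpha,\cdot)$, so $\pi_{\mathfrak g,\xi}^\sharp x=\xi([x,\cdot])$; $\mathrm{ad}_x y=-[x,y]$ and $\mathrm{ad}_x^*\xi=\xi\circ\mathrm{ad}_x$; $T^*\mathfrak g^*=\mathfrak g\times\mathfrak g^*\ni(x,\xi)$ with bundle projection $\mathrm{pr}(x,\xi)=\xi$; $\omega_{\mathrm{can}}=-d\lambda_{\mathrm{can}}$, i.e. $\omega_{\mathrm{can}}((x,\xi),(y,\eta))=\xi(y)-\eta(x)$; a symplectic form $\Omega$ defines the Poisson structure $\Omega^{-1}$ with sharp map $(u\mapsto\Omega(u,\cdot))^{-1}$. A spray for a Poisson structure $\pi$ on $M$ is a vector field $\mathcal V$ on $T^*M$ with $m_t^*\mathcal V=t\mathcal V$ for $t>0$ ($m_t$ = fibrewise multiplication by $t$) and $\mathrm{pr}_*\mathcal V(\alpha)=\pi^\sharp(\alpha)$.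 An embedded submanifold $X\subset M$ is a Poisson transversal if $TX\oplus NX=TM|_X$, where $NX=\pi^\sharp(N^*X)$ and $N^*X$ is the annihilator of $TX$; then $\pi|_X=\pi_X+w_X$ with $\pi_X\in\Gamma(\wedge^2TX)$ and $w_X\in\Gamma(\wedge^2NX)$. For a closed two-form $\sigma$ on $N^*X$, with projection $p:N^*X\to X$, $\pi_X^\sigma$ denotes the Poisson structure (where it exists) whose graph is $\{(U,\,p^*\alpha+\iota_U\sigma) : p_*U=\pi_X^\sharp\alpha\}$. a) $\pi_{\mathfrak g}$ is a Poisson structure, and $\mathcal V_{\mathfrak g}(x,\xi)=(0,-\mathrm{ad}_x^*\xi)$ is a complete spray for it, with flow $\phi_t(x,\xi)=(x,e^{-t\,\mathrm{ad}_x^*}\xi)$. b) The two-form $\Omega_{\mathfrak g}=\int_0^1\phi_t^*\omega_{\mathrm{can}}\,dt$ on $\mathfrak g\times\mathfrak g^*$ is smooth and closed, and $$\Omega_{\mathfrak g}((x,\xi),(y,\eta))_{(x_0,\xi_0)}=\xi(\Xi_{x_0}y)-\eta(\Xi_{x_0}x)+\xi_0([\Xi_{x_0}x,\Xi_{x_0}y]),$$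 where $$\Xi_{x_0}=\int_0^1e^{-t\,\mathrm{ad}_{x_0}}dt=\sum_{n\ge0}\frac{(-\mathrm{ad}_{x_0})^n}{(n+1)!}=\frac{e^{-\mathrm{ad}_{x_0}}-\mathrm{Id}}{-\mathrm{ad}_{x_0}}.$$ For every Lie group $G$ integrating $\mathfrak g$, let $\mathcal O(\mathfrak g)\subset\mathfrak g$ be the set of points at which the Lie-theoretic exponential map $\exp:\mathfrak g\to G$ is a local diffeomorphism. Then $\mathcal O(\mathfrak g)$ is open, $\Omega_{\mathfrak g}$ is nondegenerate at $(x,\xi)$ if and only if $x\in\mathcal O(\mathfrak g)$, and with $\exp_{\mathcal V_{\mathfrak g}}:=\mathrm{pr}\circ\phi_1$, $$(\mathfrak g^*,\pi_{\mathfrak g})\xleftarrow{\ \mathrm{pr}\ }(\mathcal O(\mathfrak g)\times\mathfrak g^*,\Omega_{\mathfrak g})\xrightarrow{\ \exp_{\mathcal V_{\mathfrak g}}\ }(\mathfrak g^*,-\pi_{\mathfrak g})$$ is a full dual pair: both maps are Poisson maps and surjective submersions, and their fibres are symplectically orthogonal to each other. c) An embedded submanifold $X\subset\mathfrak g^*$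 is a Poisson transversal if and only if, for every $\lambda\in X$, the two-form $\lambda\circ[\cdot,\cdot]$ is nondegenerate on the annihilator $N^*_\lambda X\subset\mathfrak g$ of $T_\lambda X$. In that case, with $N^*X=\bigcup_{\lambda\in X}N^*_\lambda X\times\{\lambda\}\subset\mathfrak g\times X$, the Poisson structure $\pi_X^{-\Omega_{\mathfrak g}|_{N^*X}}$ is defined on an open neighbourhood of $X=\{0\}\times X$ in $N^*X$, which may be chosen such that $$\exp_{\mathcal V_{\mathfrak g}}:(N^*X,\pi_X^{-\Omega_{\mathfrak g}|_{N^*X}})\to(\mathfrak g^*,\pi_{\mathfrak g}),\qquad (x,\lambda)\mapsto e^{-\mathrm{ad}_x^*}\lambda,$$ restricts to a Poisson diffeomorphism from it onto an open subset of $\mathfrak g^*$. d) Let $f:\mathfrak g\to\mathfrak h$ be a morphism of finite-dimensional real Lie algebras, let $X\subset\mathfrak g^*$ be a Poisson transversal, and put $Y:=(f^*)^{-1}(X)\subset\mathfrak h^*$. Then $f^*:(\mathfrak h^*,\pi_{\mathfrak h})\to(\mathfrak g^*,\pi_{\mathfrak g})$ is a Poisson map transverse to $X$, $Y$ is a Poisson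 transversal, and $f^*|_Y:(Y,\pi_Y)\to(X,\pi_X)$ is a Poisson map. For every $\mu\in Y$, $f$ restricts to a linear isomorphism $N^*_{f^*\mu}X\to N^*_\mu Y$, and the inverses of these form a smooth vector bundle map $F:N^*Y\to N^*X$ covering $f^*|_Y$, such that $$\exp_{\mathcal V_{\mathfrak g}}\circ F=f^*\circ\exp_{\mathcal V_{\mathfrak h}}\ \text{ on } N^*Y,\qquad F^*(\Omega_{\mathfrak g}|_{N^*X})=\Omega_{\mathfrak h}|_{N^*Y}.$$ Moreover, there are open neighbourhoods of $Y$ in $N^*Y$ and of $X$ in $N^*X$ as in c) such that $F$ restricts to a Poisson map between them, for the Poisson structures $\pi_Y^{-\Omega_{\mathfrak h}|_{N^*Y}}$ and $\pi_X^{-\Omega_{\mathfrak g}|_{N^*X}}$; so the square formed by $F$, $f^*$ and the two exponential maps is a commutative square of Poisson maps around $Y$ and $X$. -/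

import Mathlib

open scoped Manifold ContDiff Topology

noncomputable section

/-! ### Embedded submanifolds of a vector space, given as subsets -/

section Submanifolds

variable {V W : Type*} [NormedAddCommGroup V] [NormedSpace ℝ V]
  [NormedAddCommGroup W] [NormedSpace ℝ W]

/-- `S ⊆ V` is a smooth embedded submanifold: around each of its points there is a smooth chart of
`V` that flattens `S` onto a linear subspace. -/
def IsEmbeddedSubmanifold (S : Set V) : Prop :=
  ∀ p ∈ S, ∃ (Φ : OpenPartialHomeomorph V V) (L : Submodule ℝ V), p ∈ Φ.source ∧
    ContDiffOn ℝ ∞ Φ Φ.source ∧ ContDiffOn ℝ ∞ Φ.symm Φ.target ∧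
    ∀ q ∈ Φ.source, (q ∈ S ↔ Φ q ∈ L)

/-- The tangent space at `p` of a subset `S ⊆ V`: the span of the velocities at `p` of the curves
in `S` through `p`. (For an embedded submanifold the velocities already form a subspace.) -/
def tangentSpaceOf (S : Set V) (p : V) : Submodule ℝ V :=
  Submodule.span ℝ {v | ∃ γ : ℝ → V, γ 0 = p ∧ HasDerivAt γ v 0 ∧ ∀ᶠ t in 𝓝 (0 : ℝ), γ t ∈ S}

/-- The annihilator, in the dual of `V`, of a subspace of `V`. -/
def annihilatorOf (T : Submodule ℝ V) : Submodule ℝ (StrongDual ℝ V) where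
  carrier := {α | ∀ v ∈ T, α v = 0}
  zero_mem' := by intro v _; rfl
  add_mem' := by
    intro a b ha hb v hv
    simp [ha v hv, hb v hv]
  smul_mem' := by
    intro c a ha v hv
    simp [ha v hv]

/-- `φ` restricts to a diffeomorphism from the submanifold `S` of `V` onto the submanifold `S'`
of `W`. -/
def IsDiffeoOn (φ : V → W) (S : Set V) (S' : Set W) : Prop :=
  ContDiffOn ℝ ∞ φ S ∧ Set.MapsTo φ S S' ∧
    ∃ ψ : W → V, ContDiffOn ℝ ∞ ψ S' ∧ Set.MapsTo ψ S' S ∧ Set.InvOn ψ φ S S'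

end Submanifolds

/-! ### Poisson structures

A bivector at a point `p` of a submanifold `S ⊆ V` is given by its sharp map, viewed in `V`: a skew
linear map `π : V^* → V` with values in `T_p S`. The bracket is `{f, g} = dg (π (df))`. -/

/-- Sharp maps `V^* → V`. -/
abbrev Bivector (V : Type*) [NormedAddCommGroup V] [NormedSpace ℝ V] : Type _ :=
  StrongDual ℝ V →L[ℝ] V

section Poisson

variable {V W : Type*} [NormedAddCommGroup V] [NormedSpace ℝ V]
  [NormedAddCommGroup W] [NormedSpace ℝ W]

/-- `π` is a smooth Poisson structure on the submanifold `S`. The Jacobi identity is required of the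
restrictions to `S` of linear functions on `V`. -/
structure IsPoissonStructureOn (S : Set V) (π : V → Bivector V) : Prop where
  submanifold : IsEmbeddedSubmanifold S
  tangent : ∀ p ∈ S, ∀ α, π p α ∈ tangentSpaceOf S p
  skew : ∀ p ∈ S, ∀ α β : StrongDual ℝ V, β (π p α) = -α (π p β)
  smooth : ContDiffOn ℝ ∞ π S
  jacobi : ∀ p ∈ S, ∀ α β γ : StrongDual ℝ V,
    fderivWithin ℝ (fun q => β (π q α)) S p (π p γ) +
      fderivWithin ℝ (fun q => γ (π q β)) S p (π p α) +
      fderivWithin ℝ (fun q => α (π q γ)) S p (π p β) = 0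

/-- `φ : (S, π) → (S', π')` is a smooth map with `φ_* π = π'` along `φ`. -/
structure IsPoissonMapOn (S : Set V) (π : V → Bivector V)
    (S' : Set W) (π' : W → Bivector W) (φ : V → W) : Prop where
  mapsTo : Set.MapsTo φ S S'
  smooth : ContDiffOn ℝ ∞ φ S
  push : ∀ p ∈ S, ∀ α : StrongDual ℝ W,
    fderivWithin ℝ φ S p (π p (α ∘L fderivWithin ℝ φ S p)) = π' (φ p) α

/-- The embedded normal space `N_p X = π^♯ (N^*_p X)`. -/
def embeddedNormal (π : V → Bivector V) (X : Set V) (p : V) : Submodule ℝ V :=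
  (annihilatorOf (tangentSpaceOf X p)).map (π p).toLinearMap

/-- `X` is a Poisson transversal of `(V, π)`: an embedded submanifold with `T X ⊕ N X = T V` along
`X`. -/
def IsPoissonTransversal (π : V → Bivector V) (X : Set V) : Prop :=
  IsEmbeddedSubmanifold X ∧ ∀ p ∈ X, IsCompl (tangentSpaceOf X p) (embeddedNormal π X p)

open Classical in
/-- The tangential component `π_X` of `π|_X = π_X + w_X`, for a Poisson transversal `X`: the
projection of `π^♯` to `T X` along `N X`. (Junk value `0` where `T X` and `N X` are not
complementary.) -/
def inducedBivector [FiniteDimensional ℝ V] (π : V → Bivector V) (X : Set V)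
    (p : V) : Bivector V :=
  if h : IsCompl (tangentSpaceOf X p) (embeddedNormal π X p) then
    LinearMap.toContinuousLinearMap (Submodule.projection _ _ h) ∘L π p
  else 0

end Poisson

/-! ### Symplectic forms, dual pairs, sprays and Dirac structures -/

theorem update_pair_zero {A : Type*} (u w v : A) : Function.update ![w, v] 0 u = ![u, v] := by
  ext i; fin_cases i <;> rfl

theorem update_pair_one {A : Type*} (u w v : A) : Function.update ![u, w] 1 v = ![u, v] := by
  ext i; fin_cases i <;> rfl

section Symplectic

variable {E V W : Type*} [NormedAddCommGroup E] [NormedSpace ℝ E]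
  [NormedAddCommGroup V] [NormedSpace ℝ V] [NormedAddCommGroup W] [NormedSpace ℝ W]

/-- Nondegeneracy of an alternating two-form. -/
def IsNondegForm (Ω : E [⋀^Fin 2]→L[ℝ] ℝ) : Prop :=
  ∀ u : E, (∀ v : E, Ω ![u, v] = 0) → u = 0

/-- The flat map `u ↦ Ω(u, ·)` of a two-form. -/
def flatMap [FiniteDimensional ℝ E] (Ω : E [⋀^Fin 2]→L[ℝ] ℝ) : E →L[ℝ] StrongDual ℝ E :=
  LinearMap.toContinuousLinearMap
    { toFun := fun u => LinearMap.toContinuousLinearMap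
        { toFun := fun v => Ω ![u, v]
          map_add' := fun v w => by
            simpa only [update_pair_one] using Ω.map_update_add ![u, 0] 1 v w
          map_smul' := fun c v => by
            simpa only [update_pair_one, RingHom.id_apply] using Ω.map_update_smul ![u, 0] 1 c v }
      map_add' := fun u w => by
        ext v
        change Ω ![u + w, v] = Ω ![u, v] + Ω ![w, v]
        simpa only [update_pair_zero] using Ω.map_update_add ![0, v] 0 u w
      map_smul' := fun c u => by
        ext v
        change Ω ![c • u, v] = c • Ω ![u, v]
        simpa only [update_pair_zero] using Ω.map_update_smul ![0, v] 0 c u }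

theorem flatMap_apply [FiniteDimensional ℝ E] (Ω : E [⋀^Fin 2]→L[ℝ] ℝ) (u v : E) :
    flatMap Ω u v = Ω ![u, v] := rfl

/-- The bivector `Ω⁻¹` of a nondegenerate two-form: `(Ω⁻¹)^♯ = (Ω^♭)⁻¹`. -/
def inverseBivector [FiniteDimensional ℝ E] (Ω : E [⋀^Fin 2]→L[ℝ] ℝ) : Bivector E :=
  (flatMap Ω).inverse

/-- `Ω` is a symplectic form on the open set `S`. -/
structure IsSymplecticOn (S : Set E) (Ω : E → E [⋀^Fin 2]→L[ℝ] ℝ) : Prop where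
  smooth : ContDiffOn ℝ ∞ Ω S
  closed : ∀ p ∈ S, extDeriv Ω p = 0
  nondeg : ∀ p ∈ S, IsNondegForm (Ω p)

/-- `(V, πs) ←s— (S, Ω) —t→ (W, πt)` is a full dual pair: `s` and `t` are Poisson maps and
surjective submersions, and their fibres are the symplectic orthogonals of each other. -/
structure IsFullDualPair [FiniteDimensional ℝ E] (S : Set E) (Ω : E → E [⋀^Fin 2]→L[ℝ] ℝ)
    (s : E → V) (πs : V → Bivector V)
    (t : E → W) (πt : W → Bivector W) : Prop where
  isOpen : IsOpen S
  symplectic : IsSymplecticOn S Ω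
  source_poisson : IsPoissonMapOn S (fun p => inverseBivector (Ω p)) Set.univ πs s
  target_poisson : IsPoissonMapOn S (fun p => inverseBivector (Ω p)) Set.univ πt t
  source_surj : s '' S = Set.univ
  target_surj : t '' S = Set.univ
  source_subm : ∀ p ∈ S, Function.Surjective (fderiv ℝ s p)
  target_subm : ∀ p ∈ S, Function.Surjective (fderiv ℝ t p)
  orth_source : ∀ p ∈ S, ∀ v,
    fderiv ℝ t p v = 0 ↔ ∀ u, fderiv ℝ s p u = 0 → Ω p ![u, v] = 0
  orth_target : ∀ p ∈ S, ∀ u,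
    fderiv ℝ s p u = 0 ↔ ∀ v, fderiv ℝ t p v = 0 → Ω p ![u, v] = 0

/-- The pullback `φ^* Ω` of a two-form. -/
def pullbackForm (φ : E → E) (Ω : E → E [⋀^Fin 2]→L[ℝ] ℝ) (p : E) : E [⋀^Fin 2]→L[ℝ] ℝ :=
  (Ω (φ p)).compContinuousLinearMap (fderiv ℝ φ p)

theorem differentiable_oneForm (L : E →L[ℝ] StrongDual ℝ E) :
    Differentiable ℝ (fun p => ContinuousAlternatingMap.ofSubsingleton ℝ E ℝ (0 : Fin 1) (L p)) :=
  (ContinuousAlternatingMap.ofSubsingletonLIE (𝕜 := ℝ) (E := E) (F := ℝ)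
    (0 : Fin 1)).differentiable.comp L.differentiable

/-- Continuous linear endomorphisms. -/
abbrev Endo (V : Type*) [NormedAddCommGroup V] [NormedSpace ℝ V] : Type _ := V →L[ℝ] V

/-- The exponential `e^A = ∑ A^n / n!` of a continuous linear operator. -/
def opExp (A : Endo E) : Endo E := NormedSpace.exp A

/-- `φ` is the flow, defined for all times, of the vector field `v`. -/
def IsCompleteFlow (φ : ℝ → E → E) (v : E → E) : Prop :=
  ∀ p, φ 0 p = p ∧ ∀ t, HasDerivAt (fun s => φ s p) (v (φ t p)) t

/-- The Dirac structure, at a point of a submanifold `S ⊆ E` with tangent space `T`, obtained by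
pulling back the graph of the bivector `π` along a map with differential `dp`, and then gauge
transforming by the two-form `σ|_T`. It consists of the pairs `(U, p^* α + ι_U σ)` with
`dp U = π^♯ α`. -/
def gaugedPullbackDirac (T : Submodule ℝ E) (dp : E →L[ℝ] V) (π : Bivector V)
    (σ : E [⋀^Fin 2]→L[ℝ] ℝ) : Set (T × StrongDual ℝ T) :=
  {w | ∃ α : StrongDual ℝ V, dp w.1 = π α ∧ ∀ Z : T, w.2 Z = α (dp Z) + σ ![(w.1 : E), (Z : E)]}

/-- The Dirac structure `{(π^♯ θ, θ)}` of a bivector `π`, at a point with tangent space `T`. -/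
def bivectorDirac (T : Submodule ℝ E) (π : Bivector E) :
    Set (T × StrongDual ℝ T) :=
  {w | ∃ θ : StrongDual ℝ E, (w.1 : E) = π θ ∧ ∀ Z : T, w.2 Z = θ Z}

end Symplectic

/-! ### Linear Poisson structures -/

/-- A real Lie algebra with a norm on its underlying vector space. In the finite-dimensional case
the norm only serves to give the space its usual topology and smooth structure: every
finite-dimensional real Lie algebra carries one, all of them are equivalent, and no compatibility
with the bracket is asked. -/
class NormedLieAlgebra (𝔤 : Type*) extends
  NormedAddCommGroup 𝔤, LieRing 𝔤, NormedSpace ℝ 𝔤, LieAlgebra ℝ 𝔤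

section Linear

variable {𝔤 : Type*} [NormedLieAlgebra 𝔤] [FiniteDimensional ℝ 𝔤]

/-- The adjoint operator, with the sign convention `ad_x y = -[x, y]` (the bracket of `𝔤` being
thought of as that of right invariant vector fields). -/
def lieAd (x : 𝔤) : Endo 𝔤 := LinearMap.toContinuousLinearMap (-(LieAlgebra.ad ℝ 𝔤 x))

theorem lieAd_apply (x y : 𝔤) : lieAd x y = -⁅x, y⁆ := rfl

/-- The dual operator `ad_x^* ξ = ξ ∘ ad_x`. -/
def lieCoad (x : 𝔤) : Endo (StrongDual ℝ 𝔤) :=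
  ContinuousLinearMap.precomp ℝ (lieAd x)

theorem lieCoad_apply (x y : 𝔤) (ξ : StrongDual ℝ 𝔤) : lieCoad x ξ y = -ξ ⁅x, y⁆ := by
  change ξ (lieAd x y) = _
  rw [lieAd_apply, map_neg]

/-- The linear Poisson structure `π_ξ = ξ ∘ [·, ·]` on `𝔤^*`, as a map from `T^*_ξ 𝔤^* = 𝔤^{**}`
to `𝔤^*`; on covectors coming from `𝔤` see `linearPoisson_inclusion`. -/
def linearPoisson (ξ : StrongDual ℝ 𝔤) : Bivector (StrongDual ℝ 𝔤) :=
  LinearMap.toContinuousLinearMap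
    { toFun := fun Θ : StrongDual ℝ (StrongDual ℝ 𝔤) => LinearMap.toContinuousLinearMap
        { toFun := fun y : 𝔤 => Θ (lieCoad y ξ)
          map_add' := fun y z => by
            rw [← map_add]; congr 1; ext w; simp [lieCoad_apply, add_comm]
          map_smul' := fun c y => by
            rw [RingHom.id_apply, ← map_smul]; congr 1; ext w; simp [lieCoad_apply] }
      map_add' := fun Θ Θ' => by ext y; simp
      map_smul' := fun c Θ => by ext y; simp }

theorem linearPoisson_inclusion (ξ : StrongDual ℝ 𝔤) (x y : 𝔤) :
    linearPoisson ξ (NormedSpace.inclusionInDoubleDual ℝ 𝔤 x) y = ξ ⁅x, y⁆ := by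
  change lieCoad y ξ x = _
  rw [lieCoad_apply, ← lie_skew, map_neg, neg_neg]

/-- `v` is a spray for the linear Poisson structure, under `T^* 𝔤^* = 𝔤 × 𝔤^*` (the bundle
projection being the second projection and fibrewise multiplication acting on the first factor):
`m_t^* v = t v` for `t > 0`, and `pr_* v(x, ξ) = π_ξ^♯ x`. -/
structure IsPoissonSpray (v : 𝔤 × StrongDual ℝ 𝔤 → 𝔤 × StrongDual ℝ 𝔤) : Prop where
  smooth : ContDiff ℝ ∞ v
  homogeneous : ∀ t : ℝ, 0 < t →
    VectorField.pullback ℝ (fun p : 𝔤 × StrongDual ℝ 𝔤 => (t • p.1, p.2)) v = t • v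
  projects : ∀ p : 𝔤 × StrongDual ℝ 𝔤,
    (v p).2 = linearPoisson p.2 (NormedSpace.inclusionInDoubleDual ℝ 𝔤 p.1)

/-- The canonical spray `(x, ξ) ↦ (0, -ad_x^* ξ)`. -/
def canonicalSpray (p : 𝔤 × StrongDual ℝ 𝔤) : 𝔤 × StrongDual ℝ 𝔤 :=
  (0, -lieCoad p.1 p.2)

/-- The map `φ_t (x, ξ) = (x, e^{-t ad_x^*} ξ)`. -/
def sprayFlow (t : ℝ) (p : 𝔤 × StrongDual ℝ 𝔤) : 𝔤 × StrongDual ℝ 𝔤 :=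
  (p.1, opExp (-t • lieCoad p.1) p.2)

/-- The spray exponential: the time-one flow followed by the bundle projection. -/
def sprayExp (p : 𝔤 × StrongDual ℝ 𝔤) : StrongDual ℝ 𝔤 := (sprayFlow 1 p).2

variable (𝔤) in
/-- The tautological one-form on `T^* 𝔤^* = 𝔤 × 𝔤^*`: at `(x, ξ)` it sends `(y, η)` to `η x`. -/
def tautologicalForm (p : 𝔤 × StrongDual ℝ 𝔤) : (𝔤 × StrongDual ℝ 𝔤) [⋀^Fin 1]→L[ℝ] ℝ :=
  ContinuousAlternatingMap.ofSubsingleton ℝ (𝔤 × StrongDual ℝ 𝔤) ℝ (0 : Fin 1)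
    (NormedSpace.inclusionInDoubleDual ℝ 𝔤 p.1 ∘L ContinuousLinearMap.snd ℝ 𝔤 (StrongDual ℝ 𝔤))

variable (𝔤) in
/-- The canonical symplectic form `ω_can = -dλ_can`; it is evaluated in `canonicalForm_apply`. -/
def canonicalForm (p : 𝔤 × StrongDual ℝ 𝔤) : (𝔤 × StrongDual ℝ 𝔤) [⋀^Fin 2]→L[ℝ] ℝ :=
  -extDeriv (tautologicalForm 𝔤) p

variable (𝔤) in
/-- The averaged two-form `Ω_𝔤 = ∫_0^1 φ_t^* ω_can dt`. -/
def averagedForm (p : 𝔤 × StrongDual ℝ 𝔤) : (𝔤 × StrongDual ℝ 𝔤) [⋀^Fin 2]→L[ℝ] ℝ :=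
  ∫ t in (0 : ℝ)..1, pullbackForm (sprayFlow t) (canonicalForm 𝔤) p

/-- The operator `Ξ_x = ∫_0^1 e^{-t ad_x} dt`. -/
def lieXi (x : 𝔤) : Endo 𝔤 := ∫ t in (0 : ℝ)..1, opExp (-t • lieAd x)

/-- The conormal bundle `N^* X ⊆ 𝔤 × X` of `X ⊆ 𝔤^*`. -/
def conormalBundle (X : Set (StrongDual ℝ 𝔤)) : Set (𝔤 × StrongDual ℝ 𝔤) :=
  {p | p.2 ∈ X ∧ ∀ v ∈ tangentSpaceOf X p.2, v p.1 = 0}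

/-- `P` is the bivector `π_X^σ`, `σ = -Ω_𝔤|_{N^* X}`, at `n ∈ N^* X`: its graph is the pullback to
`N^* X` of the graph of `π_X`, gauge transformed by `σ`. -/
def IsModelBivectorAt (X : Set (StrongDual ℝ 𝔤)) (n : 𝔤 × StrongDual ℝ 𝔤)
    (P : Bivector (𝔤 × StrongDual ℝ 𝔤)) : Prop :=
  bivectorDirac (tangentSpaceOf (conormalBundle X) n) P =
    gaugedPullbackDirac (tangentSpaceOf (conormalBundle X) n)
      (ContinuousLinearMap.snd ℝ 𝔤 (StrongDual ℝ 𝔤))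
      (inducedBivector linearPoisson X n.2) (-averagedForm 𝔤 n)

/-- `U` is an open neighbourhood of (the zero section) `X` in `N^* X`, the model `π_X^σ`,
`σ = -Ω_𝔤|_{N^* X}`, is a Poisson structure on `U`, equal to `P`, and the spray exponential is a
Poisson diffeomorphism from `(U, P)` onto an open subset of `(𝔤^*, π_𝔤)`. -/
structure IsNormalFormOn (X : Set (StrongDual ℝ 𝔤)) (U : Set (𝔤 × StrongDual ℝ 𝔤))
    (P : 𝔤 × StrongDual ℝ 𝔤 →
      Bivector (𝔤 × StrongDual ℝ 𝔤)) : Prop where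
  isOpen : ∃ O : Set (𝔤 × StrongDual ℝ 𝔤), IsOpen O ∧ U = conormalBundle X ∩ O
  zero_mem : ∀ ξ ∈ X, ((0 : 𝔤), ξ) ∈ U
  poisson : IsPoissonStructureOn U P
  model : ∀ n ∈ U, IsModelBivectorAt X n (P n)
  poissonMap : IsPoissonMapOn U P Set.univ linearPoisson sprayExp
  diffeo : ∃ W : Set (StrongDual ℝ 𝔤), IsOpen W ∧ IsDiffeoOn sprayExp U W

/-- The dual map `f^* : 𝔥^* → 𝔤^*` of a Lie algebra morphism. -/
def dualMapOf {𝔥 : Type*} [NormedLieAlgebra 𝔥] (f : 𝔤 →ₗ⁅ℝ⁆ 𝔥) :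
    StrongDual ℝ 𝔥 →L[ℝ] StrongDual ℝ 𝔤 :=
  ContinuousLinearMap.precomp ℝ (LinearMap.toContinuousLinearMap (f : 𝔤 →ₗ[ℝ] 𝔥))

theorem dualMapOf_apply {𝔥 : Type*} [NormedLieAlgebra 𝔥] (f : 𝔤 →ₗ⁅ℝ⁆ 𝔥) (ξ : StrongDual ℝ 𝔥)
    (x : 𝔤) : dualMapOf f ξ x = ξ (f x) := rfl

end Linear

theorem canonicalForm_apply {𝔤 : Type*} [NormedLieAlgebra 𝔤]
    (p : 𝔤 × StrongDual ℝ 𝔤) (x y : 𝔤) (ξ η : StrongDual ℝ 𝔤) :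
    canonicalForm 𝔤 p ![(x, ξ), (y, η)] = ξ y - η x := by
  have hd : DifferentiableAt ℝ (tautologicalForm 𝔤) p := by
    exact differentiable_oneForm
      (((ContinuousLinearMap.snd ℝ 𝔤 (StrongDual ℝ 𝔤)).precomp ℝ) ∘L
        NormedSpace.inclusionInDoubleDual ℝ 𝔤 ∘L ContinuousLinearMap.fst ℝ 𝔤 (StrongDual ℝ 𝔤)) p
  have hf : ∀ v : Fin 1 → 𝔤 × StrongDual ℝ 𝔤, fderiv ℝ (fun q => tautologicalForm 𝔤 q v) p =
      (v 0).2 ∘L ContinuousLinearMap.fst ℝ 𝔤 (StrongDual ℝ 𝔤) := fun v =>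
    ((v 0).2 ∘L ContinuousLinearMap.fst ℝ 𝔤 (StrongDual ℝ 𝔤)).hasFDerivAt.fderiv
  rw [canonicalForm, ContinuousAlternatingMap.neg_apply, extDeriv_apply hd]
  simp only [hf]
  simp [Fin.removeNth, sub_eq_add_neg]

/-! ### The Lie-theoretic exponential map -/

section LieGroups

variable {E : Type*} [NormedAddCommGroup E] [NormedSpace ℝ E]
  {G : Type*} [TopologicalSpace G] [ChartedSpace E G] [Group G]

instance [LieGroup 𝓘(ℝ, E) ∞ G] : LieGroup 𝓘(ℝ, E) (minSmoothness ℝ 3) G :=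
  LieGroup.of_le (n := ∞) (by simp only [minSmoothness_of_isRCLikeNormedField]; exact ENat.LEInfty.out)

open Classical in
/-- The exponential map of a Lie group: `exp v = γ 1`, for the integral curve `γ` through `1` of the
left invariant vector field of `v`. (This curve exists and is unique in every Lie group.) -/
def lieExp (v : GroupLieAlgebra 𝓘(ℝ, E) G) : G :=
  if h : ∃ γ : ℝ → G, γ 0 = 1 ∧
      IsMIntegralCurve (I := 𝓘(ℝ, E)) γ (mulInvariantVectorField (I := 𝓘(ℝ, E)) v) then
    h.choose 1
  else 1

/-- The set of points of `𝔤` at which the exponential map of a Lie group `G`, whose Lie algebra is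
identified with `𝔤` by `e`, is a local diffeomorphism. (Replacing `e` by `-e`, that is, using right
instead of left invariant vector fields for the bracket, does not change this set.) -/
def lieExpRegular {𝔤 : Type*} [NormedLieAlgebra 𝔤] [CompleteSpace E] [LieGroup 𝓘(ℝ, E) ∞ G]
    (e : 𝔤 ≃ₗ⁅ℝ⁆ GroupLieAlgebra 𝓘(ℝ, E) G) : Set 𝔤 :=
  {x | IsLocalDiffeomorphAt 𝓘(ℝ, 𝔤) 𝓘(ℝ, E) ∞ (fun y : 𝔤 => lieExp (e y)) x}

end LieGroups

end

/-! Everything is expressed through A_t = e^{t[x, ·]} (`adExp`) and Ξ_t = ∫_0^t A_s ds (`adXi`). The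
A_t are automorphisms of 𝔤 (`adExp_lie`), so Duhamel's formula collapses to D_y A_t = [Ξ_t y, A_t ·]
(`fderiv_adExp`), and antisymmetrising the derivative of Ξ_t gives the Maurer-Cartan equation
(`fderiv_adXi_sub`). Since φ_t(x, ξ) = (x, ξ ∘ A_t), the first identity exhibits φ_t^*ω_can as the
t-derivative of the explicit expression with Ξ_t in place of Ξ, which integrates to the formula for
Ω (`averagedForm_apply`). The second exhibits Ω as the differential of the one-form (y, η) ↦ ξ(Ξ_1
y), so Ω is closed. By the formula, Ω is nondegenerate exactly where Ξ_1 is injective, and the dual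
pair becomes linear algebra with explicit Ω-dual vectors.

A Lie group enters only through the fact that exp is a local diffeomorphism at x iff Ξ_1 is
injective there (`mem_lieExpRegular_iff`). Write exp(x + w) = exp(x) k(w). In a chart at the
identity, the quotient of the two one-parameter subgroups solves h' = L(h)(x + w) - R(h)x, with L
and R the left and right invariant frames. The linearisation at 0 is h' = [-x, h] + w, so k has
derivative ∫_0^1 e^{-s[x, ·]} ds = A_{-1} Ξ_1 at 0 (`exists_lieExp_add`). Small solutions on a fixed
time interval and their first order expansion come from variation of constants and Picard iteration.
Smoothness of exp then follows by bootstrapping its derivative formula.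

For the normal form, the spray exponential has derivative (x, η) ↦ η + ξ ∘ [x, ·] at (0, ξ), and
maps the tangent space N^*X × TX of the conormal bundle isomorphically onto NX ⊕ TX. Local inverses
glue around the zero section, and π_𝔤 is transported through the glued inverse. That this yields the
gauge transformed model is a pointwise statement: under the substitution A_1 β = Z + Ξ_1 U_1, the
conditions d exp(U) = π^♯β and U_2 = π^♯Z are equivalent, and they imply exp^*β = pr^*Z - ι_U Ω
(`fderiv_sprayExp_eq_iff`, `fderiv_sprayExp_apply_eq`). Nondegeneracy of Ω plays no role in it.

A morphism f commutes with A_t and Ξ_t, which are built from the bracket alone; this gives the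
commuting square and the pullback of two-forms. It is injective on N^*X because f^*μ kills brackets
with ker f (`eq_zero_of_map_eq_zero`), and transversality and the rest of the linear algebra follow
by duality. Through the exponentials F corresponds to f^*, so it is Poisson because f^* is. -/

noncomputable section

/-! ### Smooth dependence of integrals on parameters -/

section ParametricIntegrals

universe u
variable {H : Type u} [NormedAddCommGroup H] [NormedSpace ℝ H] [FiniteDimensional ℝ H]

theorem hasFDerivAt_intervalIntegral_of_contDiff {E : Type u} [NormedAddCommGroup E]
    [NormedSpace ℝ E] {F : H → ℝ → E}
    (hF : ContDiff ℝ ∞ (fun p : H × ℝ => F p.1 p.2)) (a b : ℝ) (x₀ : H) :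
    HasFDerivAt (fun x => ∫ t in a..b, F x t) (∫ t in a..b, fderiv ℝ (fun x => F x t) x₀) x₀ := by
  have hdiff : ∀ t, Differentiable ℝ (fun x => F x t) := fun t =>
    (hF.comp (contDiff_id.prodMk contDiff_const)).differentiable (by simp)
  have hD : Continuous (fun p : H × ℝ => fderiv ℝ (fun x => F x p.2) p.1) := by
    have h := ContDiff.fderiv (n := ∞) (m := ∞) (f := fun (p : H × ℝ) (x : H) => F x p.2)
      (g := fun p : H × ℝ => p.1)
      (hF.comp (contDiff_snd.prodMk (contDiff_snd.comp contDiff_fst))) contDiff_fst (by simp)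
    exact h.continuous
  obtain ⟨K, hK, hK'⟩ := exists_compact_mem_nhds x₀
  obtain ⟨C, hC⟩ := (hK.prod (isCompact_uIcc (a := a) (b := b))).exists_bound_of_continuousOn
    hD.continuousOn
  refine (intervalIntegral.hasFDerivAt_integral_of_dominated_of_fderiv_le
    (F := F) (F' := fun x t => fderiv ℝ (fun x => F x t) x) (bound := fun _ => C) hK'
    (Filter.Eventually.of_forall fun x => ?_) ?_ ?_ ?_ ?_ ?_)
  · exact (hF.continuous.comp (by fun_prop : Continuous fun t : ℝ => (x, t))).aestronglyMeasurable
  · exact (hF.continuous.comp (by fun_prop : Continuous fun t : ℝ => (x₀, t))).intervalIntegrable _ _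
  · exact (hD.comp (by fun_prop : Continuous fun t : ℝ => (x₀, t))).aestronglyMeasurable
  · refine Filter.Eventually.of_forall fun t ht x hx => hC (x, t) ⟨hx, ?_⟩
    exact Set.uIoc_subset_uIcc ht
  · exact intervalIntegrable_const
  · exact Filter.Eventually.of_forall fun t _ x _ => (hdiff t x).hasFDerivAt

/-- Induction on the order of smoothness: the derivative is again a parametric integral, with values
in `H →L[ℝ] E`. For this reason `E` is generalized and shares its universe with `H`. -/
theorem contDiff_intervalIntegral {E : Type u} [NormedAddCommGroup E]
    [NormedSpace ℝ E] {F : H → ℝ → E}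
    (hF : ContDiff ℝ ∞ (fun p : H × ℝ => F p.1 p.2)) (a b : ℝ) :
    ContDiff ℝ ∞ (fun x => ∫ t in a..b, F x t) := by
  rw [contDiff_infty]
  intro n
  induction n generalizing E with
  | zero =>
    exact contDiff_zero.2 (continuous_iff_continuousAt.2 fun x =>
      (hasFDerivAt_intervalIntegral_of_contDiff hF a b x).continuousAt)
  | succ n ih =>
    rw [Nat.cast_succ, contDiff_succ_iff_fderiv]
    refine ⟨fun x => (hasFDerivAt_intervalIntegral_of_contDiff hF a b x).differentiableAt,
      by simp, ?_⟩
    have : fderiv ℝ (fun x => ∫ t in a..b, F x t) =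
        fun x => ∫ t in a..b, fderiv ℝ (fun x => F x t) x :=
      funext fun x => (hasFDerivAt_intervalIntegral_of_contDiff hF a b x).fderiv
    rw [this]
    refine ih ?_
    exact ContDiff.fderiv (n := ∞) (m := ∞) (f := fun (p : H × ℝ) (x : H) => F x p.2)
      (g := fun p : H × ℝ => p.1)
      (hF.comp (contDiff_snd.prodMk (contDiff_snd.comp contDiff_fst))) contDiff_fst (by simp)

end ParametricIntegrals

/-! ### The exponential in a Banach algebra and its derivative -/

section BanachAlgebra

open NormedSpace

variable {A : Type*} [NormedRing A] [NormedAlgebra ℝ A] [CompleteSpace A]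

theorem contDiff_normedSpace_exp : ContDiff ℝ ∞ (exp : A → A) :=
  contDiff_iff_contDiffAt.2 fun x => (exp_analytic (𝕂 := ℝ) x).contDiffAt

theorem exp_smul_mul_exp_neg_smul (t : ℝ) (x : A) : exp (t • x) * exp (-t • x) = 1 := by
  have := NormedAlgebra.restrictScalars ℚ ℝ A
  rw [← exp_add_of_commute ((Commute.refl x).smul_left _ |>.smul_right _), ← add_smul]
  simp

theorem exp_neg_smul_mul_exp_smul (t : ℝ) (x : A) : exp (-t • x) * exp (t • x) = 1 := by
  simpa using exp_smul_mul_exp_neg_smul (-t) x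

theorem exp_add_smul (s t : ℝ) (x : A) : exp ((s + t) • x) = exp (s • x) * exp (t • x) := by
  have := NormedAlgebra.restrictScalars ℚ ℝ A
  rw [← exp_add_of_commute ((Commute.refl x).smul_left _ |>.smul_right _), ← add_smul]

theorem continuous_exp_smul : Continuous (fun p : ℝ × A => exp (p.1 • p.2)) :=
  contDiff_normedSpace_exp.continuous.comp continuous_smul

/-- Duhamel's formula. -/
theorem exp_smul_add_sub (t : ℝ) (x h : A) :
    exp (t • (x + h)) - exp (t • x) =
      ∫ s in (0 : ℝ)..t, exp (s • (x + h)) * h * exp ((t - s) • x) := by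
  -- The product e^{s(x+h)} e^{(t-s)x} interpolates between the two exponentials, and its derivative
  -- is the integrand.
  have hd : ∀ s : ℝ, HasDerivAt (fun s : ℝ => exp (s • (x + h)) * exp ((t - s) • x))
      (exp (s • (x + h)) * h * exp ((t - s) • x)) s := fun s => by
    have h1 := hasDerivAt_exp_smul_const (𝕂 := ℝ) (x + h) s
    have h2 := (hasDerivAt_exp_smul_const' (𝕂 := ℝ) x (t - s)).scomp s
      ((hasDerivAt_id s).const_sub t)
    refine (h1.mul h2).congr_deriv ?_
    simp only [neg_smul, one_smul, mul_neg, Function.comp_apply]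
    noncomm_ring
  have hc : Continuous fun s : ℝ => exp (s • (x + h)) * h * exp ((t - s) • x) := by
    have h1 : Continuous fun s : ℝ => exp (s • (x + h)) :=
      continuous_exp_smul.comp (by fun_prop : Continuous fun s : ℝ => (s, x + h))
    have h2 : Continuous fun s : ℝ => exp ((t - s) • x) :=
      continuous_exp_smul.comp (by fun_prop : Continuous fun s : ℝ => (t - s, x))
    fun_prop
  rw [intervalIntegral.integral_eq_sub_of_hasDerivAt (fun s _ => hd s)
    (hc.intervalIntegrable _ _)]
  simp

/-- Duhamel's formula for the increment r h, divided by r: the difference quotient is an integral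
depending continuously on r, so its limit is the value at r = 0. -/
theorem fderiv_exp_smul (t : ℝ) (x h : A) :
    fderiv ℝ (fun y : A => exp (t • y)) x h =
      ∫ s in (0 : ℝ)..t, exp (s • x) * h * exp ((t - s) • x) := by
  have hd : DifferentiableAt ℝ (fun y : A => exp (t • y)) x :=
    (contDiff_normedSpace_exp.comp (contDiff_const_smul t)).differentiable (by simp) x
  have hl : HasDerivAt (fun r : ℝ => exp (t • (x + r • h)))
      (fderiv ℝ (fun y : A => exp (t • y)) x h) 0 := by
    have h1 : HasDerivAt (fun r : ℝ => x + r • h) h 0 := by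
      simpa using ((hasDerivAt_id (0 : ℝ)).smul_const h).const_add x
    have h2 : HasFDerivAt (fun y : A => exp (t • y)) (fderiv ℝ (fun y : A => exp (t • y)) x)
        (x + (0 : ℝ) • h) := by simpa using hd.hasFDerivAt
    exact HasFDerivAt.comp_hasDerivAt (f := fun r : ℝ => x + r • h) (l := fun y : A => exp (t • y))
      (0 : ℝ) h2 h1
  have hI : Continuous fun r : ℝ =>
      ∫ s in (0 : ℝ)..t, exp (s • (x + r • h)) * h * exp ((t - s) • x) := by
    refine intervalIntegral.continuous_parametric_intervalIntegral_of_continuous' ?_ _ _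
    have h1 : Continuous fun p : ℝ × ℝ => exp (p.2 • (x + p.1 • h)) :=
      continuous_exp_smul.comp (by fun_prop : Continuous fun p : ℝ × ℝ => (p.2, x + p.1 • h))
    have h2 : Continuous fun p : ℝ × ℝ => exp ((t - p.2) • x) :=
      continuous_exp_smul.comp (by fun_prop : Continuous fun p : ℝ × ℝ => (t - p.2, x))
    exact (h1.mul continuous_const).mul h2
  have hs := hl.tendsto_slope
  have hs' : Filter.Tendsto (slope (fun r : ℝ => exp (t • (x + r • h))) 0) (𝓝[≠] 0)
      (𝓝 (∫ s in (0 : ℝ)..t, exp (s • x) * h * exp ((t - s) • x))) := by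
    have h0 := (hI.tendsto 0).mono_left (nhdsWithin_le_nhds (s := {0}ᶜ))
    simp only [zero_smul, add_zero] at h0
    refine h0.congr' ?_
    filter_upwards [self_mem_nhdsWithin] with r hr
    have hr : r ≠ 0 := hr
    rw [slope_def_module]
    simp only [zero_smul, add_zero, sub_zero]
    rw [exp_smul_add_sub]
    simp only [mul_smul_comm, smul_mul_assoc]
    rw [intervalIntegral.integral_smul, smul_smul, inv_mul_cancel₀ hr, one_smul]
  exact tendsto_nhds_unique hs hs'

/-- Termwise integration of the exponential series, dominated on [0, 1] by the norms of its terms at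
t = 1. -/
theorem hasSum_integral_exp_smul (x : A) :
    HasSum (fun n : ℕ => (((n + 1).factorial : ℝ)⁻¹) • x ^ n) (∫ t in (0 : ℝ)..1, exp (t • x)) := by
  have key := intervalIntegral.hasSum_integral_of_dominated_convergence
    (μ := MeasureTheory.volume) (a := 0) (b := 1)
    (F := fun (n : ℕ) (t : ℝ) => ((n.factorial : ℝ)⁻¹) • (t • x) ^ n)
    (f := fun t => exp (t • x)) (fun n _ => ‖((n.factorial : ℝ)⁻¹) • x ^ n‖)
    (fun n => (by fun_prop : Continuous _).aestronglyMeasurable)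
    (fun n => Filter.Eventually.of_forall fun t ht => ?_)
    (Filter.Eventually.of_forall fun t _ => norm_expSeries_summable' (𝕂 := ℝ) x)
    intervalIntegrable_const
    (Filter.Eventually.of_forall fun t _ => exp_series_hasSum_exp' (𝕂 := ℝ) (t • x))
  · refine key.congr_fun ?_ |> fun h => h
    intro n
    simp only [smul_pow]
    rw [intervalIntegral.integral_smul, intervalIntegral.integral_smul_const, integral_pow]
    simp only [one_pow, smul_smul, Nat.factorial_succ]
    congr 1
    push_cast
    rw [zero_pow (by omega), mul_inv]
    field_simp
    simp
  · rw [smul_pow, norm_smul, norm_smul, norm_smul]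
    have h0 : 0 < t ∧ t ≤ 1 := by simpa using ht
    have h1 : ‖t ^ n‖ ≤ 1 := by
      rw [norm_pow, Real.norm_of_nonneg h0.1.le]; exact pow_le_one₀ h0.1.le h0.2
    have h2 : ‖t ^ n‖ * ‖x ^ n‖ ≤ ‖x ^ n‖ := mul_le_of_le_one_left (norm_nonneg _) h1
    gcongr

end BanachAlgebra

/-! ### The operators e^{t[x, ·]} and their integrals -/

section LieExponential

open NormedSpace

variable {𝔤 : Type*} [NormedLieAlgebra 𝔤] [FiniteDimensional ℝ 𝔤]

variable (𝔤) in
/-- The Lie bracket as a continuous bilinear map. -/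
def bracketL : 𝔤 →L[ℝ] Endo 𝔤 :=
  LinearMap.toContinuousLinearMap
    { toFun := fun x => LinearMap.toContinuousLinearMap (LieAlgebra.ad ℝ 𝔤 x : 𝔤 →ₗ[ℝ] 𝔤)
      map_add' := fun x y => by ext z; simp
      map_smul' := fun c x => by ext z; simp }

@[simp] theorem bracketL_apply (x y : 𝔤) : bracketL 𝔤 x y = ⁅x, y⁆ := rfl

theorem neg_lieAd (x : 𝔤) : -lieAd x = bracketL 𝔤 x := by ext y; simp [lieAd_apply]

theorem neg_smul_lieAd (t : ℝ) (x : 𝔤) : -t • lieAd x = t • bracketL 𝔤 x := by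
  rw [← neg_lieAd]; simp

/-- The operator `e^{t [x, ·]}`. -/
def adExp (t : ℝ) (x : 𝔤) : Endo 𝔤 := exp (t • bracketL 𝔤 x)

/-- The operator `∫_0^t e^{s [x, ·]} ds`. -/
def adXi (t : ℝ) (x : 𝔤) : Endo 𝔤 := ∫ s in (0 : ℝ)..t, adExp s x

theorem opExp_neg_smul_lieAd (t : ℝ) (x : 𝔤) : opExp (-t • lieAd x) = adExp t x := by
  rw [neg_smul_lieAd]; rfl

theorem lieXi_eq (x : 𝔤) : lieXi x = adXi 1 x := by
  simp only [lieXi, adXi, opExp_neg_smul_lieAd]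

@[simp] theorem adExp_zero (x : 𝔤) : adExp 0 x = 1 := by simp [adExp]

@[simp] theorem adExp_zero_right (t : ℝ) : adExp t (0 : 𝔤) = 1 := by simp [adExp]

@[simp] theorem adXi_zero (x : 𝔤) : adXi 0 x = 0 := by simp [adXi]

theorem adXi_zero_right (t : ℝ) : adXi t (0 : 𝔤) = t • 1 := by simp [adXi]

theorem contDiff_adExp : ContDiff ℝ ∞ (fun p : 𝔤 × ℝ => adExp p.2 p.1) :=
  contDiff_normedSpace_exp.comp (contDiff_snd.smul ((bracketL 𝔤).contDiff.comp contDiff_fst))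

theorem continuous_adExp (x : 𝔤) : Continuous (fun t => adExp t x) :=
  contDiff_adExp.continuous.comp (by fun_prop : Continuous fun t : ℝ => (x, t))

theorem continuous_adExp_apply (x y : 𝔤) : Continuous (fun t => adExp t x y) :=
  (continuous_adExp x).clm_apply continuous_const

theorem contDiff_adXi (t : ℝ) : ContDiff ℝ ∞ (fun x : 𝔤 => adXi t x) :=
  contDiff_intervalIntegral (F := fun x s => adExp s x) contDiff_adExp 0 t

theorem hasDerivAt_adExp (t : ℝ) (x : 𝔤) :
    HasDerivAt (fun s => adExp s x) (bracketL 𝔤 x * adExp t x) t :=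
  hasDerivAt_exp_smul_const' (𝕂 := ℝ) (bracketL 𝔤 x) t

theorem hasDerivAt_adExp_apply (t : ℝ) (x y : 𝔤) :
    HasDerivAt (fun s => adExp s x y) ⁅x, adExp t x y⁆ t := by
  simpa using (hasDerivAt_adExp t x).clm_apply (hasDerivAt_const t y)

theorem hasDerivAt_adXi (t : ℝ) (x : 𝔤) : HasDerivAt (fun s => adXi s x) (adExp t x) t :=
  intervalIntegral.integral_hasDerivAt_right ((continuous_adExp x).intervalIntegrable _ _)
    (continuous_adExp x).aestronglyMeasurable.stronglyMeasurableAtFilter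
    (continuous_adExp x).continuousAt

theorem hasDerivAt_adXi_apply (t : ℝ) (x y : 𝔤) :
    HasDerivAt (fun s => adXi s x y) (adExp t x y) t := by
  simpa using (hasDerivAt_adXi t x).clm_apply (hasDerivAt_const t y)

theorem adXi_apply (t : ℝ) (x y : 𝔤) : adXi t x y = ∫ s in (0 : ℝ)..t, adExp s x y :=
  (ContinuousLinearMap.intervalIntegral_apply ((continuous_adExp x).intervalIntegrable _ _) y)

theorem adExp_neg_apply_adExp (t : ℝ) (x y : 𝔤) : adExp (-t) x (adExp t x y) = y :=
  DFunLike.congr_fun (exp_neg_smul_mul_exp_smul t (bracketL 𝔤 x)) y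

theorem adExp_apply_adExp_neg (t : ℝ) (x y : 𝔤) : adExp t x (adExp (-t) x y) = y :=
  DFunLike.congr_fun (exp_smul_mul_exp_neg_smul t (bracketL 𝔤 x)) y

theorem HasDerivAt.lie {u v : ℝ → 𝔤} {u' v' : 𝔤} {t : ℝ} (hu : HasDerivAt u u' t)
    (hv : HasDerivAt v v' t) : HasDerivAt (fun s => ⁅u s, v s⁆) (⁅u', v t⁆ + ⁅u t, v'⁆) t := by
  simpa using ((bracketL 𝔤).hasFDerivAt.comp_hasDerivAt t hu).clm_apply hv

/-- The operators `e^{t [x, ·]}` are automorphisms. -/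
theorem adExp_lie (t : ℝ) (x y z : 𝔤) : adExp t x ⁅y, z⁆ = ⁅adExp t x y, adExp t x z⁆ := by
  -- By the Leibniz rule for [x, ·], that is the Jacobi identity, A_{-s}[A_s y, A_s z] does not
  -- depend on s.
  have hd : ∀ s : ℝ, HasDerivAt (fun s => adExp (-s) x ⁅adExp s x y, adExp s x z⁆) 0 s := by
    intro s
    have h1 := ((hasDerivAt_exp_smul_const (𝕂 := ℝ) (bracketL 𝔤 x) (-s)).scomp s
      (hasDerivAt_neg s)).clm_apply
      ((hasDerivAt_adExp_apply s x y).lie (hasDerivAt_adExp_apply s x z))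
    refine h1.congr_deriv ?_
    simp only [← leibniz_lie, neg_smul, one_smul, Function.comp_apply]
    exact neg_add_cancel _
  have hc := is_const_of_deriv_eq_zero (fun s => (hd s).differentiableAt)
    (fun s => (hd s).deriv) t 0
  simp only [neg_zero, adExp_zero, one_apply_eq_self] at hc
  rw [← hc, adExp_apply_adExp_neg]

theorem adExp_apply_add (s t : ℝ) (x y : 𝔤) : adExp (s + t) x y = adExp s x (adExp t x y) :=
  DFunLike.congr_fun (exp_add_smul s t (bracketL 𝔤 x)) y

theorem differentiable_adExp (t : ℝ) : Differentiable ℝ (fun x : 𝔤 => adExp t x) :=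
  (contDiff_adExp.comp (contDiff_id.prodMk contDiff_const)).differentiable (by simp)

/-- In Duhamel's integrand the automorphism property turns A_s [y, A_{t-s} z] into [A_s y, A_t z];
the second entry no longer depends on s, and the first integrates to Ξ_t y. -/
theorem fderiv_adExp (t : ℝ) (x y z : 𝔤) :
    fderiv ℝ (fun x => adExp t x) x y z = ⁅adXi t x y, adExp t x z⁆ := by
  have h0 : (fun x : 𝔤 => adExp t x) = (fun B : Endo 𝔤 => exp (t • B)) ∘ bracketL 𝔤 := rfl
  have hd : DifferentiableAt ℝ (fun B : Endo 𝔤 => exp (t • B)) (bracketL 𝔤 x) :=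
    (contDiff_normedSpace_exp.comp (contDiff_const_smul t)).differentiable (by simp) _
  rw [h0, fderiv_comp _ hd (bracketL 𝔤).differentiableAt, ContinuousLinearMap.comp_apply,
    ContinuousLinearMap.fderiv]
  refine (congrArg (fun B : Endo 𝔤 => B z)
    (fderiv_exp_smul t (bracketL 𝔤 x) (bracketL 𝔤 y))).trans ?_
  have hc : Continuous fun s : ℝ =>
      adExp s x * bracketL 𝔤 y * adExp (t - s) x :=
    ((continuous_adExp x).mul continuous_const).mul
      ((continuous_adExp x).comp (by fun_prop : Continuous fun s : ℝ => t - s))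
  refine (ContinuousLinearMap.intervalIntegral_apply (hc.intervalIntegrable _ _) z).trans ?_
  rw [adXi_apply]
  have hL : ⁅∫ s in (0 : ℝ)..t, adExp s x y, adExp t x z⁆ =
      ((bracketL 𝔤).flip (adExp t x z)) (∫ s in (0 : ℝ)..t, adExp s x y) := rfl
  rw [hL, ← ContinuousLinearMap.intervalIntegral_comp_comm _
    ((continuous_adExp_apply x y).intervalIntegrable _ _)]
  refine intervalIntegral.integral_congr fun s _ => ?_
  change adExp s x ⁅y, adExp (t - s) x z⁆ = ⁅adExp s x y, adExp t x z⁆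
  rw [adExp_lie, ← adExp_apply_add]
  simp

theorem fderiv_adXi (t : ℝ) (x y z : 𝔤) :
    fderiv ℝ (fun x => adXi t x) x y z =
      ∫ s in (0 : ℝ)..t, ⁅adXi s x y, adExp s x z⁆ := by
  have h := hasFDerivAt_intervalIntegral_of_contDiff (F := fun (x : 𝔤) s => adExp s x)
    contDiff_adExp 0 t x
  have hc : Continuous fun s : ℝ => fderiv ℝ (fun x => adExp s x) x := by
    have h := ContDiff.fderiv (n := ∞) (m := ∞) (f := fun (s : ℝ) (x : 𝔤) => adExp s x)
      (g := fun _ : ℝ => x) (contDiff_adExp.comp (contDiff_snd.prodMk contDiff_fst))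
      contDiff_const (by simp)
    exact h.continuous
  have h' : fderiv ℝ (fun x => adXi t x) x = ∫ s in (0 : ℝ)..t, fderiv ℝ (fun x => adExp s x) x :=
    h.fderiv
  rw [h', ContinuousLinearMap.intervalIntegral_apply (hc.intervalIntegrable _ _) y,
    ContinuousLinearMap.intervalIntegral_apply
      ((hc.clm_apply continuous_const).intervalIntegrable _ _) z]
  simp only [fderiv_adExp]

theorem continuous_adXi (x : 𝔤) : Continuous (fun t => adXi t x) :=
  continuous_iff_continuousAt.2 fun t => (hasDerivAt_adXi t x).continuousAt

/-- The Maurer-Cartan equation. -/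
theorem fderiv_adXi_sub (t : ℝ) (x y z : 𝔤) :
    fderiv ℝ (fun x => adXi t x) x y z - fderiv ℝ (fun x => adXi t x) x z y =
      ⁅adXi t x y, adXi t x z⁆ := by
  have hc : ∀ y z : 𝔤, Continuous fun s : ℝ => ⁅adXi s x y, adExp s x z⁆ := fun y z =>
    ((bracketL 𝔤).continuous.comp ((continuous_adXi x).clm_apply continuous_const)).clm_apply
      (continuous_adExp_apply x z)
  rw [fderiv_adXi, fderiv_adXi, ← intervalIntegral.integral_sub
    ((hc y z).intervalIntegrable _ _) ((hc z y).intervalIntegrable _ _)]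
  -- The bracket [Ξ_s y, Ξ_s z] is an antiderivative of the difference of the two integrands and
  -- vanishes at s = 0.
  rw [intervalIntegral.integral_eq_sub_of_hasDerivAt (f := fun s => ⁅adXi s x y, adXi s x z⁆)
    (f' := fun s => ⁅adXi s x y, adExp s x z⁆ - ⁅adXi s x z, adExp s x y⁆) (fun s _ => ?_)
    (((hc y z).sub (hc z y)).intervalIntegrable _ _)]
  · simp
  · refine ((hasDerivAt_adXi_apply s x y).lie (hasDerivAt_adXi_apply s x z)).congr_deriv ?_
    rw [← lie_skew (adXi s x z) (adExp s x y)]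
    abel

theorem hasSum_lieXi (x : 𝔤) :
    HasSum (fun n : ℕ => (((n + 1).factorial : ℝ)⁻¹) • (-lieAd x) ^ n) (lieXi x) := by
  rw [lieXi_eq, neg_lieAd]
  exact hasSum_integral_exp_smul (bracketL 𝔤 x)

/-- The exponential of the coadjoint operator is the transpose of that of the adjoint one. -/
theorem opExp_smul_lieCoad (t : ℝ) (x : 𝔤) (ξ : StrongDual ℝ 𝔤) :
    opExp (-t • lieCoad x) ξ = ξ ∘L adExp t x := by
  let L : Endo 𝔤 →L[ℝ] StrongDual ℝ 𝔤 := (ContinuousLinearMap.compL ℝ 𝔤 𝔤 ℝ ξ)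
  have h1 := (exp_series_hasSum_exp' (𝕂 := ℝ) (t • bracketL 𝔤 x)).mapL L
  have h2 := (exp_series_hasSum_exp' (𝕂 := ℝ) (-t • lieCoad x)).mapL
    (ContinuousLinearMap.apply ℝ (StrongDual ℝ 𝔤) ξ)
  refine h2.unique ?_
  refine h1.congr_fun ?_ |> fun h => h
  intro n
  simp only [map_smul, L, ContinuousLinearMap.compL_apply, ContinuousLinearMap.apply_apply,
    smul_pow]
  congr 1
  -- Transposition reverses products, which is harmless for powers of one operator; so the two
  -- exponential series agree term by term.
  have hn : ∀ η : StrongDual ℝ 𝔤, ((lieCoad x) ^ n) η = η ∘L (lieAd x) ^ n := by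
    induction n with
    | zero => intro η; rfl
    | succ n ih =>
      intro η
      rw [pow_succ', mul_apply_eq_comp, ih, pow_succ]
      rfl
  rw [hn, ← neg_lieAd]
  ext y
  rcases n.even_or_odd with h | h <;> simp [h.neg_pow]

end LieExponential

/-! ### Submanifolds, double duals and forms on a vector space -/

section Ambient

variable {V : Type*} [NormedAddCommGroup V] [NormedSpace ℝ V]

theorem isEmbeddedSubmanifold_univ : IsEmbeddedSubmanifold (Set.univ : Set V) := fun _ _ =>
  ⟨OpenPartialHomeomorph.refl V, ⊤, trivial, contDiffOn_id, contDiffOn_id, by simp⟩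

theorem tangentSpaceOf_univ (p : V) : tangentSpaceOf Set.univ p = ⊤ := by
  refine eq_top_iff.2 fun v _ => Submodule.subset_span ⟨fun t => p + t • v, by simp, ?_, by simp⟩
  simpa using ((hasDerivAt_id (0 : ℝ)).smul_const v).const_add p

/-- Finite-dimensional reflexivity. It allows every covector on 𝔤^* to be replaced by an element of
𝔤, where brackets can be computed. -/
theorem exists_inclusionInDoubleDual_eq [FiniteDimensional ℝ V]
    (Θ : StrongDual ℝ (StrongDual ℝ V)) : ∃ z, NormedSpace.inclusionInDoubleDual ℝ V z = Θ := by
  let Θ' : Module.Dual ℝ (Module.Dual ℝ V) :=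
    Θ.toLinearMap ∘ₗ (LinearMap.toContinuousLinearMap (𝕜 := ℝ) (E := V) (F' := ℝ)).toLinearMap
  obtain ⟨z, hz⟩ := (Module.evalEquiv ℝ V).surjective Θ'
  refine ⟨z, ContinuousLinearMap.ext fun ξ => ?_⟩
  have := LinearMap.congr_fun hz ξ.toLinearMap
  exact this

theorem contDiff_extDeriv {n : ℕ} {θ : V → V [⋀^Fin n]→L[ℝ] ℝ} (hθ : ContDiff ℝ ∞ θ) :
    ContDiff ℝ ∞ (extDeriv θ) := by
  have h := hθ.fderiv_right (m := ∞) (by simp)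
  exact h.continuousLinearMap_comp
    (ContinuousAlternatingMap.alternatizeUncurryFinCLM (n := n) ℝ V ℝ)

theorem intervalIntegral_alternating_apply {n : ℕ} {f : ℝ → V [⋀^Fin n]→L[ℝ] ℝ}
    (hf : Continuous f) (a b : ℝ) (v : Fin n → V) :
    (∫ t in a..b, f t) v = ∫ t in a..b, f t v :=
  (ContinuousLinearMap.intervalIntegral_comp_comm (ContinuousAlternatingMap.apply ℝ V ℝ v)
    (hf.intervalIntegrable a b)).symm

end Ambient

/-! ### The linear Poisson structure, its spray and the averaged form -/

section LinearPoisson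

variable {𝔤 : Type*} [NormedLieAlgebra 𝔤] [FiniteDimensional ℝ 𝔤]

theorem linearPoisson_apply (ξ : StrongDual ℝ 𝔤) (Θ : StrongDual ℝ (StrongDual ℝ 𝔤)) (y : 𝔤) :
    linearPoisson ξ Θ y = Θ (lieCoad y ξ) := rfl

variable (𝔤) in
/-- The linear Poisson structure as a linear function of the base point. -/
def linearPoissonL : StrongDual ℝ 𝔤 →L[ℝ] Bivector (StrongDual ℝ 𝔤) :=
  LinearMap.toContinuousLinearMap
    { toFun := linearPoisson
      map_add' := fun ξ η => by ext Θ y; simp [linearPoisson_apply]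
      map_smul' := fun c ξ => by ext Θ y; simp [linearPoisson_apply] }

theorem contDiff_linearPoisson : ContDiff ℝ ∞ (linearPoisson (𝔤 := 𝔤)) :=
  ContinuousLinearMap.contDiff (𝕜 := ℝ) (E := StrongDual ℝ 𝔤) (F := Bivector (StrongDual ℝ 𝔤))
    (linearPoissonL 𝔤)

/-- The bracket of the linear functions a and b is the linear function [a, b], so skewness and the
Jacobi identity are those of 𝔤. -/
theorem isPoissonStructureOn_linearPoisson :
    IsPoissonStructureOn Set.univ (linearPoisson (𝔤 := 𝔤)) where
  submanifold := isEmbeddedSubmanifold_univ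
  tangent p _ α := by rw [tangentSpaceOf_univ]; trivial
  skew p _ α β := by
    obtain ⟨a, rfl⟩ := exists_inclusionInDoubleDual_eq α
    obtain ⟨b, rfl⟩ := exists_inclusionInDoubleDual_eq β
    have e : ∀ a b : 𝔤, NormedSpace.inclusionInDoubleDual ℝ 𝔤 b
        (linearPoisson p (NormedSpace.inclusionInDoubleDual ℝ 𝔤 a)) = p ⁅a, b⁆ :=
      fun a b => linearPoisson_inclusion p a b
    rw [e, e, ← lie_skew, map_neg]
  smooth := contDiff_linearPoisson.contDiffOn
  jacobi p _ α β γ := by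
    obtain ⟨a, rfl⟩ := exists_inclusionInDoubleDual_eq α
    obtain ⟨b, rfl⟩ := exists_inclusionInDoubleDual_eq β
    obtain ⟨c, rfl⟩ := exists_inclusionInDoubleDual_eq γ
    have h : ∀ a b c : 𝔤, fderivWithin ℝ (fun q : StrongDual ℝ 𝔤 =>
        NormedSpace.inclusionInDoubleDual ℝ 𝔤 b
          (linearPoisson q (NormedSpace.inclusionInDoubleDual ℝ 𝔤 a))) Set.univ p
          (linearPoisson p (NormedSpace.inclusionInDoubleDual ℝ 𝔤 c)) = p ⁅c, ⁅a, b⁆⁆ := by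
      intro a b c
      have h1 : (fun q : StrongDual ℝ 𝔤 => NormedSpace.inclusionInDoubleDual ℝ 𝔤 b
          (linearPoisson q (NormedSpace.inclusionInDoubleDual ℝ 𝔤 a))) =
          NormedSpace.inclusionInDoubleDual ℝ 𝔤 ⁅a, b⁆ :=
        funext fun q => linearPoisson_inclusion q a b
      rw [h1, fderivWithin_univ, ContinuousLinearMap.fderiv]
      exact linearPoisson_inclusion p c ⁅a, b⁆
    rw [h, h, h, ← map_add, ← map_add, lie_jacobi, map_zero]

theorem sprayFlow_eq (t : ℝ) (p : 𝔤 × StrongDual ℝ 𝔤) :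
    sprayFlow t p = (p.1, p.2 ∘L adExp t p.1) := by
  rw [sprayFlow, opExp_smul_lieCoad]

theorem sprayExp_eq (p : 𝔤 × StrongDual ℝ 𝔤) : sprayExp p = p.2 ∘L adExp 1 p.1 := by
  rw [sprayExp, sprayFlow_eq]

theorem sprayExp_apply (p : 𝔤 × StrongDual ℝ 𝔤) (y : 𝔤) : sprayExp p y = p.2 (adExp 1 p.1 y) := by
  rw [sprayExp_eq]; rfl

theorem isPoissonSpray_canonicalSpray : IsPoissonSpray (canonicalSpray (𝔤 := 𝔤)) where
  smooth := by
    have h : (canonicalSpray (𝔤 := 𝔤)) = fun p => (0, p.2 ∘L bracketL 𝔤 p.1) := by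
      ext1 p
      refine Prod.ext rfl (ContinuousLinearMap.ext fun y => ?_)
      change -(lieCoad p.1 p.2 y) = p.2 ⁅p.1, y⁆
      rw [lieCoad_apply, neg_neg]
    rw [h]
    exact contDiff_const.prodMk
      (contDiff_snd.clm_comp ((bracketL 𝔤).contDiff.comp contDiff_fst))
  homogeneous t ht := by
    ext1 p
    have hd : HasFDerivAt (fun p : 𝔤 × StrongDual ℝ 𝔤 => (t • p.1, p.2))
        ((t • ContinuousLinearMap.fst ℝ 𝔤 (StrongDual ℝ 𝔤)).prod
          (ContinuousLinearMap.snd ℝ 𝔤 (StrongDual ℝ 𝔤))) p :=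
      (hasFDerivAt_fst.const_smul t).prodMk hasFDerivAt_snd
    have hinv : ((t • ContinuousLinearMap.fst ℝ 𝔤 (StrongDual ℝ 𝔤)).prod
          (ContinuousLinearMap.snd ℝ 𝔤 (StrongDual ℝ 𝔤))).inverse =
        ((t⁻¹ • ContinuousLinearMap.fst ℝ 𝔤 (StrongDual ℝ 𝔤)).prod
          (ContinuousLinearMap.snd ℝ 𝔤 (StrongDual ℝ 𝔤))) :=
      ContinuousLinearMap.inverse_eq (by ext q <;> simp [ht.ne']) (by ext q <;> simp [ht.ne'])
    rw [VectorField.pullback, hd.fderiv, hinv]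
    refine Prod.ext (by simp [canonicalSpray]) (ContinuousLinearMap.ext fun y => ?_)
    simp [canonicalSpray, lieCoad_apply]
  projects p := by
    ext y
    rw [linearPoisson_inclusion]
    change -(lieCoad p.1 p.2 y) = _
    rw [lieCoad_apply, neg_neg]

theorem isCompleteFlow_sprayFlow : IsCompleteFlow (sprayFlow (𝔤 := 𝔤)) canonicalSpray := by
  intro p
  refine ⟨by simp [sprayFlow_eq]; rfl, fun t => ?_⟩
  simp only [sprayFlow_eq]
  refine (hasDerivAt_const t p.1).prodMk ?_
  have h := ((ContinuousLinearMap.compL ℝ 𝔤 𝔤 ℝ p.2).hasFDerivAt.comp_hasDerivAt t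
    (hasDerivAt_exp_smul_const (𝕂 := ℝ) (bracketL 𝔤 p.1) t))
  refine h.congr_deriv (ContinuousLinearMap.ext fun y => ?_)
  change p.2 (adExp t p.1 ⁅p.1, y⁆) = -(lieCoad p.1 (p.2 ∘L adExp t p.1) y)
  rw [lieCoad_apply, neg_neg]
  rfl

theorem contDiff_sprayFlow (t : ℝ) : ContDiff ℝ ∞ (sprayFlow (𝔤 := 𝔤) t) := by
  have h : sprayFlow (𝔤 := 𝔤) t = fun p => (p.1, p.2 ∘L adExp t p.1) := funext (sprayFlow_eq t)
  rw [h]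
  exact contDiff_fst.prodMk (contDiff_snd.clm_comp
    (contDiff_adExp.comp (contDiff_fst.prodMk contDiff_const)))

theorem contDiff_sprayExp : ContDiff ℝ ∞ (sprayExp (𝔤 := 𝔤)) :=
  contDiff_snd.comp (contDiff_sprayFlow 1)

theorem fderiv_sprayFlow (t : ℝ) (p q : 𝔤 × StrongDual ℝ 𝔤) :
    fderiv ℝ (sprayFlow t) p q =
      (q.1, q.2 ∘L adExp t p.1 + p.2 ∘L (bracketL 𝔤 (adXi t p.1 q.1) ∘L adExp t p.1)) := by
  have h : sprayFlow (𝔤 := 𝔤) t = fun p => (p.1, p.2 ∘L adExp t p.1) := funext (sprayFlow_eq t)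
  have h1 : HasFDerivAt (fun p : 𝔤 × StrongDual ℝ 𝔤 => adExp t p.1) _ p :=
    (differentiable_adExp t p.1).hasFDerivAt.comp p hasFDerivAt_fst
  have h2 := (hasFDerivAt_snd (𝕜 := ℝ) (p := p)).clm_comp h1
  rw [h, (hasFDerivAt_fst.prodMk h2).fderiv]
  refine Prod.ext rfl (ContinuousLinearMap.ext fun y => ?_)
  change p.2 (fderiv ℝ (fun x => adExp t x) p.1 q.1 y) + q.2 (adExp t p.1 y) = _
  rw [fderiv_adExp, add_comm]
  rfl

theorem fderiv_sprayExp (p q : 𝔤 × StrongDual ℝ 𝔤) :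
    fderiv ℝ sprayExp p q =
      q.2 ∘L adExp 1 p.1 + p.2 ∘L (bracketL 𝔤 (adXi 1 p.1 q.1) ∘L adExp 1 p.1) := by
  have h : sprayExp (𝔤 := 𝔤) = fun p => (sprayFlow 1 p).2 := rfl
  have h2 := (((contDiff_sprayFlow (𝔤 := 𝔤) 1).differentiable (by simp)) p).hasFDerivAt.snd
  rw [h, h2.fderiv, ContinuousLinearMap.comp_apply, fderiv_sprayFlow]
  rfl

theorem fderiv_sprayExp_apply (p q : 𝔤 × StrongDual ℝ 𝔤) (z : 𝔤) :
    fderiv ℝ sprayExp p q z =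
      q.2 (adExp 1 p.1 z) + p.2 ⁅adXi 1 p.1 q.1, adExp 1 p.1 z⁆ := by
  rw [fderiv_sprayExp]; rfl

-- ω_can has constant coefficients; thus φ_t^*ω_can depends on t only through the differential of
-- φ_t.
omit [FiniteDimensional ℝ 𝔤] in
theorem canonicalForm_eq (p q : 𝔤 × StrongDual ℝ 𝔤) : canonicalForm 𝔤 p = canonicalForm 𝔤 q := by
  ext v
  have hv : v = ![((v 0).1, (v 0).2), ((v 1).1, (v 1).2)] := by
    ext i <;> fin_cases i <;> rfl
  rw [hv, canonicalForm_apply, canonicalForm_apply]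

theorem continuous_fderiv_sprayFlow (p : 𝔤 × StrongDual ℝ 𝔤) :
    Continuous fun t : ℝ => fderiv ℝ (sprayFlow t) p := by
  have hc : ContDiff ℝ ∞ (fun q : ℝ × (𝔤 × StrongDual ℝ 𝔤) => sprayFlow q.1 q.2) := by
    simp only [sprayFlow_eq]
    exact (contDiff_fst.comp contDiff_snd).prodMk
      ((contDiff_snd.comp contDiff_snd).clm_comp
        (contDiff_adExp.comp ((contDiff_fst.comp contDiff_snd).prodMk contDiff_fst)))
  exact (ContDiff.fderiv (n := ∞) (m := ∞)
    (f := fun (t : ℝ) (q : 𝔤 × StrongDual ℝ 𝔤) => sprayFlow t q)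
    (g := fun _ : ℝ => p) hc contDiff_const (by simp)).continuous

theorem averagedForm_apply (x₀ x y : 𝔤) (ξ₀ ξ η : StrongDual ℝ 𝔤) :
    averagedForm 𝔤 (x₀, ξ₀) ![(x, ξ), (y, η)] =
      ξ (adXi 1 x₀ y) - η (adXi 1 x₀ x) + ξ₀ ⁅adXi 1 x₀ x, adXi 1 x₀ y⁆ := by
  let p : 𝔤 × StrongDual ℝ 𝔤 := (x₀, ξ₀)
  have hc : Continuous fun t : ℝ => pullbackForm (sprayFlow t) (canonicalForm 𝔤) p := by
    have h1 : Continuous fun f : (𝔤 × StrongDual ℝ 𝔤) →L[ℝ] (𝔤 × StrongDual ℝ 𝔤) =>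
        (canonicalForm 𝔤 0).compContinuousLinearMap f :=
      continuous_iff_continuousAt.2 fun f =>
        (ContinuousAlternatingMap.hasStrictFDerivAt_compContinuousLinearMap
          (canonicalForm 𝔤 0, f)).continuousAt.comp
            (f := fun f => (canonicalForm 𝔤 0, f)) (by fun_prop)
    refine (h1.comp (continuous_fderiv_sprayFlow p)).congr fun t => ?_
    rw [pullbackForm, canonicalForm_eq (sprayFlow t p) 0]
    rfl
  let ev : ((𝔤 × StrongDual ℝ 𝔤) [⋀^Fin 2]→L[ℝ] ℝ) → ℝ := fun θ => θ ![(x, ξ), (y, η)]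
  have h0 : averagedForm 𝔤 p ![(x, ξ), (y, η)] =
      ∫ t in (0 : ℝ)..1, ev (pullbackForm (sprayFlow t) (canonicalForm 𝔤) p) :=
    intervalIntegral_alternating_apply hc 0 1 _
  -- The integrand is the derivative of the claimed expression with Ξ_t for Ξ. The derivative of the
  -- bracket term supplies precisely the contributions of D A_t to the differential of φ_t.
  have hder : ∀ t : ℝ, HasDerivAt (fun t => ξ (adXi t x₀ y) - η (adXi t x₀ x) +
      ξ₀ ⁅adXi t x₀ x, adXi t x₀ y⁆) (ev (pullbackForm (sprayFlow t) (canonicalForm 𝔤) p)) t := by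
    intro t
    have h1 := ξ.hasFDerivAt.comp_hasDerivAt t (hasDerivAt_adXi_apply t x₀ y)
    have h2 := η.hasFDerivAt.comp_hasDerivAt t (hasDerivAt_adXi_apply t x₀ x)
    have h3 := ξ₀.hasFDerivAt.comp_hasDerivAt t
      ((hasDerivAt_adXi_apply t x₀ x).lie (hasDerivAt_adXi_apply t x₀ y))
    refine ((h1.sub h2).add h3).congr_deriv ?_
    have h4 : ev (pullbackForm (sprayFlow t) (canonicalForm 𝔤) p) =
        canonicalForm 𝔤 (sprayFlow t p)
          ![fderiv ℝ (sprayFlow t) p (x, ξ), fderiv ℝ (sprayFlow t) p (y, η)] := by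
      change canonicalForm 𝔤 (sprayFlow t p)
        (fun i => fderiv ℝ (sprayFlow t) p (![(x, ξ), (y, η)] i)) = _
      congr 1
      ext i <;> fin_cases i <;> rfl
    rw [h4, fderiv_sprayFlow, fderiv_sprayFlow, canonicalForm_apply]
    change _ = (ξ (adExp t x₀ y) + ξ₀ ⁅adXi t x₀ x, adExp t x₀ y⁆) -
      (η (adExp t x₀ x) + ξ₀ ⁅adXi t x₀ y, adExp t x₀ x⁆)
    rw [map_add, ← lie_skew (adExp t x₀ x), map_neg]
    ring
  have hc' : Continuous fun t => ev (pullbackForm (sprayFlow t) (canonicalForm 𝔤) p) :=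
    (ContinuousAlternatingMap.apply ℝ (𝔤 × StrongDual ℝ 𝔤) ℝ
      ![(x, ξ), (y, η)]).continuous.comp hc
  rw [show averagedForm 𝔤 (x₀, ξ₀) ![(x, ξ), (y, η)] = _ from h0,
    intervalIntegral.integral_eq_sub_of_hasDerivAt (fun t _ => hder t)
      (hc'.intervalIntegrable _ _)]
  simp

theorem averagedForm_pair (p q r : 𝔤 × StrongDual ℝ 𝔤) :
    averagedForm 𝔤 p ![q, r] = q.2 (adXi 1 p.1 r.1) - r.2 (adXi 1 p.1 q.1) +
      p.2 ⁅adXi 1 p.1 q.1, adXi 1 p.1 r.1⁆ :=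
  averagedForm_apply p.1 q.1 r.1 p.2 q.2 r.2

variable (𝔤) in
/-- A primitive of the averaged two-form. -/
def averagedPrimitive (p : 𝔤 × StrongDual ℝ 𝔤) : (𝔤 × StrongDual ℝ 𝔤) [⋀^Fin 1]→L[ℝ] ℝ :=
  ContinuousAlternatingMap.ofSubsingleton ℝ (𝔤 × StrongDual ℝ 𝔤) ℝ (0 : Fin 1)
    ((p.2 ∘L adXi 1 p.1) ∘L ContinuousLinearMap.fst ℝ 𝔤 (StrongDual ℝ 𝔤))

theorem contDiff_averagedPrimitive : ContDiff ℝ ∞ (averagedPrimitive 𝔤) := by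
  have h := LinearIsometryEquiv.contDiff (𝕜 := ℝ) (n := ∞) (E := StrongDual ℝ (𝔤 × StrongDual ℝ 𝔤))
    (F := (𝔤 × StrongDual ℝ 𝔤) [⋀^Fin 1]→L[ℝ] ℝ) (ContinuousAlternatingMap.ofSubsingletonLIE
      (𝕜 := ℝ) (E := 𝔤 × StrongDual ℝ 𝔤) (F := ℝ) (0 : Fin 1))
  exact h.comp
    ((contDiff_snd.clm_comp ((contDiff_adXi 1).comp contDiff_fst)).clm_comp contDiff_const)

/-- Differentiating the covector in ξ(Ξ y) gives the first two terms of the formula;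
antisymmetrising the derivative of Ξ gives the bracket term by the Maurer-Cartan equation. -/
theorem averagedForm_eq_extDeriv : averagedForm 𝔤 = extDeriv (averagedPrimitive 𝔤) := by
  ext p v
  have hv : v = ![v 0, v 1] := by
    ext i <;> fin_cases i <;> rfl
  rw [extDeriv_apply (contDiff_averagedPrimitive.differentiable (by simp) p)]
  have hX : HasFDerivAt (fun q : 𝔤 × StrongDual ℝ 𝔤 => adXi 1 q.1)
      (fderiv ℝ (fun x => adXi 1 x) p.1 ∘L ContinuousLinearMap.fst ℝ 𝔤 (StrongDual ℝ 𝔤)) p :=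
    ((contDiff_adXi (𝔤 := 𝔤) 1).differentiable (by simp) p.1).hasFDerivAt.comp p hasFDerivAt_fst
  have hf : ∀ (w : Fin 1 → 𝔤 × StrongDual ℝ 𝔤) (u : 𝔤 × StrongDual ℝ 𝔤),
      fderiv ℝ (fun q => averagedPrimitive 𝔤 q w) p u =
        u.2 (adXi 1 p.1 (w 0).1) + p.2 (fderiv ℝ (fun x => adXi 1 x) p.1 u.1 (w 0).1) := by
    intro w u
    have h2 := (hasFDerivAt_snd (𝕜 := ℝ) (p := p)).clm_apply
      (hX.clm_apply (hasFDerivAt_const (w 0).1 p))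
    have h3 : (fun q => averagedPrimitive 𝔤 q w) =
      fun q : 𝔤 × StrongDual ℝ 𝔤 => q.2 (adXi 1 q.1 (w 0).1) := rfl
    rw [h3, h2.fderiv]
    simp [add_comm]
  simp only [hf]
  conv_lhs => rw [hv]
  rw [averagedForm_pair]
  simp only [Fin.removeNth]
  have hm := congrArg p.2 (fderiv_adXi_sub 1 p.1 (v 0).1 (v 1).1)
  rw [map_sub] at hm
  rw [← hm]
  simp
  ring

theorem contDiff_averagedForm : ContDiff ℝ ∞ (averagedForm 𝔤) := by
  rw [averagedForm_eq_extDeriv]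
  exact contDiff_extDeriv contDiff_averagedPrimitive

theorem extDeriv_averagedForm (p : 𝔤 × StrongDual ℝ 𝔤) : extDeriv (averagedForm 𝔤) p = 0 := by
  rw [averagedForm_eq_extDeriv]
  exact congrFun (extDeriv_extDeriv (contDiff_averagedPrimitive (𝔤 := 𝔤)) (by
    simp only [minSmoothness_of_isRCLikeNormedField]; exact ENat.LEInfty.out)) p

end LinearPoisson

/-! ### Nondegeneracy of the averaged form and the dual pair -/

section DualPair

/-- `ContinuousLinearMap.inverse` is meaningful only on equivalences; nondegeneracy and equality of
dimensions make the flat map one. -/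
theorem inverseBivector_apply_eq {E : Type*} [NormedAddCommGroup E] [NormedSpace ℝ E]
    [FiniteDimensional ℝ E] {Ω : E [⋀^Fin 2]→L[ℝ] ℝ} (hΩ : IsNondegForm Ω) {u : E}
    {Θ : StrongDual ℝ E} (h : ∀ v, Ω ![u, v] = Θ v) : inverseBivector Ω Θ = u := by
  have hinj : Function.Injective (flatMap Ω) := by
    refine (injective_iff_map_eq_zero _).2 fun w hw => hΩ w fun v => ?_
    rw [← flatMap_apply, hw]; rfl
  have hdim : Module.finrank ℝ E = Module.finrank ℝ (StrongDual ℝ E) := by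
    rw [← (LinearMap.toContinuousLinearMap (𝕜 := ℝ) (E := E) (F' := ℝ)).finrank_eq]
    exact (Subspace.dual_finrank_eq (K := ℝ) (V := E)).symm
  let e : E ≃L[ℝ] StrongDual ℝ E :=
    (LinearEquiv.ofInjectiveOfFinrankEq (flatMap Ω).toLinearMap hinj hdim).toContinuousLinearEquiv
  have he : (e : E →L[ℝ] StrongDual ℝ E) = flatMap Ω := by ext v w; rfl
  rw [inverseBivector, ← he, ContinuousLinearMap.inverse_equiv]
  refine e.symm_apply_eq.2 (ContinuousLinearMap.ext fun v => ?_)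
  rw [← h v]
  rfl

variable {𝔤 : Type*} [NormedLieAlgebra 𝔤] [FiniteDimensional ℝ 𝔤]

theorem surjective_adXi {x : 𝔤} (h : Function.Injective (adXi 1 x)) :
    Function.Surjective (adXi 1 x) :=
  (LinearMap.injective_iff_surjective (f := (adXi 1 x).toLinearMap)).1 h

/-- A vector a with Ξ a = 0 gives (a, 0) in the kernel of Ω. Conversely, pairing a kernel vector
with the (0, η) kills its first component, and then pairing with the (y, 0) kills the second, as Ξ
is onto. -/
theorem isNondegForm_averagedForm_iff (x : 𝔤) (ξ : StrongDual ℝ 𝔤) :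
    IsNondegForm (averagedForm 𝔤 (x, ξ)) ↔ Function.Injective (adXi 1 x) := by
  constructor
  · intro h
    refine (injective_iff_map_eq_zero _).2 fun a ha => ?_
    have := h (a, 0) fun v => by rw [averagedForm_pair]; simp [ha]
    exact congrArg Prod.fst this
  · intro h u hu
    have h1 : u.1 = 0 := by
      refine (injective_iff_map_eq_zero _).1 h _ (SeparatingDual.eq_zero_of_forall_dual_eq_zero (R := ℝ) fun η => ?_)
      have := hu (0, η)
      rw [averagedForm_pair] at this
      simpa using this
    refine Prod.ext h1 (ContinuousLinearMap.ext fun z => ?_)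
    obtain ⟨y, rfl⟩ := surjective_adXi h z
    have := hu (y, 0)
    rw [averagedForm_pair] at this
    simpa [h1] using this

/-- No group appears here: the open set is arbitrary as long as it contains 0 and Ξ is injective on
it. -/
theorem isFullDualPair_averagedForm {S : Set 𝔤} (hS : IsOpen S) (h0 : (0 : 𝔤) ∈ S)
    (hinj : ∀ x ∈ S, Function.Injective (adXi 1 x)) :
    IsFullDualPair (S ×ˢ Set.univ) (averagedForm 𝔤)
      Prod.snd linearPoisson sprayExp (fun ξ => -linearPoisson (𝔤 := 𝔤) ξ) := by
  have hO : IsOpen (S ×ˢ (Set.univ : Set (StrongDual ℝ 𝔤))) := hS.prod isOpen_univ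
  have hnd : ∀ p ∈ S ×ˢ (Set.univ : Set (StrongDual ℝ 𝔤)), IsNondegForm (averagedForm 𝔤 p) :=
    fun p hp => (isNondegForm_averagedForm_iff p.1 p.2).2 (hinj _ hp.1)
  have hsnd : ∀ p : 𝔤 × StrongDual ℝ 𝔤, fderiv ℝ (Prod.snd : 𝔤 × StrongDual ℝ 𝔤 → _) p =
      ContinuousLinearMap.snd ℝ 𝔤 (StrongDual ℝ 𝔤) := fun p => fderiv_snd
  refine
    { isOpen := hO
      symplectic := ⟨contDiff_averagedForm.contDiffOn, fun p _ => extDeriv_averagedForm p, hnd⟩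
      source_poisson := ⟨Set.mapsTo_univ _ _, contDiff_snd.contDiffOn, fun p hp α => ?_⟩
      target_poisson := ⟨Set.mapsTo_univ _ _, contDiff_sprayExp.contDiffOn, fun p hp α => ?_⟩
      source_surj := Set.eq_univ_of_forall fun ξ => ⟨(0, ξ), ⟨h0, trivial⟩, rfl⟩
      target_surj := Set.eq_univ_of_forall fun ξ => ⟨(0, ξ), ⟨h0, trivial⟩, ?_⟩
      source_subm := fun p _ ζ => ⟨(0, ζ), by rw [hsnd]; rfl⟩
      target_subm := fun p _ ζ => ⟨(0, ζ ∘L adExp (-1) p.1), ?_⟩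
      orth_source := fun p hp v => ?_
      orth_target := fun p hp u => ?_ }
  · obtain ⟨z, rfl⟩ := exists_inclusionInDoubleDual_eq α
    obtain ⟨w, hw⟩ := surjective_adXi (hinj _ hp.1) z
    rw [fderivWithin_of_isOpen hO hp, hsnd]
    -- With Ξ w = z, the vector Ω-dual to pr^*z is (-w, ξ ∘ [z, ·]), whose projection is already
    -- π^♯z.
    rw [inverseBivector_apply_eq (hnd p hp)
      (u := (-w, linearPoisson p.2 (NormedSpace.inclusionInDoubleDual ℝ 𝔤 z)))]
    · rfl
    · intro v
      rw [averagedForm_pair]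
      simp only [linearPoisson_inclusion, map_neg, hw, neg_lie]
      simp
  · obtain ⟨z, rfl⟩ := exists_inclusionInDoubleDual_eq α
    obtain ⟨w, hw⟩ := surjective_adXi (hinj _ hp.1) (adExp 1 p.1 z)
    rw [fderivWithin_of_isOpen hO hp]
    -- With Ξ w = A_1 z, the vector Ω-dual to exp^*z lies in the fibre of pr. The minus sign is the
    -- one of the target Poisson structure.
    rw [inverseBivector_apply_eq (hnd p hp) (u := (-w, 0))]
    · ext y
      rw [fderiv_sprayExp_apply, neg_apply, neg_apply, linearPoisson_inclusion, sprayExp_apply,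
        adExp_lie]
      simp only [hw, zero_apply, zero_add, map_neg, neg_lie]
    · intro v
      rw [averagedForm_pair, ContinuousLinearMap.comp_apply, NormedSpace.dual_def,
        fderiv_sprayExp_apply, ← lie_skew]
      simp [hw]
  · rw [sprayExp_eq]
    ext y
    simp
  · ext y
    rw [fderiv_sprayExp_apply]
    simp [adExp_neg_apply_adExp]
  · simp only [hsnd]
    constructor
    · intro h u hu
      have hu : u.2 = 0 := hu
      -- Evaluated at A_{-1} Ξ u_1, the equation d exp(v) = 0 becomes Ω(u, v) = 0, up to skewness of
      -- the bracket.
      have := DFunLike.congr_fun h (adExp (-1) p.1 (adXi 1 p.1 u.1))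
      rw [fderiv_sprayExp_apply, adExp_apply_adExp_neg] at this
      rw [averagedForm_pair, hu, ← lie_skew, map_neg]
      simp only [zero_apply] at this ⊢
      linarith
    · intro h
      ext y
      obtain ⟨w, hw⟩ := surjective_adXi (hinj _ hp.1) (adExp 1 p.1 y)
      have := h (w, 0) rfl
      rw [averagedForm_pair, ← lie_skew, map_neg] at this
      rw [fderiv_sprayExp_apply, ← hw]
      simp only [zero_apply] at this ⊢
      linarith
  · simp only [hsnd]
    constructor
    · intro hu v hv
      have hu : u.2 = 0 := hu
      have := DFunLike.congr_fun hv (adExp (-1) p.1 (adXi 1 p.1 u.1))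
      rw [fderiv_sprayExp_apply, adExp_apply_adExp_neg] at this
      rw [averagedForm_pair, hu, ← lie_skew, map_neg]
      simp only [zero_apply] at this ⊢
      linarith
    · intro h
      refine ContinuousLinearMap.ext fun z => ?_
      obtain ⟨y, rfl⟩ := surjective_adXi (hinj _ hp.1) z
      -- This second component is chosen to put the vector in the kernel of d exp.
      have := h (y, -(p.2 ∘L bracketL 𝔤 (adXi 1 p.1 y))) (by
        ext w
        rw [fderiv_sprayExp_apply]
        simp)
      rw [averagedForm_pair, ← lie_skew, map_neg] at this
      simp at this
      exact this

end DualPair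

/-! ### Tangent spaces of subsets and derivatives within them -/

section TangentSpaces

variable {V W : Type*} [NormedAddCommGroup V] [NormedSpace ℝ V]
  [NormedAddCommGroup W] [NormedSpace ℝ W]

theorem mem_tangentSpaceOf_of_hasDerivAt {S : Set V} {p v : V} {γ : ℝ → V} (h0 : γ 0 = p)
    (hγ : HasDerivAt γ v 0) (hS : ∀ᶠ t in 𝓝 (0 : ℝ), γ t ∈ S) : v ∈ tangentSpaceOf S p :=
  Submodule.subset_span ⟨γ, h0, hγ, hS⟩

/-- Derivatives within a set map tangent vectors to tangent vectors. -/
theorem HasFDerivWithinAt.mapsTo_tangentSpaceOf {S : Set V} {S' : Set W} {p : V} {g : V → W}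
    {g' : V →L[ℝ] W} (hg : HasFDerivWithinAt g g' S p) (hS : Set.MapsTo g S S') {v : V}
    (hv : v ∈ tangentSpaceOf S p) : g' v ∈ tangentSpaceOf S' (g p) := by
  suffices h : tangentSpaceOf S p ≤ (tangentSpaceOf S' (g p)).comap g'.toLinearMap from h hv
  refine Submodule.span_le.2 ?_
  rintro v ⟨γ, rfl, hγ, hγS⟩
  exact mem_tangentSpaceOf_of_hasDerivAt (γ := g ∘ γ) rfl (hg.comp_hasDerivAt 0 hγ hγS)
    (hγS.mono fun t ht => hS ht)

/-- Derivatives within a set are determined on tangent vectors. -/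
theorem HasFDerivWithinAt.eq_of_mem_tangentSpaceOf {S : Set V} {p : V} {g : V → W}
    {g₁ g₂ : V →L[ℝ] W} (h₁ : HasFDerivWithinAt g g₁ S p) (h₂ : HasFDerivWithinAt g g₂ S p) {v : V}
    (hv : v ∈ tangentSpaceOf S p) : g₁ v = g₂ v := by
  suffices h : tangentSpaceOf S p ≤ LinearMap.eqLocus g₁.toLinearMap g₂.toLinearMap from h hv
  refine Submodule.span_le.2 ?_
  rintro v ⟨γ, rfl, hγ, hγS⟩
  exact (h₁.comp_hasDerivAt 0 hγ hγS).unique (h₂.comp_hasDerivAt 0 hγ hγS)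

/-- A submanifold of lower dimension does not determine derivatives within it uniquely, so
`fderivWithin` is one choice among many; only its values on tangent vectors are meaningful. -/
theorem fderivWithin_apply_eq {S : Set V} {p : V} {g : V → W} {g' : V →L[ℝ] W}
    (h : HasFDerivWithinAt g g' S p) {v : V} (hv : v ∈ tangentSpaceOf S p) :
    fderivWithin ℝ g S p v = g' v :=
  h.differentiableWithinAt.hasFDerivWithinAt.eq_of_mem_tangentSpaceOf h hv

theorem tangentSpaceOf_inter_open (S : Set V) {O : Set V} (hO : IsOpen O) {p : V} (hp : p ∈ O) :
    tangentSpaceOf (S ∩ O) p = tangentSpaceOf S p := by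
  unfold tangentSpaceOf
  congr 1
  ext v
  constructor
  · rintro ⟨γ, h0, hγ, hS⟩
    exact ⟨γ, h0, hγ, hS.mono fun t ht => ht.1⟩
  · rintro ⟨γ, h0, hγ, hS⟩
    refine ⟨γ, h0, hγ, hS.and (hγ.continuousAt.eventually (hO.mem_nhds (h0.symm ▸ hp)))⟩

theorem IsEmbeddedSubmanifold.inter_open {S O : Set V} (hS : IsEmbeddedSubmanifold S)
    (hO : IsOpen O) : IsEmbeddedSubmanifold (S ∩ O) := by
  rintro p ⟨hp, hpO⟩
  obtain ⟨Φ, L, hpΦ, h1, h2, h3⟩ := hS p hp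
  refine ⟨Φ.restrOpen O hO, L, ⟨hpΦ, hpO⟩, h1.mono ?_, h2.mono ?_, ?_⟩
  · exact Set.inter_subset_left
  · exact fun x hx => hx.1
  · rintro q ⟨hq, hqO⟩
    simpa [hqO] using h3 q hq

/-- The inverse function theorem for smooth maps. -/
theorem exists_openPartialHomeomorph_of_contDiffOn [CompleteSpace V] {f : V → W} {D : Set V}
    (hD : IsOpen D) (hf : ContDiffOn ℝ ∞ f D) {a : V} (ha : a ∈ D) (e : V ≃L[ℝ] W)
    (he : fderiv ℝ f a = e) :
    ∃ κ : OpenPartialHomeomorph V W, a ∈ κ.source ∧ κ.source ⊆ D ∧ (∀ x, κ x = f x) ∧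
      ContDiffOn ℝ ∞ κ κ.source ∧ ContDiffOn ℝ ∞ κ.symm κ.target := by
  have hfa : ContDiffAt ℝ ∞ f a := hf.contDiffAt (hD.mem_nhds ha)
  have hda : HasFDerivAt f (e : V →L[ℝ] W) a := by
    rw [← he]; exact (hfa.differentiableAt (by simp)).hasFDerivAt
  let κ₀ := hfa.toOpenPartialHomeomorph f hda (by simp)
  -- Restricting to the points with invertible derivative makes the inverse smooth on the whole
  -- target, not only near the image of `a`.
  have hinv : IsOpen {x ∈ D | fderiv ℝ f x ∈ Set.range ((↑) : (V ≃L[ℝ] W) → V →L[ℝ] W)} :=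
    (hf.continuousOn_fderiv_of_isOpen hD (by simp)).isOpen_inter_preimage hD
      ContinuousLinearEquiv.isOpen
  let κ := κ₀.restrOpen _ hinv
  have hκ : ∀ x, κ x = f x := fun x => by
    simp [κ, κ₀, ContDiffAt.toOpenPartialHomeomorph_coe]
  refine ⟨κ, ⟨hfa.mem_toOpenPartialHomeomorph_source hda (by simp), ha, ⟨e, he.symm⟩⟩,
    fun x hx => hx.2.1, hκ, ?_, ?_⟩
  · exact (hf.mono fun x hx => hx.2.1).congr fun x _ => hκ x
  · intro y hy
    have hx := κ.map_target hy
    obtain ⟨e', he'⟩ := hx.2.2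
    have hc : ContDiffAt ℝ ∞ f (κ.symm y) := hf.contDiffAt (hD.mem_nhds hx.2.1)
    have hκf : (κ : V → W) = f := funext hκ
    refine (κ.contDiffAt_symm hy (f₀' := e') ?_ ?_).contDiffWithinAt
    · rw [hκf, he']; exact (hc.differentiableAt (by simp)).hasFDerivAt
    · rw [hκf]; exact hc

/-- Vectors tangent to a subset flattened by a chart. -/
theorem mem_tangentSpaceOf_iff_of_chart [FiniteDimensional ℝ V] {S : Set V}
    {Φ : OpenPartialHomeomorph V V} {L : Submodule ℝ V}
    (h1 : ContDiffOn ℝ ∞ Φ Φ.source) (h2 : ContDiffOn ℝ ∞ Φ.symm Φ.target)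
    (h3 : ∀ q ∈ Φ.source, (q ∈ S ↔ Φ q ∈ L)) {p : V} (hp : p ∈ Φ.source) (hpS : p ∈ S) (v : V) :
    v ∈ tangentSpaceOf S p ↔ fderiv ℝ Φ p v ∈ L := by
  have d1 : HasFDerivAt Φ (fderiv ℝ Φ p) p :=
    ((h1.contDiffAt (Φ.open_source.mem_nhds hp)).differentiableAt (by simp)).hasFDerivAt
  have d2 : HasFDerivAt Φ.symm (fderiv ℝ Φ.symm (Φ p)) (Φ p) :=
    ((h2.contDiffAt (Φ.open_target.mem_nhds (Φ.map_source hp))).differentiableAt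
      (by simp)).hasFDerivAt
  have hcomp : fderiv ℝ Φ.symm (Φ p) (fderiv ℝ Φ p v) = v := by
    have h : HasFDerivAt (Φ.symm ∘ Φ) (ContinuousLinearMap.id ℝ V) p :=
      (hasFDerivAt_id p).congr_of_eventuallyEq (Φ.eventually_left_inverse hp)
    exact DFunLike.congr_fun ((d2.comp p d1).unique h) v
  constructor
  · intro hv
    suffices h : tangentSpaceOf S p ≤ L.comap (fderiv ℝ Φ p).toLinearMap from h hv
    refine Submodule.span_le.2 ?_
    rintro v ⟨γ, rfl, hγ, hγS⟩
    have hd : HasDerivAt (Φ ∘ γ) (fderiv ℝ Φ (γ 0) v) 0 := d1.comp_hasDerivAt 0 hγ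
    have hL : ∀ᶠ t in 𝓝 (0 : ℝ), (Φ ∘ γ) t ∈ L := by
      filter_upwards [hγS, hγ.continuousAt.eventually (Φ.open_source.mem_nhds hp)] with t ht ht'
      exact (h3 _ ht').1 ht
    -- The difference quotients of the flattened curve lie in `L`, which is closed.
    refine (Submodule.closed_of_finiteDimensional L).mem_of_tendsto hd.tendsto_slope ?_
    filter_upwards [hL.filter_mono nhdsWithin_le_nhds] with t ht
    rw [slope_def_module]
    exact L.smul_mem _ (L.sub_mem ht ((h3 _ hp).1 hpS))
  · intro hv
    -- The required curve is the preimage under the chart of a straight line in `L`.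
    have hc : HasDerivAt (fun t : ℝ => Φ p + t • fderiv ℝ Φ p v) (fderiv ℝ Φ p v) 0 := by
      simpa using ((hasDerivAt_id (0 : ℝ)).smul_const (fderiv ℝ Φ p v)).const_add (Φ p)
    have hp0 : Φ p + (0 : ℝ) • fderiv ℝ Φ p v = Φ p := by simp
    have hd : HasDerivAt (fun t : ℝ => Φ.symm (Φ p + t • fderiv ℝ Φ p v))
        (fderiv ℝ Φ.symm (Φ p) (fderiv ℝ Φ p v)) 0 :=
      HasFDerivAt.comp_hasDerivAt (l := Φ.symm) (f := fun t : ℝ => Φ p + t • fderiv ℝ Φ p v) 0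
        (by simpa using d2) hc
    rw [hcomp] at hd
    refine mem_tangentSpaceOf_of_hasDerivAt (by simp [Φ.left_inv hp]) hd ?_
    have ht : ∀ᶠ t : ℝ in 𝓝 0, Φ p + t • fderiv ℝ Φ p v ∈ Φ.target :=
      hc.continuousAt.eventually (Φ.open_target.mem_nhds (by simpa using Φ.map_source hp))
    filter_upwards [ht] with t ht
    refine (h3 _ (Φ.map_target ht)).2 ?_
    rw [Φ.right_inv ht]
    exact L.add_mem ((h3 p hp).1 hpS) (L.smul_mem _ hv)

end TangentSpaces

/-! ### Double annihilators -/

section Annihilators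

variable {V : Type*} [NormedAddCommGroup V] [NormedSpace ℝ V] [FiniteDimensional ℝ V]

/-- A vector killed by the annihilator of a subspace lies in that subspace. -/
theorem mem_of_forall_annihilator {P : Submodule ℝ V} {y : V}
    (h : ∀ v : StrongDual ℝ V, (∀ x ∈ P, v x = 0) → v y = 0) : y ∈ P := by
  by_contra hy
  obtain ⟨f, hf, hP⟩ := P.exists_le_ker_of_notMem hy
  exact hf (h (LinearMap.toContinuousLinearMap f) fun x hx => hP hx)

/-- A covector vanishing where a subspace of covectors vanishes lies in that subspace. -/
theorem mem_of_forall_coannihilator {T : Submodule ℝ (StrongDual ℝ V)} {w : StrongDual ℝ V}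
    (h : ∀ x : V, (∀ v ∈ T, v x = 0) → w x = 0) : w ∈ T := by
  refine mem_of_forall_annihilator fun Θ hΘ => ?_
  obtain ⟨z, rfl⟩ := exists_inclusionInDoubleDual_eq Θ
  exact h z hΘ

end Annihilators

/-! ### Transport of Poisson structures and gluing of local inverses -/

section PoissonTransport

variable {V E : Type*} [NormedAddCommGroup V] [NormedSpace ℝ V]
  [NormedAddCommGroup E] [NormedSpace ℝ E]

theorem hasFDerivAt_poissonBracket {π : V → Bivector V} {f g : V → ℝ} {w : V}
    (hπ : ContDiffAt ℝ ∞ π w) (hf : ContDiffAt ℝ ∞ f w) (hg : ContDiffAt ℝ ∞ g w) (v : V) :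
    DifferentiableAt ℝ (fun q => fderiv ℝ g q (π q (fderiv ℝ f q))) w ∧
    fderiv ℝ (fun q => fderiv ℝ g q (π q (fderiv ℝ f q))) w v =
      fderiv ℝ (fderiv ℝ g) w v (π w (fderiv ℝ f w)) +
        fderiv ℝ g w (fderiv ℝ π w v (fderiv ℝ f w)) +
        fderiv ℝ g w (π w (fderiv ℝ (fderiv ℝ f) w v)) := by
  have h1 := ((hf.fderiv_right (m := ∞) (by simp)).differentiableAt (by simp)).hasFDerivAt
  have h2 := ((hg.fderiv_right (m := ∞) (by simp)).differentiableAt (by simp)).hasFDerivAt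
  have h3 := (hπ.differentiableAt (by simp)).hasFDerivAt
  have h := h2.clm_apply (h3.clm_apply h1)
  refine ⟨h.differentiableAt, ?_⟩
  rw [h.fderiv]
  simp
  abel

/-- The Jacobi identity for linear functions implies that for smooth functions. -/
theorem jacobi_poissonBracket {π : V → Bivector V} (hπ : IsPoissonStructureOn Set.univ π)
    {f g h : V → ℝ} {w : V} (hf : ContDiffAt ℝ ∞ f w) (hg : ContDiffAt ℝ ∞ g w)
    (hh : ContDiffAt ℝ ∞ h w) :
    fderiv ℝ (fun q => fderiv ℝ g q (π q (fderiv ℝ f q))) w (π w (fderiv ℝ h w)) +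
      fderiv ℝ (fun q => fderiv ℝ h q (π q (fderiv ℝ g q))) w (π w (fderiv ℝ f w)) +
      fderiv ℝ (fun q => fderiv ℝ f q (π q (fderiv ℝ h q))) w (π w (fderiv ℝ g w)) = 0 := by
  have hπw : ContDiffAt ℝ ∞ π w := (contDiffOn_univ.1 hπ.smooth).contDiffAt
  rw [(hasFDerivAt_poissonBracket hπw hf hg _).2, (hasFDerivAt_poissonBracket hπw hg hh _).2,
    (hasFDerivAt_poissonBracket hπw hh hf _).2]
  have hJ := hπ.jacobi w trivial (fderiv ℝ f w) (fderiv ℝ g w) (fderiv ℝ h w)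
  have hd : ∀ (α β : StrongDual ℝ V) (v : V),
      fderivWithin ℝ (fun q => β (π q α)) Set.univ w v = β (fderiv ℝ π w v α) := by
    intro α β v
    have h1 := β.hasFDerivAt.comp w ((hπw.differentiableAt (by simp)).hasFDerivAt.clm_apply
      (hasFDerivAt_const α w))
    rw [fderivWithin_univ]
    have h2 : (fun q => β (π q α)) = β ∘ fun q => π q α := rfl
    rw [h2, h1.fderiv]
    simp
  rw [hd, hd, hd] at hJ
  have hs : ∀ α β : StrongDual ℝ V, β (π w α) = -α (π w β) := hπ.skew w trivial
  have h2 : minSmoothness ℝ 2 ≤ (∞ : WithTop ℕ∞) := by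
    simp only [minSmoothness_of_isRCLikeNormedField]; exact ENat.LEInfty.out
  -- The terms with derivatives of π sum to zero by the identity for linear functions; the Hessian
  -- terms cancel in pairs by skewness of π and symmetry of second derivatives.
  rw [hs (fderiv ℝ (fderiv ℝ f) w _) (fderiv ℝ g w), hs (fderiv ℝ (fderiv ℝ g) w _) (fderiv ℝ h w),
    hs (fderiv ℝ (fderiv ℝ h) w _) (fderiv ℝ f w),
    (hf.isSymmSndFDerivAt h2).eq (π w (fderiv ℝ h w)) (π w (fderiv ℝ g w)),
    (hg.isSymmSndFDerivAt h2).eq (π w (fderiv ℝ h w)) (π w (fderiv ℝ f w)),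
    (hh.isSymmSndFDerivAt h2).eq (π w (fderiv ℝ f w)) (π w (fderiv ℝ g w))]
  linarith

/-- `ψ` is a smooth map on the open set `W`, inverse to the restriction of `t` to `S`. -/
structure IsSmoothInverseOn (t : E → V) (S : Set E) (W : Set V) (ψ : V → E) : Prop where
  isOpen : IsOpen W
  smooth : ContDiffOn ℝ ∞ ψ W
  map_target : ∀ w ∈ W, ψ w ∈ S
  right_inv : ∀ w ∈ W, t (ψ w) = w
  map_source : ∀ n ∈ S, t n ∈ W
  left_inv : ∀ n ∈ S, ψ (t n) = n

/-- The push forward of the bivector field `π` by `ψ`, a one-sided inverse of `t`. -/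
def pushBivector (t : E → V) (ψ : V → E) (π : V → Bivector V) (n : E) : Bivector E :=
  fderiv ℝ ψ (t n) ∘L π (t n) ∘L ContinuousLinearMap.precomp ℝ (fderiv ℝ ψ (t n))

theorem pushBivector_apply (t : E → V) (ψ : V → E) (π : V → Bivector V) (n : E)
    (θ : StrongDual ℝ E) :
    pushBivector t ψ π n θ = fderiv ℝ ψ (t n) (π (t n) (θ ∘L fderiv ℝ ψ (t n))) := rfl

namespace IsSmoothInverseOn

variable {t : E → V} {S : Set E} {W : Set V} {ψ : V → E}

theorem hasFDerivAt (h : IsSmoothInverseOn t S W ψ) {n : E} (hn : n ∈ S) :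
    HasFDerivAt ψ (fderiv ℝ ψ (t n)) (t n) :=
  ((h.smooth.contDiffAt (h.isOpen.mem_nhds (h.map_source n hn))).differentiableAt
    (by simp)).hasFDerivAt

theorem fderiv_mem (h : IsSmoothInverseOn t S W ψ) {n : E} (hn : n ∈ S) (v : V) :
    fderiv ℝ ψ (t n) v ∈ tangentSpaceOf S n := by
  have h1 := (h.hasFDerivAt hn).hasFDerivWithinAt.mapsTo_tangentSpaceOf (S := W) (S' := S)
    h.map_target (v := v) (by
      rw [← Set.univ_inter W, tangentSpaceOf_inter_open _ h.isOpen (h.map_source n hn),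
        tangentSpaceOf_univ]
      trivial)
  rwa [h.left_inv n hn] at h1

theorem fderiv_comp_fderiv (h : IsSmoothInverseOn t S W ψ) (ht : ContDiff ℝ ∞ t) {n : E}
    (hn : n ∈ S) (v : V) : fderiv ℝ t n (fderiv ℝ ψ (t n) v) = v := by
  have h1 : HasFDerivAt t (fderiv ℝ t n) (ψ (t n)) := by
    rw [h.left_inv n hn]; exact (ht.differentiable (by simp) n).hasFDerivAt
  have h2 := h1.comp (t n) (h.hasFDerivAt hn)
  have h3 : HasFDerivAt (t ∘ ψ) (ContinuousLinearMap.id ℝ V) (t n) :=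
    (hasFDerivAt_id _).congr_of_eventuallyEq (by
      filter_upwards [h.isOpen.mem_nhds (h.map_source n hn)] with w hw
      exact h.right_inv w hw)
  exact DFunLike.congr_fun (h2.unique h3) v

theorem fderiv_fderiv_of_mem (h : IsSmoothInverseOn t S W ψ) (ht : ContDiff ℝ ∞ t) {n : E}
    (hn : n ∈ S) {u : E} (hu : u ∈ tangentSpaceOf S n) :
    fderiv ℝ ψ (t n) (fderiv ℝ t n u) = u := by
  have h2 := ((h.hasFDerivAt hn).comp n (ht.differentiable (by simp) n).hasFDerivAt)
  have h3 : HasFDerivWithinAt (ψ ∘ t) (ContinuousLinearMap.id ℝ E) S n :=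
    (hasFDerivWithinAt_id _ _).congr (fun m hm => h.left_inv m hm) (h.left_inv n hn)
  exact h2.hasFDerivWithinAt.eq_of_mem_tangentSpaceOf h3 hu

theorem isDiffeoOn (h : IsSmoothInverseOn t S W ψ) (ht : ContDiff ℝ ∞ t) : IsDiffeoOn t S W :=
  ⟨ht.contDiffOn, h.map_source, ψ, h.smooth, h.map_target, h.left_inv, h.right_inv⟩

theorem isPoissonMapOn (h : IsSmoothInverseOn t S W ψ) (ht : ContDiff ℝ ∞ t)
    (π : V → Bivector V) : IsPoissonMapOn S (pushBivector t ψ π) Set.univ π t where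
  mapsTo := Set.mapsTo_univ _ _
  smooth := ht.contDiffOn
  push n hn α := by
    have hd : ∀ v, fderivWithin ℝ t S n (fderiv ℝ ψ (t n) v) = v := fun v => by
      rw [fderivWithin_apply_eq (ht.differentiable (by simp) n).hasFDerivAt.hasFDerivWithinAt
        (h.fderiv_mem hn v), h.fderiv_comp_fderiv ht hn]
    rw [pushBivector_apply, hd]
    congr 1
    exact ContinuousLinearMap.ext fun v => congrArg α (hd v)

/-- A linear function θ on `E` corresponds to the nonlinear function θ ∘ ψ on `W`. Brackets
correspond as well, so the Jacobi identity for smooth functions on `V` is what is needed. -/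
theorem isPoissonStructureOn (h : IsSmoothInverseOn t S W ψ) (ht : ContDiff ℝ ∞ t)
    (hS : IsEmbeddedSubmanifold S) {π : V → Bivector V} (hπ : IsPoissonStructureOn Set.univ π) :
    IsPoissonStructureOn S (pushBivector t ψ π) where
  submanifold := hS
  tangent n hn α := h.fderiv_mem hn _
  skew n hn α β := hπ.skew (t n) trivial (α ∘L fderiv ℝ ψ (t n)) (β ∘L fderiv ℝ ψ (t n))
  smooth := by
    have h1 : ContDiffOn ℝ ∞ (fun n => fderiv ℝ ψ (t n)) S :=
      (h.smooth.fderiv_of_isOpen h.isOpen (by simp)).comp ht.contDiffOn h.map_source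
    have h2 : ContDiffOn ℝ ∞ (fun n => π (t n)) S :=
      (contDiffOn_univ.1 hπ.smooth).comp_contDiffOn ht.contDiffOn
    have h3 : ContDiffOn ℝ ∞ (fun n => (ContinuousLinearMap.compL ℝ V E ℝ).flip
        (fderiv ℝ ψ (t n))) S := h1.continuousLinearMap_comp _
    exact h1.clm_comp (h2.clm_comp h3)
  jacobi n hn α β γ := by
    have hsm : ∀ θ : StrongDual ℝ E, ∀ w ∈ W, ContDiffAt ℝ ∞ (fun w => θ (ψ w)) w := fun θ w hw =>
      θ.contDiff.contDiffAt.comp w (h.smooth.contDiffAt (h.isOpen.mem_nhds hw))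
    have hfd : ∀ θ : StrongDual ℝ E, ∀ w ∈ W,
        fderiv ℝ (fun w => θ (ψ w)) w = θ ∘L fderiv ℝ ψ w := fun θ w hw =>
      (θ.hasFDerivAt.comp w ((h.smooth.contDiffAt (h.isOpen.mem_nhds hw)).differentiableAt
        (by simp)).hasFDerivAt).fderiv
    have hn' := h.map_source n hn
    have key : ∀ α β γ : StrongDual ℝ E,
        fderivWithin ℝ (fun q => β (pushBivector t ψ π q α)) S n (pushBivector t ψ π n γ) =
        fderiv ℝ (fun w => fderiv ℝ (fun w => β (ψ w)) w (π w (fderiv ℝ (fun w => α (ψ w)) w)))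
          (t n) (π (t n) (fderiv ℝ (fun w => γ (ψ w)) (t n))) := by
      intro α β γ
      have hG := (hasFDerivAt_poissonBracket (contDiffOn_univ.1 hπ.smooth).contDiffAt
        (hsm α _ hn') (hsm β _ hn') 0).1.hasFDerivAt
      have hGt := (hG.comp n (ht.differentiable (by simp) n).hasFDerivAt).hasFDerivWithinAt (s := S)
      have hGt' := hGt.congr (f₁ := fun q => β (pushBivector t ψ π q α))
        (fun q hq => by
          simp only [Function.comp_apply, hfd _ _ (h.map_source q hq)]; rfl)
        (by simp only [Function.comp_apply, hfd _ _ hn']; rfl)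
      have hv : pushBivector t ψ π n γ = fderiv ℝ ψ (t n) (π (t n) (γ ∘L fderiv ℝ ψ (t n))) := rfl
      rw [hv, fderivWithin_apply_eq hGt' (h.fderiv_mem hn _), ContinuousLinearMap.comp_apply,
        h.fderiv_comp_fderiv ht hn, hfd γ _ hn']
    rw [key, key, key]
    exact jacobi_poissonBracket hπ (hsm α _ hn') (hsm β _ hn') (hsm γ _ hn')

end IsSmoothInverseOn

/-- Local smooth inverses of `t` along a section `z` over `X` glue to a smooth inverse near the
image of `z`. -/
theorem exists_isSmoothInverseOn_of_local {t : E → V} (ht : Continuous t) {C : Set E} {X : Set V}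
    {z : V → E} (hz : Isometry z) (htz : ∀ ξ ∈ X, t (z ξ) = ξ)
    (hloc : ∀ ξ ∈ X, ∃ O W ψ, IsOpen O ∧ z ξ ∈ O ∧ IsSmoothInverseOn t (C ∩ O) W ψ)
    {O' : Set E} (hO' : IsOpen O') (hzO' : ∀ ξ ∈ X, z ξ ∈ O') :
    ∃ O W ψ, IsOpen O ∧ O ⊆ O' ∧ (∀ ξ ∈ X, z ξ ∈ O) ∧ IsSmoothInverseOn t (C ∩ O) W ψ := by
  choose! Oξ Wξ ψξ hOξ hzO hinv using hloc
  -- The factor 3 gives room for comparing two balls: a point near z ξ' with the same image as a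
  -- point near z ξ must still lie in the domain of the inverse at ξ.
  have hδ : ∀ ξ ∈ X, ∃ δ > 0, Metric.ball (z ξ) (3 * δ) ⊆ Oξ ξ ∩ O' := by
    intro ξ hξ
    obtain ⟨ε, hε, h⟩ := Metric.isOpen_iff.1 ((hOξ ξ hξ).inter hO') (z ξ) ⟨hzO ξ hξ, hzO' ξ hξ⟩
    exact ⟨ε / 3, by positivity, by convert h using 2; ring⟩
  choose! δ hδ0 hδ using hδ
  -- Closeness of t n to ξ is imposed along with that of n to z ξ. Equal images then bound dist ξ
  -- ξ', which equals dist (z ξ) (z ξ').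
  let O : Set E := ⋃ ξ ∈ X, Metric.ball (z ξ) (δ ξ) ∩ t ⁻¹' Metric.ball ξ (δ ξ)
  have hO : IsOpen O := isOpen_biUnion fun ξ _ =>
    Metric.isOpen_ball.inter (Metric.isOpen_ball.preimage ht)
  have hmem : ∀ n ∈ O, ∃ ξ ∈ X, dist n (z ξ) < δ ξ ∧ dist (t n) ξ < δ ξ := by
    intro n hn
    obtain ⟨ξ, hξ, h1, h2⟩ := Set.mem_iUnion₂.1 hn
    exact ⟨ξ, hξ, h1, h2⟩
  have hsub : ∀ ξ ∈ X, ∀ n, dist n (z ξ) < 3 * δ ξ → n ∈ Oξ ξ ∩ O' := fun ξ hξ n hn => hδ ξ hξ hn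
  -- When δ ξ' ≤ δ ξ, the triangle inequality gives dist m (z ξ) < δ ξ' + (δ ξ + δ ξ') ≤ 3 δ ξ. Both
  -- points lie in the domain at ξ, where `t` is injective on `C`.
  have key : ∀ n ∈ C ∩ O, ∀ m ∈ C ∩ O, t n = t m → ∀ ξ ∈ X, ∀ ξ' ∈ X, dist n (z ξ) < δ ξ →
      dist (t n) ξ < δ ξ → dist m (z ξ') < δ ξ' → dist (t m) ξ' < δ ξ' → δ ξ' ≤ δ ξ → n = m := by
    intro n hn m hm hnm ξ hξ ξ' hξ' h1 h2 h3 h4 hle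
    have h5 : dist (z ξ') (z ξ) < δ ξ + δ ξ' := by
      rw [hz.dist_eq]
      calc dist ξ' ξ ≤ dist ξ' (t m) + dist (t m) ξ := dist_triangle _ _ _
        _ = dist (t m) ξ' + dist (t n) ξ := by rw [dist_comm, hnm]
        _ < δ ξ + δ ξ' := by linarith
    have h6 : dist m (z ξ) < 3 * δ ξ := by
      have := dist_triangle m (z ξ') (z ξ)
      linarith
    have hn' := (hinv ξ hξ).left_inv n ⟨hn.1, (hsub ξ hξ n (by linarith [hδ0 ξ hξ])).1⟩
    have hm' := (hinv ξ hξ).left_inv m ⟨hm.1, (hsub ξ hξ m h6).1⟩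
    rw [← hn', ← hm', hnm]
  have hinj : Set.InjOn t (C ∩ O) := by
    intro n hn m hm hnm
    obtain ⟨ξ, hξ, h1, h2⟩ := hmem n hn.2
    obtain ⟨ξ', hξ', h3, h4⟩ := hmem m hm.2
    rcases le_total (δ ξ') (δ ξ) with hle | hle
    · exact key n hn m hm hnm ξ hξ ξ' hξ' h1 h2 h3 h4 hle
    · exact (key m hm n hn hnm.symm ξ' hξ' ξ hξ h3 h4 h1 h2 hle).symm
  have hlocal : ∀ n ∈ C ∩ O, ∃ ξ ∈ X, ∃ N : Set V, N ∈ 𝓝 (t n) ∧ N ⊆ Wξ ξ ∧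
      ∀ w ∈ N, ψξ ξ w ∈ C ∩ O := by
    intro n hn
    obtain ⟨ξ, hξ, h1, -⟩ := hmem n hn.2
    have hnξ : n ∈ C ∩ Oξ ξ := ⟨hn.1, (hsub ξ hξ n (by linarith [hδ0 ξ hξ])).1⟩
    have hw := (hinv ξ hξ).map_source n hnξ
    refine ⟨ξ, hξ, Wξ ξ ∩ ψξ ξ ⁻¹' O, ?_, Set.inter_subset_left, fun w hw =>
      ⟨((hinv ξ hξ).map_target w hw.1).1, hw.2⟩⟩
    refine ((hinv ξ hξ).smooth.continuousOn.isOpen_inter_preimage (hinv ξ hξ).isOpen hO).mem_nhds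
      ⟨hw, ?_⟩
    change ψξ ξ (t n) ∈ O
    rw [(hinv ξ hξ).left_inv n hnξ]
    exact hn.2
  classical
  rcases isEmpty_or_nonempty E with hE | hE
  · refine ⟨∅, ∅, z, isOpen_empty, Set.empty_subset _, fun ξ _ => (hE.false (z ξ)).elim, ?_⟩
    exact ⟨isOpen_empty, contDiffOn_empty, by simp, by simp, by simp, by simp⟩
  -- By injectivity this global choice agrees near each point with one of the local smooth inverses.
  let ψ : V → E := Function.invFunOn t (C ∩ O)
  have hψ : ∀ n ∈ C ∩ O, ψ (t n) = n := fun n hn => hinj.leftInvOn_invFunOn hn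
  refine ⟨O, t '' (C ∩ O), ψ, hO, ?_, ?_, ?_, ?_, ?_, ?_, ?_, hψ⟩
  · intro n hn
    obtain ⟨ξ, hξ, h1, -⟩ := hmem n hn
    exact (hsub ξ hξ n (by linarith [hδ0 ξ hξ])).2
  · intro ξ hξ
    refine Set.mem_iUnion₂.2 ⟨ξ, hξ, Metric.mem_ball_self (hδ0 ξ hξ), ?_⟩
    change t (z ξ) ∈ Metric.ball ξ (δ ξ)
    rw [htz ξ hξ]
    exact Metric.mem_ball_self (hδ0 ξ hξ)
  · refine isOpen_iff_mem_nhds.2 ?_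
    rintro _ ⟨n, hn, rfl⟩
    obtain ⟨ξ, hξ, N, hN, hNW, hNC⟩ := hlocal n hn
    filter_upwards [hN] with w hw
    exact ⟨ψξ ξ w, hNC w hw, (hinv ξ hξ).right_inv w (hNW hw)⟩
  · rintro _ ⟨n, hn, rfl⟩
    obtain ⟨ξ, hξ, N, hN, hNW, hNC⟩ := hlocal n hn
    have hs : ContDiffAt ℝ ∞ (ψξ ξ) (t n) := (hinv ξ hξ).smooth.contDiffAt
      ((hinv ξ hξ).isOpen.mem_nhds (hNW (mem_of_mem_nhds hN)))
    refine (hs.congr_of_eventuallyEq ?_).contDiffWithinAt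
    filter_upwards [hN] with w hw
    have := hψ _ (hNC w hw)
    rwa [(hinv ξ hξ).right_inv w (hNW hw)] at this
  · rintro _ ⟨n, hn, rfl⟩
    rw [hψ n hn]; exact hn
  · rintro _ ⟨n, hn, rfl⟩
    rw [hψ n hn]
  · exact fun n hn => ⟨n, hn, rfl⟩

end PoissonTransport

/-! ### Inverse function theorem on a submanifold -/

section Charts

variable {V E : Type*} [NormedAddCommGroup V] [NormedSpace ℝ V]
  [NormedAddCommGroup E] [NormedSpace ℝ E]

theorem OpenPartialHomeomorph.hasFDerivAt_of_contDiffOn {Φ : OpenPartialHomeomorph V E}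
    (h1 : ContDiffOn ℝ ∞ Φ Φ.source) {p : V} (hp : p ∈ Φ.source) :
    HasFDerivAt Φ (fderiv ℝ Φ p) p :=
  ((h1.contDiffAt (Φ.open_source.mem_nhds hp)).differentiableAt (by simp)).hasFDerivAt

theorem OpenPartialHomeomorph.fderiv_symm_fderiv {Φ : OpenPartialHomeomorph V E}
    (h1 : ContDiffOn ℝ ∞ Φ Φ.source) (h2 : ContDiffOn ℝ ∞ Φ.symm Φ.target) {p : V}
    (hp : p ∈ Φ.source) (v : V) : fderiv ℝ Φ.symm (Φ p) (fderiv ℝ Φ p v) = v := by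
  have h : HasFDerivAt (Φ.symm ∘ Φ) (ContinuousLinearMap.id ℝ V) p :=
    (hasFDerivAt_id p).congr_of_eventuallyEq (Φ.eventually_left_inverse hp)
  exact DFunLike.congr_fun (((Φ.symm.hasFDerivAt_of_contDiffOn h2 (Φ.map_source hp)).comp p
    (Φ.hasFDerivAt_of_contDiffOn h1 hp)).unique h) v

theorem OpenPartialHomeomorph.fderiv_fderiv_symm {Φ : OpenPartialHomeomorph V E}
    (h1 : ContDiffOn ℝ ∞ Φ Φ.source) (h2 : ContDiffOn ℝ ∞ Φ.symm Φ.target) {p : V}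
    (hp : p ∈ Φ.source) (w : E) : fderiv ℝ Φ p (fderiv ℝ Φ.symm (Φ p) w) = w := by
  have h := Φ.symm.fderiv_symm_fderiv (by simpa using h2) (by simpa using h1) (Φ.map_source hp) w
  simpa [Φ.left_inv hp] using h

/-- A smooth map whose derivative at `p` restricts to an isomorphism on the tangent space of a
submanifold has a smooth inverse on a neighbourhood of `p` in that submanifold. -/
theorem exists_isSmoothInverseOn_of_bijective [FiniteDimensional ℝ E] [FiniteDimensional ℝ V]
    {t : E → V} (ht : ContDiff ℝ ∞ t) {C : Set E} (hC : IsEmbeddedSubmanifold C) {p : E}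
    (hp : p ∈ C) (hinj : ∀ v ∈ tangentSpaceOf C p, fderiv ℝ t p v = 0 → v = 0)
    (hsurj : ∀ w, ∃ v ∈ tangentSpaceOf C p, fderiv ℝ t p v = w) :
    ∃ O W ψ, IsOpen O ∧ p ∈ O ∧ IsSmoothInverseOn t (C ∩ O) W ψ := by
  obtain ⟨Ψ, M, hpΨ, h1, h2, h3⟩ := hC p hp
  have hT := mem_tangentSpaceOf_iff_of_chart h1 h2 h3 hpΨ hp
  let a : M := ⟨Ψ p, (h3 p hpΨ).1 hp⟩
  let D : Set M := {m | (m : E) ∈ Ψ.target}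
  have hD : IsOpen D := Ψ.open_target.preimage continuous_subtype_val
  -- In the chart, `C` is an open piece of the linear space `M`, where the usual inverse function
  -- theorem applies to `t`.
  let f : M → V := fun m => t (Ψ.symm m)
  have hf : ContDiffOn ℝ ∞ f D := ht.comp_contDiffOn
    (h2.comp M.subtypeL.contDiff.contDiffOn fun m hm => hm)
  have hfa : HasFDerivAt f (fderiv ℝ t p ∘L fderiv ℝ Ψ.symm (Ψ p) ∘L M.subtypeL) a := by
    have ht' : HasFDerivAt t (fderiv ℝ t p) (Ψ.symm a) := by
      have : Ψ.symm a = p := Ψ.left_inv hpΨ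
      rw [this]; exact (ht.differentiable (by simp) p).hasFDerivAt
    exact ht'.comp a ((Ψ.symm.hasFDerivAt_of_contDiffOn h2 (Ψ.map_source hpΨ)).comp a
      M.subtypeL.hasFDerivAt)
  have hbij : Function.Bijective (fderiv ℝ t p ∘L fderiv ℝ Ψ.symm (Ψ p) ∘L M.subtypeL) := by
    constructor
    · refine (injective_iff_map_eq_zero _).2 fun m hm => ?_
      have hv : fderiv ℝ Ψ.symm (Ψ p) m ∈ tangentSpaceOf C p := by
        rw [hT, Ψ.fderiv_fderiv_symm h1 h2 hpΨ]; exact m.2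
      have h0 := hinj _ hv hm
      have := Ψ.fderiv_fderiv_symm h1 h2 hpΨ m
      rw [h0, map_zero] at this
      exact Subtype.ext this.symm
    · intro w
      obtain ⟨v, hv, rfl⟩ := hsurj w
      exact ⟨⟨fderiv ℝ Ψ p v, (hT v).1 hv⟩,
        congrArg (fderiv ℝ t p) (Ψ.fderiv_symm_fderiv h1 h2 hpΨ v)⟩
  let e : M ≃L[ℝ] V := (LinearEquiv.ofBijective
    (fderiv ℝ t p ∘L fderiv ℝ Ψ.symm (Ψ p) ∘L M.subtypeL).toLinearMap hbij).toContinuousLinearEquiv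
  obtain ⟨κ, haκ, hκD, hκf, hκ1, hκ2⟩ := exists_openPartialHomeomorph_of_contDiffOn hD hf
    (a := a) (Ψ.map_source hpΨ) e (by rw [hfa.fderiv]; ext; rfl)
  -- The source of κ is open only in `M`; it is the trace of an open subset of `E`, whose preimage
  -- under the chart is the ambient neighbourhood sought.
  obtain ⟨Q, hQ, hQκ⟩ := isOpen_induced_iff.1 κ.open_source
  have hQ' : ∀ m : M, (m : E) ∈ Q ↔ m ∈ κ.source := fun m => by rw [← hQκ]; rfl
  refine ⟨Ψ.source ∩ Ψ ⁻¹' Q, κ.target, fun w => Ψ.symm (κ.symm w),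
    Ψ.isOpen_inter_preimage hQ, ⟨hpΨ, (hQ' a).2 haκ⟩, κ.open_target, ?_, ?_, ?_, ?_, ?_⟩
  · exact h2.comp (M.subtypeL.contDiff.comp_contDiffOn hκ2) fun w hw => hκD (κ.map_target hw)
  · intro w hw
    have hm := hκD (κ.map_target hw)
    have hs := Ψ.map_target hm
    refine ⟨(h3 _ hs).2 ?_, hs, ?_⟩
    · rw [Ψ.right_inv hm]; exact (κ.symm w).2
    · change Ψ (Ψ.symm (κ.symm w)) ∈ Q
      rw [Ψ.right_inv hm]; exact (hQ' _).2 (κ.map_target hw)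
  · intro w hw
    exact (hκf _).symm.trans (κ.right_inv hw)
  all_goals
    rintro n ⟨hn, hnΨ, hnQ⟩
    have hm : (⟨Ψ n, (h3 n hnΨ).1 hn⟩ : M) ∈ κ.source := (hQ' _).1 hnQ
    have hk : κ ⟨Ψ n, (h3 n hnΨ).1 hn⟩ = t n :=
      (hκf _).trans (congrArg t (Ψ.left_inv hnΨ))
  · rw [← hk]; exact κ.map_source hm
  · change Ψ.symm (κ.symm (t n)) = n
    rw [← hk, κ.left_inv hm]
    exact Ψ.left_inv hnΨ

end Charts

/-! ### Transposes of operators on the dual -/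

section Predual

variable {V : Type*} [NormedAddCommGroup V] [NormedSpace ℝ V] [FiniteDimensional ℝ V]

variable (V) in
/-- The canonical isomorphism with the double dual. -/
def doubleDualEquiv : V ≃L[ℝ] StrongDual ℝ (StrongDual ℝ V) :=
  (LinearEquiv.ofBijective (NormedSpace.inclusionInDoubleDual ℝ V).toLinearMap
    ⟨(injective_iff_map_eq_zero _).2 fun _ hx =>
      SeparatingDual.eq_zero_of_forall_dual_eq_zero (R := ℝ) fun ξ => DFunLike.congr_fun hx ξ,
      exists_inclusionInDoubleDual_eq⟩).toContinuousLinearEquiv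

theorem apply_doubleDualEquiv_symm (Θ : StrongDual ℝ (StrongDual ℝ V)) (ζ : StrongDual ℝ V) :
    ζ ((doubleDualEquiv V).symm Θ) = Θ ζ :=
  DFunLike.congr_fun ((doubleDualEquiv V).apply_symm_apply Θ) ζ

/-- The endomorphism of `V` whose dual is a given endomorphism of the dual of `V`. -/
def predualFun (B : Endo (StrongDual ℝ V)) : Endo V :=
  (doubleDualEquiv V).symm.toContinuousLinearMap ∘L ContinuousLinearMap.precomp ℝ B ∘L
    (doubleDualEquiv V).toContinuousLinearMap

theorem apply_predualFun (B : Endo (StrongDual ℝ V)) (x : V) (ζ : StrongDual ℝ V) :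
    ζ (predualFun B x) = B ζ x :=
  apply_doubleDualEquiv_symm (ContinuousLinearMap.precomp ℝ B (doubleDualEquiv V x)) ζ

/-- The endomorphism of `V` whose dual is a given endomorphism of the dual of `V`, as a linear
function of the latter. -/
def predual : Endo (StrongDual ℝ V) →L[ℝ] Endo V := LinearMap.toContinuousLinearMap
  { toFun := predualFun
    map_add' := fun B B' => ContinuousLinearMap.ext fun x => sub_eq_zero.1
      (SeparatingDual.eq_zero_of_forall_dual_eq_zero (R := ℝ) fun ζ => by
        simp [apply_predualFun])
    map_smul' := fun c B => ContinuousLinearMap.ext fun x => sub_eq_zero.1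
      (SeparatingDual.eq_zero_of_forall_dual_eq_zero (R := ℝ) fun ζ => by
        simp [apply_predualFun]) }

theorem apply_predual (B : Endo (StrongDual ℝ V)) (x : V) (ζ : StrongDual ℝ V) :
    ζ (predual B x) = B ζ x := by
  exact apply_predualFun B x ζ

/-- The subspace of `V` annihilated by a subspace of its dual. -/
def coannihilatorOf (T : Submodule ℝ (StrongDual ℝ V)) : Submodule ℝ V where
  carrier := {x | ∀ v ∈ T, v x = 0}
  zero_mem' := by intro v _; simp
  add_mem' := by
    intro a b ha hb v hv
    simp [ha v hv, hb v hv]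
  smul_mem' := by
    intro c a ha v hv
    simp [ha v hv]

end Predual

/-! ### The conormal bundle as a submanifold -/

section Conormal

variable {𝔤 : Type*} [NormedLieAlgebra 𝔤] [FiniteDimensional ℝ 𝔤]

/-- The cotangent lift of a chart of `𝔤^*`. -/
def conormalChart (Φ : OpenPartialHomeomorph (StrongDual ℝ 𝔤) (StrongDual ℝ 𝔤))
    (h1 : ContDiffOn ℝ ∞ Φ Φ.source) (h2 : ContDiffOn ℝ ∞ Φ.symm Φ.target) :
    OpenPartialHomeomorph (𝔤 × StrongDual ℝ 𝔤) (𝔤 × StrongDual ℝ 𝔤) where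
  toFun p := (predual (fderiv ℝ Φ.symm (Φ p.2)) p.1, Φ p.2)
  invFun q := (predual (fderiv ℝ Φ (Φ.symm q.2)) q.1, Φ.symm q.2)
  source := Prod.snd ⁻¹' Φ.source
  target := Prod.snd ⁻¹' Φ.target
  map_source' p hp := Φ.map_source hp
  map_target' q hq := Φ.map_target hq
  left_inv' p hp := by
    refine Prod.ext (sub_eq_zero.1 (SeparatingDual.eq_zero_of_forall_dual_eq_zero (R := ℝ) fun ζ => ?_)) (Φ.left_inv hp)
    simp only [map_sub, apply_predual, Φ.left_inv hp, Φ.fderiv_symm_fderiv h1 h2 hp, sub_self]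
  right_inv' q hq := by
    refine Prod.ext (sub_eq_zero.1 (SeparatingDual.eq_zero_of_forall_dual_eq_zero (R := ℝ) fun ζ => ?_)) (Φ.right_inv hq)
    have := Φ.fderiv_fderiv_symm h1 h2 (Φ.map_target hq) ζ
    simp only [map_sub, apply_predual, this, sub_self]
  open_source := Φ.open_source.preimage continuous_snd
  open_target := Φ.open_target.preimage continuous_snd
  continuousOn_toFun := by
    have hc : ContinuousOn (fun p : 𝔤 × StrongDual ℝ 𝔤 => Φ p.2) (Prod.snd ⁻¹' Φ.source) :=
      h1.continuousOn.comp continuous_snd.continuousOn fun p hp => hp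
    refine ContinuousOn.prodMk (ContinuousOn.clm_apply (predual.continuous.comp_continuousOn ?_)
      continuous_fst.continuousOn) hc
    exact (h2.continuousOn_fderiv_of_isOpen Φ.open_target (by simp)).comp hc
      fun p hp => Φ.map_source hp
  continuousOn_invFun := by
    have hc : ContinuousOn (fun p : 𝔤 × StrongDual ℝ 𝔤 => Φ.symm p.2) (Prod.snd ⁻¹' Φ.target) :=
      h2.continuousOn.comp continuous_snd.continuousOn fun p hp => hp
    refine ContinuousOn.prodMk (ContinuousOn.clm_apply (predual.continuous.comp_continuousOn ?_)
      continuous_fst.continuousOn) hc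
    exact (h1.continuousOn_fderiv_of_isOpen Φ.open_source (by simp)).comp hc
      fun p hp => Φ.map_target hp

variable {Φ : OpenPartialHomeomorph (StrongDual ℝ 𝔤) (StrongDual ℝ 𝔤)}

theorem contDiffOn_conormalChart (h1 : ContDiffOn ℝ ∞ Φ Φ.source)
    (h2 : ContDiffOn ℝ ∞ Φ.symm Φ.target) :
    ContDiffOn ℝ ∞ (conormalChart Φ h1 h2) (conormalChart Φ h1 h2).source := by
  have hc : ContDiffOn ℝ ∞ (fun p : 𝔤 × StrongDual ℝ 𝔤 => Φ p.2) (Prod.snd ⁻¹' Φ.source) :=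
    h1.comp contDiff_snd.contDiffOn fun p hp => hp
  refine ContDiffOn.prodMk (ContDiffOn.clm_apply (ContDiffOn.continuousLinearMap_comp _ ?_)
    contDiff_fst.contDiffOn) hc
  exact (h2.fderiv_of_isOpen Φ.open_target (by simp)).comp hc fun p hp => Φ.map_source hp

theorem contDiffOn_conormalChart_symm (h1 : ContDiffOn ℝ ∞ Φ Φ.source)
    (h2 : ContDiffOn ℝ ∞ Φ.symm Φ.target) :
    ContDiffOn ℝ ∞ (conormalChart Φ h1 h2).symm (conormalChart Φ h1 h2).target := by
  have hc : ContDiffOn ℝ ∞ (fun p : 𝔤 × StrongDual ℝ 𝔤 => Φ.symm p.2) (Prod.snd ⁻¹' Φ.target) :=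
    h2.comp contDiff_snd.contDiffOn fun p hp => hp
  refine ContDiffOn.prodMk (ContDiffOn.clm_apply (ContDiffOn.continuousLinearMap_comp _ ?_)
    contDiff_fst.contDiffOn) hc
  exact (h1.fderiv_of_isOpen Φ.open_source (by simp)).comp hc fun p hp => Φ.map_target hp

/-- The chart acts on the fibre by the transpose of the derivative of Φ⁻¹. As the derivative of Φ
carries T X onto `L`, this transpose carries the annihilator of T X onto that of `L`. -/
theorem conormalChart_mem_iff {X : Set (StrongDual ℝ 𝔤)} {L : Submodule ℝ (StrongDual ℝ 𝔤)}
    (h1 : ContDiffOn ℝ ∞ Φ Φ.source) (h2 : ContDiffOn ℝ ∞ Φ.symm Φ.target)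
    (h3 : ∀ q ∈ Φ.source, (q ∈ X ↔ Φ q ∈ L)) {p : 𝔤 × StrongDual ℝ 𝔤}
    (hp : p ∈ (conormalChart Φ h1 h2).source) :
    p ∈ conormalBundle X ↔ conormalChart Φ h1 h2 p ∈ (coannihilatorOf L).prod L := by
  have hp' : p.2 ∈ Φ.source := hp
  have hT : ∀ hX : p.2 ∈ X, (∀ v ∈ tangentSpaceOf X p.2, v p.1 = 0) ↔
      predual (fderiv ℝ Φ.symm (Φ p.2)) p.1 ∈ coannihilatorOf L := by
    intro hX
    have hv := mem_tangentSpaceOf_iff_of_chart h1 h2 h3 hp' hX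
    constructor
    · intro h w hw
      rw [apply_predual]
      exact h _ ((hv _).2 (by rwa [Φ.fderiv_fderiv_symm h1 h2 hp']))
    · intro h v hvT
      have := h _ ((hv v).1 hvT)
      rwa [apply_predual, Φ.fderiv_symm_fderiv h1 h2 hp'] at this
  constructor
  · rintro ⟨hX, h⟩
    exact ⟨(hT hX).1 h, (h3 _ hp').1 hX⟩
  · rintro ⟨h, hL⟩
    have hX := (h3 _ hp').2 hL
    exact ⟨hX, (hT hX).2 h⟩

theorem isEmbeddedSubmanifold_conormalBundle {X : Set (StrongDual ℝ 𝔤)}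
    (hX : IsEmbeddedSubmanifold X) : IsEmbeddedSubmanifold (conormalBundle X) := by
  intro p hp
  obtain ⟨Φ, L, hpΦ, h1, h2, h3⟩ := hX p.2 hp.1
  exact ⟨conormalChart Φ h1 h2, (coannihilatorOf L).prod L, hpΦ, contDiffOn_conormalChart h1 h2,
    contDiffOn_conormalChart_symm h1 h2, fun q hq => conormalChart_mem_iff h1 h2 h3 hq⟩

omit [FiniteDimensional ℝ 𝔤] in
theorem snd_mem_tangentSpaceOf {X : Set (StrongDual ℝ 𝔤)} {n U : 𝔤 × StrongDual ℝ 𝔤}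
    (hU : U ∈ tangentSpaceOf (conormalBundle X) n) : U.2 ∈ tangentSpaceOf X n.2 :=
  (hasFDerivAt_snd (𝕜 := ℝ) (p := n)).hasFDerivWithinAt.mapsTo_tangentSpaceOf (fun _ h => h.1) hU

/-- Directions along the zero section are tangent, so the matter reduces to vertical vectors (x, 0).
On these the conormal chart is linear in the fibre variable, and its derivative tests exactly
whether x is conormal. -/
theorem mem_tangentSpaceOf_conormalBundle_zero {X : Set (StrongDual ℝ 𝔤)}
    (hX : IsEmbeddedSubmanifold X) {ξ : StrongDual ℝ 𝔤} (hξ : ξ ∈ X) (U : 𝔤 × StrongDual ℝ 𝔤) :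
    U ∈ tangentSpaceOf (conormalBundle X) ((0 : 𝔤), ξ) ↔
      U.1 ∈ coannihilatorOf (tangentSpaceOf X ξ) ∧ U.2 ∈ tangentSpaceOf X ξ := by
  have hmem : ((0 : 𝔤), ξ) ∈ conormalBundle X := ⟨hξ, fun v _ => map_zero v⟩
  have h2 : ∀ η ∈ tangentSpaceOf X ξ,
      ((0 : 𝔤), η) ∈ tangentSpaceOf (conormalBundle X) ((0 : 𝔤), ξ) := fun η hη =>
    HasFDerivWithinAt.mapsTo_tangentSpaceOf
      (hasFDerivAt_prodMk_right (𝕜 := ℝ) (0 : 𝔤) ξ).hasFDerivWithinAt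
      (fun ζ hζ => (⟨hζ, fun v _ => map_zero v⟩ : ((0 : 𝔤), ζ) ∈ conormalBundle X)) hη
  constructor
  · intro hU
    have hU2 := snd_mem_tangentSpaceOf hU
    refine ⟨?_, hU2⟩
    have hU1 : (U.1, (0 : StrongDual ℝ 𝔤)) ∈ tangentSpaceOf (conormalBundle X) ((0 : 𝔤), ξ) := by
      have := Submodule.sub_mem _ hU (h2 _ hU2)
      rwa [show U - ((0 : 𝔤), U.2) = (U.1, 0) by ext <;> simp] at this
    obtain ⟨Φ, L, hpΦ, c1, c2, c3⟩ := hX ξ hξ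
    have hT := mem_tangentSpaceOf_iff_of_chart c1 c2 c3 hpΦ hξ
    rw [mem_tangentSpaceOf_iff_of_chart (contDiffOn_conormalChart c1 c2)
      (contDiffOn_conormalChart_symm c1 c2) (fun q hq => conormalChart_mem_iff c1 c2 c3 hq)
      (show ((0 : 𝔤), ξ) ∈ (conormalChart Φ c1 c2).source from hpΦ) hmem] at hU1
    have hd : HasFDerivAt (fun x : 𝔤 => conormalChart Φ c1 c2 (x, ξ))
        ((predual (fderiv ℝ Φ.symm (Φ ξ))).prod 0) 0 :=
      (predual (fderiv ℝ Φ.symm (Φ ξ))).hasFDerivAt.prodMk (hasFDerivAt_const (Φ ξ) (0 : 𝔤))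
    have hd' := ((conormalChart Φ c1 c2).hasFDerivAt_of_contDiffOn (contDiffOn_conormalChart c1 c2)
      (show ((0 : 𝔤), ξ) ∈ (conormalChart Φ c1 c2).source from hpΦ)).comp (0 : 𝔤)
      (hasFDerivAt_prodMk_left (𝕜 := ℝ) (0 : 𝔤) ξ)
    have he := DFunLike.congr_fun (hd'.unique hd) U.1
    have he' : fderiv ℝ (conormalChart Φ c1 c2) ((0 : 𝔤), ξ) (U.1, 0) =
      (predual (fderiv ℝ Φ.symm (Φ ξ)) U.1, 0) := he
    rw [he'] at hU1
    intro v hv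
    have := hU1.1 _ ((hT v).1 hv)
    simpa [apply_predual, Φ.fderiv_symm_fderiv c1 c2 hpΦ] using this
  · rintro ⟨ha, hη⟩
    have h1 : (U.1, (0 : StrongDual ℝ 𝔤)) ∈ tangentSpaceOf (conormalBundle X) ((0 : 𝔤), ξ) := by
      have hc : HasDerivAt (fun s : ℝ => (s • U.1, ξ)) (U.1, (0 : StrongDual ℝ 𝔤)) 0 := by
        simpa using ((hasDerivAt_id (0 : ℝ)).smul_const U.1).prodMk (hasDerivAt_const (0 : ℝ) ξ)
      refine mem_tangentSpaceOf_of_hasDerivAt (by simp) hc (.of_forall fun s => ⟨hξ, fun v hv => ?_⟩)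
      have := ha v hv
      simp [this]
    have := Submodule.add_mem _ h1 (h2 _ hη)
    simpa using this

end Conormal

/-! ### Poisson transversals of the linear structure -/

section Transversals

variable {𝔤 : Type*} [NormedLieAlgebra 𝔤] [FiniteDimensional ℝ 𝔤]

theorem linearPoisson_doubleDualEquiv (ξ : StrongDual ℝ 𝔤) (x : 𝔤) :
    linearPoisson ξ (doubleDualEquiv 𝔤 x) = ξ ∘L bracketL 𝔤 x :=
  ContinuousLinearMap.ext fun y => linearPoisson_inclusion ξ x y

theorem mem_embeddedNormal_linearPoisson {X : Set (StrongDual ℝ 𝔤)} {ξ η : StrongDual ℝ 𝔤} :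
    η ∈ embeddedNormal linearPoisson X ξ ↔
      ∃ x ∈ coannihilatorOf (tangentSpaceOf X ξ), ξ ∘L bracketL 𝔤 x = η := by
  constructor
  · rintro ⟨α, hα, rfl⟩
    obtain ⟨x, rfl⟩ := (doubleDualEquiv 𝔤).surjective α
    exact ⟨x, hα, (linearPoisson_doubleDualEquiv ξ x).symm⟩
  · rintro ⟨x, hx, rfl⟩
    exact ⟨doubleDualEquiv 𝔤 x, hx, linearPoisson_doubleDualEquiv ξ x⟩

/-- A vector l ∘ [x, ·] of NX, with x conormal, lies in TX iff x is in the kernel of the form on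
N^*X. Elements annihilating TX + NX lie in the same kernel. Its vanishing therefore yields both
halves of TX ⊕ NX. -/
theorem isPoissonTransversal_linearPoisson_iff {X : Set (StrongDual ℝ 𝔤)}
    (hX : IsEmbeddedSubmanifold X) : IsPoissonTransversal linearPoisson X ↔
      ∀ l ∈ X, ∀ x : 𝔤, (∀ v ∈ tangentSpaceOf X l, v x = 0) →
        (∀ y : 𝔤, (∀ v ∈ tangentSpaceOf X l, v y = 0) → l ⁅x, y⁆ = 0) → x = 0 := by
  have hskew : ∀ (l : StrongDual ℝ 𝔤) (x y : 𝔤), l ⁅x, y⁆ = -l ⁅y, x⁆ := fun l x y => by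
    rw [← lie_skew, map_neg]
  constructor
  · rintro ⟨-, h⟩ l hl x hx hxy
    have hT : l ∘L bracketL 𝔤 x ∈ tangentSpaceOf X l := mem_of_forall_coannihilator hxy
    have h0 : l ∘L bracketL 𝔤 x = 0 := Submodule.disjoint_def.1 (h l hl).disjoint _ hT
      (mem_embeddedNormal_linearPoisson.2 ⟨x, hx, rfl⟩)
    refine SeparatingDual.eq_zero_of_forall_dual_eq_zero (R := ℝ) fun η => ?_
    obtain ⟨a, ha, b, hb, rfl⟩ := Submodule.mem_sup.1
      ((h l hl).sup_eq_top.symm ▸ Submodule.mem_top : η ∈ _)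
    obtain ⟨y, hy, rfl⟩ := mem_embeddedNormal_linearPoisson.1 hb
    have : l ⁅x, y⁆ = 0 := DFunLike.congr_fun h0 y
    simp [hx a ha, bracketL_apply, hskew l y x, this]
  · intro h
    refine ⟨hX, fun l hl => ⟨Submodule.disjoint_def.2 fun η hη hN => ?_,
      codisjoint_iff.2 (Submodule.eq_top_iff'.2 fun w => mem_of_forall_coannihilator
        fun x hx => ?_)⟩⟩
    · obtain ⟨x, hx, rfl⟩ := mem_embeddedNormal_linearPoisson.1 hN
      have hx0 : x = 0 := h l hl x hx fun y hy => hy _ hη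
      rw [hx0, map_zero, ContinuousLinearMap.comp_zero]
    · have hx0 : x = 0 := h l hl x (fun v hv => hx v (Submodule.mem_sup_left hv)) fun y hy => by
        have : l ⁅y, x⁆ = 0 :=
          hx _ (Submodule.mem_sup_right (mem_embeddedNormal_linearPoisson.2 ⟨y, hy, rfl⟩))
        rw [hskew, this, neg_zero]
      rw [hx0, map_zero]

end Transversals

/-! ### The tangential component of a bivector -/

section InducedBivector

variable {V : Type*} [NormedAddCommGroup V] [NormedSpace ℝ V] [FiniteDimensional ℝ V]
  {π : V → Bivector V} {X : Set V} {p : V}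

theorem inducedBivector_mem (h : IsCompl (tangentSpaceOf X p) (embeddedNormal π X p))
    (α : StrongDual ℝ V) : inducedBivector π X p α ∈ tangentSpaceOf X p := by
  rw [inducedBivector, dif_pos h]
  exact Submodule.projection_apply_mem h _

theorem exists_sub_inducedBivector_eq (h : IsCompl (tangentSpaceOf X p) (embeddedNormal π X p))
    (α : StrongDual ℝ V) :
    ∃ ν ∈ annihilatorOf (tangentSpaceOf X p), π p α - inducedBivector π X p α = π p ν := by
  have h1 : π p α - inducedBivector π X p α ∈ embeddedNormal π X p := by
    rw [inducedBivector, dif_pos h]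
    change π p α - Submodule.projection _ _ h (π p α) ∈ _
    rw [← Submodule.projection_apply_eq_zero_iff h, map_sub,
      Submodule.projection_apply_of_mem_left h (Submodule.projection_apply_mem h _), sub_self]
  obtain ⟨ν, hν, h2⟩ := h1
  exact ⟨ν, hν, h2.symm⟩

/-- Characterises π_X^♯α as the tangent vector differing from π^♯α by an element of π^♯(N^*X), which
avoids handling the projection itself. -/
theorem inducedBivector_eq (h : IsCompl (tangentSpaceOf X p) (embeddedNormal π X p))
    {α ν : StrongDual ℝ V} {v : V} (hv : v ∈ tangentSpaceOf X p)
    (hν : ν ∈ annihilatorOf (tangentSpaceOf X p)) (e : π p α = v + π p ν) :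
    inducedBivector π X p α = v := by
  obtain ⟨ν', hν', h'⟩ := exists_sub_inducedBivector_eq h α
  have hN : inducedBivector π X p α - v ∈ embeddedNormal π X p := by
    refine ⟨ν - ν', Submodule.sub_mem _ hν hν', ?_⟩
    change π p (ν - ν') = _
    rw [map_sub, ← h', e]; abel
  exact sub_eq_zero.1 (Submodule.disjoint_def.1 h.disjoint _
    (Submodule.sub_mem _ (inducedBivector_mem h α) hv) hN)

end InducedBivector

/-! ### The normal form around a Poisson transversal -/

section NormalForm

variable {𝔤 : Type*} [NormedLieAlgebra 𝔤] [FiniteDimensional ℝ 𝔤]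

theorem linearPoisson_sprayExp_apply (n : 𝔤 × StrongDual ℝ 𝔤) (β z : 𝔤) :
    linearPoisson (sprayExp n) (doubleDualEquiv 𝔤 β) z =
      n.2 ⁅adExp 1 n.1 β, adExp 1 n.1 z⁆ := by
  rw [linearPoisson_doubleDualEquiv]
  change sprayExp n ⁅β, z⁆ = _
  rw [sprayExp_apply, adExp_lie]

/-- The substitution for β absorbs the term of d exp coming from the variation of x: the difference
of the two sides of one equation is that of the other composed with the invertible operator A_1. -/
theorem fderiv_sprayExp_eq_iff {n U : 𝔤 × StrongDual ℝ 𝔤} {β Z : 𝔤}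
    (h : adExp 1 n.1 β = Z + adXi 1 n.1 U.1) :
    fderiv ℝ sprayExp n U = linearPoisson (sprayExp n) (doubleDualEquiv 𝔤 β) ↔
      U.2 = linearPoisson n.2 (doubleDualEquiv 𝔤 Z) := by
  have key : ∀ z, fderiv ℝ sprayExp n U z - linearPoisson (sprayExp n) (doubleDualEquiv 𝔤 β) z =
      (U.2 - linearPoisson n.2 (doubleDualEquiv 𝔤 Z)) (adExp 1 n.1 z) := by
    intro z
    rw [fderiv_sprayExp_apply, linearPoisson_sprayExp_apply, h, linearPoisson_doubleDualEquiv,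
      add_lie, map_add, sub_apply]
    change _ = U.2 (adExp 1 n.1 z) - n.2 ⁅Z, adExp 1 n.1 z⁆
    ring
  constructor
  · intro e
    refine sub_eq_zero.1 (ContinuousLinearMap.ext fun y => ?_)
    have := key (adExp (-1) n.1 y)
    rw [e, sub_self, adExp_apply_adExp_neg] at this
    exact this.symm
  · intro e
    refine ContinuousLinearMap.ext fun z => sub_eq_zero.1 ?_
    rw [key z, e, sub_self]
    rfl

/-- The covector half of the correspondence: exp^*β = pr^*Z - ι_U Ω. Together with the vector half
it identifies the pullback of the graph of π_𝔤 along exp with the gauge transform by -Ω of its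
pullback along pr. -/
theorem fderiv_sprayExp_apply_eq {n U : 𝔤 × StrongDual ℝ 𝔤} {β Z : 𝔤}
    (h : adExp 1 n.1 β = Z + adXi 1 n.1 U.1)
    (hU : U.2 = linearPoisson n.2 (doubleDualEquiv 𝔤 Z)) (V : 𝔤 × StrongDual ℝ 𝔤) :
    fderiv ℝ sprayExp n V β = V.2 Z + (-averagedForm 𝔤 n) ![U, V] := by
  rw [ContinuousAlternatingMap.neg_apply, averagedForm_pair, fderiv_sprayExp_apply, hU,
    linearPoisson_doubleDualEquiv, h]
  change _ = V.2 Z + -(n.2 ⁅Z, adXi 1 n.1 V.1⁆ - _ + _)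
  rw [← lie_skew Z, lie_add, map_add, map_add, map_neg, ← lie_skew (adXi 1 n.1 U.1), map_neg]
  ring

/-- Restriction of this identification to the conormal bundle. The covector Z may be changed by a
conormal element without changing its restriction to TX, and this freedom accounts for replacing π
by π_X. -/
theorem isModelBivectorAt_pushBivector {X : Set (StrongDual ℝ 𝔤)}
    (hX : IsPoissonTransversal linearPoisson X) {O : Set (𝔤 × StrongDual ℝ 𝔤)} (hO : IsOpen O)
    {W : Set (StrongDual ℝ 𝔤)} {ψ : StrongDual ℝ 𝔤 → 𝔤 × StrongDual ℝ 𝔤}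
    (hψ : IsSmoothInverseOn sprayExp (conormalBundle X ∩ O) W ψ) {n : 𝔤 × StrongDual ℝ 𝔤}
    (hn : n ∈ conormalBundle X ∩ O) :
    IsModelBivectorAt X n (pushBivector sprayExp ψ linearPoisson n) := by
  have hT := tangentSpaceOf_inter_open (conormalBundle X) hO hn.2
  have hc := hX.2 n.2 hn.1.1
  have hinv : ∀ V ∈ tangentSpaceOf (conormalBundle X) n,
      fderiv ℝ ψ (sprayExp n) (fderiv ℝ sprayExp n V) = V := fun V hV =>
    hψ.fderiv_fderiv_of_mem contDiff_sprayExp hn (by rwa [hT])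
  have hinv' := hψ.fderiv_comp_fderiv contDiff_sprayExp hn
  ext ⟨⟨U, hU⟩, θ⟩
  constructor
  · rintro ⟨θ', hUθ, hθ⟩
    replace hUθ : U = pushBivector sprayExp ψ linearPoisson n θ' := hUθ
    obtain ⟨β, hβ⟩ := (doubleDualEquiv 𝔤).surjective (θ' ∘L fderiv ℝ ψ (sprayExp n))
    have hdU : fderiv ℝ sprayExp n U = linearPoisson (sprayExp n) (doubleDualEquiv 𝔤 β) := by
      rw [hUθ, pushBivector_apply, hinv', hβ]
    have hZ : adExp 1 n.1 β = (adExp 1 n.1 β - adXi 1 n.1 U.1) + adXi 1 n.1 U.1 := by abel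
    have hU2 := (fderiv_sprayExp_eq_iff hZ).1 hdU
    refine ⟨doubleDualEquiv 𝔤 (adExp 1 n.1 β - adXi 1 n.1 U.1), ?_, ?_⟩
    · change U.2 = _
      exact (inducedBivector_eq hc (snd_mem_tangentSpaceOf hU) (Submodule.zero_mem _)
        (by rw [map_zero, add_zero, hU2])).symm
    · rintro ⟨V, hV⟩
      refine (hθ _).trans ?_
      change θ' V = V.2 _ + _
      rw [← fderiv_sprayExp_apply_eq hZ hU2 V]
      nth_rewrite 1 [← hinv V hV]
      exact (DFunLike.congr_fun hβ (fderiv ℝ sprayExp n V)).symm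
  · rintro ⟨α, hUα, hθ⟩
    replace hUα : U.2 = inducedBivector linearPoisson X n.2 α := hUα
    -- Subtracting ν turns the tangential component π_X^♯α into a value of the full π^♯, to which
    -- the pointwise correspondence applies.
    obtain ⟨ν, hν, hαν⟩ := exists_sub_inducedBivector_eq hc α
    obtain ⟨Z, hZ⟩ := (doubleDualEquiv 𝔤).surjective (α - ν)
    have hU2 : U.2 = linearPoisson n.2 (doubleDualEquiv 𝔤 Z) := by
      rw [hZ, map_sub, ← hαν, hUα]; abel
    have hβ : adExp 1 n.1 (adExp (-1) n.1 (Z + adXi 1 n.1 U.1)) = Z + adXi 1 n.1 U.1 :=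
      adExp_apply_adExp_neg _ _ _
    set β := adExp (-1) n.1 (Z + adXi 1 n.1 U.1)
    refine ⟨doubleDualEquiv 𝔤 β ∘L fderiv ℝ sprayExp n, ?_, ?_⟩
    · change U = pushBivector sprayExp ψ linearPoisson n _
      have : (doubleDualEquiv 𝔤 β ∘L fderiv ℝ sprayExp n) ∘L fderiv ℝ ψ (sprayExp n) =
          doubleDualEquiv 𝔤 β :=
        ContinuousLinearMap.ext fun v => congrArg (doubleDualEquiv 𝔤 β) (hinv' v)
      rw [pushBivector_apply, this, ← (fderiv_sprayExp_eq_iff hβ).2 hU2, hinv U hU]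
    · rintro ⟨V, hV⟩
      refine (hθ _).trans ?_
      change α V.2 + _ = fderiv ℝ sprayExp n V β
      rw [fderiv_sprayExp_apply_eq hβ hU2 V]
      have h1 : V.2 Z = (α - ν) V.2 := by rw [← hZ]; rfl
      rw [h1, sub_apply, hν _ (snd_mem_tangentSpaceOf hV), sub_zero]

theorem sprayExp_zero_left (ξ : StrongDual ℝ 𝔤) : sprayExp ((0 : 𝔤), ξ) = ξ := by
  ext z
  rw [sprayExp_apply, adExp_zero_right]
  rfl

/-- On the zero section A_1 and Ξ_1 are the identity, so d exp is (x, η) ↦ η + ξ ∘ [x, ·]. On N^*X ×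
TX it is bijective because TX ⊕ NX is everything and x ↦ ξ ∘ [x, ·] is injective on N^*X. -/
theorem exists_isSmoothInverseOn_sprayExp_at {X : Set (StrongDual ℝ 𝔤)}
    (hX : IsPoissonTransversal linearPoisson X) {ξ : StrongDual ℝ 𝔤} (hξ : ξ ∈ X) :
    ∃ O W ψ, IsOpen O ∧ ((0 : 𝔤), ξ) ∈ O ∧
      IsSmoothInverseOn sprayExp (conormalBundle X ∩ O) W ψ := by
  have hd : ∀ q : 𝔤 × StrongDual ℝ 𝔤,
      fderiv ℝ sprayExp ((0 : 𝔤), ξ) q = q.2 + ξ ∘L bracketL 𝔤 q.1 := fun q => by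
    ext z
    rw [fderiv_sprayExp_apply]
    simp [adExp_zero_right, adXi_zero_right, bracketL_apply]
  have hc := hX.2 ξ hξ
  refine exists_isSmoothInverseOn_of_bijective contDiff_sprayExp
    (isEmbeddedSubmanifold_conormalBundle hX.1) ⟨hξ, fun v _ => map_zero v⟩ ?_ ?_
  · intro q hq h0
    rw [mem_tangentSpaceOf_conormalBundle_zero hX.1 hξ] at hq
    have hN := mem_embeddedNormal_linearPoisson.2 ⟨q.1, hq.1, rfl⟩
    rw [hd, add_eq_zero_iff_eq_neg] at h0
    have h2 : q.2 = 0 := Submodule.disjoint_def.1 hc.disjoint _ hq.2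
      (h0 ▸ Submodule.neg_mem _ hN)
    have h1 : ξ ∘L bracketL 𝔤 q.1 = 0 := by rw [← neg_eq_zero, ← h0, h2]
    exact Prod.ext ((isPoissonTransversal_linearPoisson_iff hX.1).1 hX ξ hξ q.1 hq.1
      fun y _ => DFunLike.congr_fun h1 y) h2
  · intro w
    obtain ⟨a, ha, b, hb, rfl⟩ := Submodule.mem_sup.1
      (hc.sup_eq_top.symm ▸ Submodule.mem_top : w ∈ _)
    obtain ⟨x, hx, rfl⟩ := mem_embeddedNormal_linearPoisson.1 hb
    exact ⟨(x, a), (mem_tangentSpaceOf_conormalBundle_zero hX.1 hξ _).2 ⟨hx, ha⟩, hd _⟩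

/-- The prescribed `O'` serves the functoriality statement, where the neighbourhood of Y has to be
small enough for F to map it into that of X. -/
theorem exists_isSmoothInverseOn_sprayExp {X : Set (StrongDual ℝ 𝔤)}
    (hX : IsPoissonTransversal linearPoisson X) {O' : Set (𝔤 × StrongDual ℝ 𝔤)} (hO' : IsOpen O')
    (h0 : ∀ ξ ∈ X, ((0 : 𝔤), ξ) ∈ O') :
    ∃ O W ψ, IsOpen O ∧ O ⊆ O' ∧ (∀ ξ ∈ X, ((0 : 𝔤), ξ) ∈ O) ∧
      IsSmoothInverseOn sprayExp (conormalBundle X ∩ O) W ψ :=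
  exists_isSmoothInverseOn_of_local contDiff_sprayExp.continuous
    (z := fun ξ : StrongDual ℝ 𝔤 => ((0 : 𝔤), ξ))
    (Isometry.of_dist_eq fun ξ η => by simp [Prod.dist_eq]) (fun ξ _ => sprayExp_zero_left ξ)
    (fun _ hξ => exists_isSmoothInverseOn_sprayExp_at hX hξ) hO' h0

theorem isNormalFormOn_pushBivector {X : Set (StrongDual ℝ 𝔤)}
    (hX : IsPoissonTransversal linearPoisson X) {O : Set (𝔤 × StrongDual ℝ 𝔤)} (hO : IsOpen O)
    (h0 : ∀ ξ ∈ X, ((0 : 𝔤), ξ) ∈ O) {W : Set (StrongDual ℝ 𝔤)}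
    {ψ : StrongDual ℝ 𝔤 → 𝔤 × StrongDual ℝ 𝔤}
    (hψ : IsSmoothInverseOn sprayExp (conormalBundle X ∩ O) W ψ) :
    IsNormalFormOn X (conormalBundle X ∩ O) (pushBivector sprayExp ψ linearPoisson) where
  isOpen := ⟨O, hO, rfl⟩
  zero_mem ξ hξ := ⟨⟨hξ, fun v _ => map_zero v⟩, h0 ξ hξ⟩
  poisson := hψ.isPoissonStructureOn contDiff_sprayExp
    ((isEmbeddedSubmanifold_conormalBundle hX.1).inter_open hO) isPoissonStructureOn_linearPoisson
  model _ hn := isModelBivectorAt_pushBivector hX hO hψ hn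
  poissonMap := hψ.isPoissonMapOn contDiff_sprayExp _
  diffeo := ⟨W, hψ.isOpen, hψ.isDiffeoOn contDiff_sprayExp⟩

end NormalForm

/-! ### Preimages of submanifolds under transverse linear maps -/

section Preimage

variable {V W : Type*} [NormedAddCommGroup V] [NormedSpace ℝ V] [FiniteDimensional ℝ V]
  [NormedAddCommGroup W] [NormedSpace ℝ W] [FiniteDimensional ℝ W]

/-- The preimage of a submanifold under a linear map transverse to it, near a point. -/
theorem exists_chart_preimage (A : V →L[ℝ] W) {X : Set W} (hX : IsEmbeddedSubmanifold X) {p : V}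
    (hp : A p ∈ X) (hA : A.range ⊔ tangentSpaceOf X (A p) = ⊤) :
    ∃ (κ : OpenPartialHomeomorph V V) (L : Submodule ℝ V), p ∈ κ.source ∧
      ContDiffOn ℝ ∞ κ κ.source ∧ ContDiffOn ℝ ∞ κ.symm κ.target ∧
      (∀ q ∈ κ.source, (q ∈ A ⁻¹' X ↔ κ q ∈ L)) ∧
      ∀ v, fderiv ℝ κ p v ∈ L ↔ A v ∈ tangentSpaceOf X (A p) := by
  obtain ⟨Φ, L, hpΦ, h1, h2, h3⟩ := hX (A p) hp
  have hT := mem_tangentSpaceOf_iff_of_chart h1 h2 h3 hpΦ hp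
  obtain ⟨K, hLK⟩ := L.exists_isCompl
  let P : W →L[ℝ] K := LinearMap.toContinuousLinearMap (K.projectionOnto L hLK.symm)
  have hP : ∀ w, P w = 0 ↔ w ∈ L := fun w => Submodule.projectionOnto_apply_eq_zero_iff hLK.symm
  have hPK : ∀ k : K, P k = k := fun k => Submodule.projectionOnto_apply_left hLK.symm k
  let R : V →L[ℝ] K := P ∘L fderiv ℝ Φ (A p) ∘L A
  have hR : ∀ v, R v = 0 ↔ A v ∈ tangentSpaceOf X (A p) := fun v => (hP _).trans (hT _).symm
  have hRs : Function.Surjective R := by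
    intro k
    obtain ⟨_, ⟨v, rfl⟩, t, ht, e⟩ := Submodule.mem_sup.1
      (hA.symm ▸ Submodule.mem_top : fderiv ℝ Φ.symm (Φ (A p)) k ∈ _)
    refine ⟨v, ?_⟩
    change P (fderiv ℝ Φ (A p) (A v)) = k
    have e' : A v = fderiv ℝ Φ.symm (Φ (A p)) k - t := eq_sub_of_add_eq e
    rw [e', map_sub, Φ.fderiv_fderiv_symm h1 h2 hpΦ, map_sub, hPK, (hP _).2 ((hT t).1 ht), sub_zero]
  obtain ⟨s', hs'⟩ := R.toLinearMap.exists_rightInverse_of_surjective (LinearMap.range_eq_top.2 hRs)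
  let s : K →L[ℝ] V := LinearMap.toContinuousLinearMap s'
  have hs : ∀ k, R (s k) = k := fun k => LinearMap.congr_fun hs' k
  have hD : IsOpen (A ⁻¹' Φ.source) := Φ.open_source.preimage A.continuous
  have hρ : ContDiffOn ℝ ∞ (fun q => P (Φ (A q))) (A ⁻¹' Φ.source) :=
    P.contDiff.comp_contDiffOn (h1.comp A.contDiff.contDiffOn fun q hq => hq)
  have hρd : HasFDerivAt (fun q => P (Φ (A q))) R p := P.hasFDerivAt.comp p
    ((Φ.hasFDerivAt_of_contDiffOn h1 hpΦ).comp p A.hasFDerivAt)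
  -- The identity with its R-component replaced by the nonlinear defining function: R ∘ Θ = P ∘ Φ ∘
  -- A, and Θ has identity derivative at p. Hence Θ is a local chart taking the preimage to ker R.
  let Θ : V → V := fun q => q - s (R q) + s (P (Φ (A q)))
  have hΘ : ContDiffOn ℝ ∞ Θ (A ⁻¹' Φ.source) :=
    (contDiff_id.sub (s ∘L R).contDiff).contDiffOn.add (s.contDiff.comp_contDiffOn hρ)
  have hΘd : HasFDerivAt Θ (ContinuousLinearMap.id ℝ V) p := by
    have := ((hasFDerivAt_id p).sub (s ∘L R).hasFDerivAt).add (s.hasFDerivAt.comp p hρd)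
    rwa [sub_add_cancel] at this
  obtain ⟨κ, hpκ, hκD, hκf, hκ1, hκ2⟩ := exists_openPartialHomeomorph_of_contDiffOn hD hΘ
    (a := p) hpΦ (ContinuousLinearEquiv.refl ℝ V) hΘd.fderiv
  refine ⟨κ, R.ker, hpκ, hκ1, hκ2, fun q hq => ?_, fun v => ?_⟩
  · change A q ∈ X ↔ R (κ q) = 0
    rw [h3 _ (hκD hq), ← hP, hκf, map_add, map_sub, hs, hs, sub_self, zero_add]
  · rw [show (κ : V → V) = Θ from funext hκf, hΘd.fderiv]
    exact hR v

theorem isEmbeddedSubmanifold_preimage (A : V →L[ℝ] W) {X : Set W} (hX : IsEmbeddedSubmanifold X)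
    (hA : ∀ p ∈ A ⁻¹' X, A.range ⊔ tangentSpaceOf X (A p) = ⊤) :
    IsEmbeddedSubmanifold (A ⁻¹' X) := by
  intro p hp
  obtain ⟨κ, L, h0, h1, h2, h3, -⟩ := exists_chart_preimage A hX hp (hA p hp)
  exact ⟨κ, L, h0, h1, h2, h3⟩

theorem mem_tangentSpaceOf_preimage (A : V →L[ℝ] W) {X : Set W} (hX : IsEmbeddedSubmanifold X)
    {p : V} (hp : A p ∈ X) (hA : A.range ⊔ tangentSpaceOf X (A p) = ⊤) (v : V) :
    v ∈ tangentSpaceOf (A ⁻¹' X) p ↔ A v ∈ tangentSpaceOf X (A p) := by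
  obtain ⟨κ, L, h0, h1, h2, h3, h4⟩ := exists_chart_preimage A hX hp hA
  exact (mem_tangentSpaceOf_iff_of_chart h1 h2 h3 h0 hp v).trans (h4 v)

end Preimage

/-- Covectors agreeing on TX differ by a conormal one, which π_X does not see. It permits replacing
derivatives within X, determined only on TX, by ambient ones. -/
theorem inducedBivector_congr {V : Type*} [NormedAddCommGroup V] [NormedSpace ℝ V]
    [FiniteDimensional ℝ V] {π : V → Bivector V} {X : Set V} {p : V}
    (h : IsCompl (tangentSpaceOf X p) (embeddedNormal π X p)) {α β : StrongDual ℝ V}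
    (hαβ : ∀ v ∈ tangentSpaceOf X p, α v = β v) :
    inducedBivector π X p α = inducedBivector π X p β := by
  obtain ⟨ν, hν, e⟩ := exists_sub_inducedBivector_eq h β
  refine inducedBivector_eq h (inducedBivector_mem h β)
    (ν := α - β + ν) (fun v hv => ?_) ?_
  · simp [hαβ v hv, hν v hv]
  · rw [map_add, map_sub, ← e]; abel

/-- The exponential intertwines what its argument intertwines. -/
theorem map_normedSpace_exp_apply {V W : Type*} [NormedAddCommGroup V] [NormedSpace ℝ V]
    [CompleteSpace V] [NormedAddCommGroup W] [NormedSpace ℝ W] [CompleteSpace W] (f : V →L[ℝ] W)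
    {A : Endo V} {B : Endo W} (h : ∀ z, f (A z) = B (f z)) (z : V) :
    f (NormedSpace.exp A z) = NormedSpace.exp B (f z) := by
  have hpow : ∀ (n : ℕ) z, f ((A ^ n) z) = (B ^ n) (f z) := by
    intro n
    induction n with
    | zero => intro z; rfl
    | succ n ih => intro z; rw [pow_succ, pow_succ]; exact (ih (A z)).trans (by rw [h]; rfl)
  have h1 := (NormedSpace.exp_series_hasSum_exp' (𝕂 := ℝ) A).mapL
    (f ∘L ContinuousLinearMap.apply ℝ V z)
  have h2 := (NormedSpace.exp_series_hasSum_exp' (𝕂 := ℝ) B).mapL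
    (ContinuousLinearMap.apply ℝ W (f z))
  have h3 : (fun n : ℕ => (f ∘L ContinuousLinearMap.apply ℝ V z) ((n.factorial⁻¹ : ℝ) • A ^ n)) =
      fun n : ℕ => ContinuousLinearMap.apply ℝ W (f z) ((n.factorial⁻¹ : ℝ) • B ^ n) :=
    funext fun n => by
      rw [map_smul, map_smul]
      exact congrArg _ (hpow n z)
  rw [h3] at h1
  exact h1.unique h2

/-! ### Dual maps of Lie algebra morphisms -/

section Morphisms

variable {𝔤 : Type*} [NormedLieAlgebra 𝔤] [FiniteDimensional ℝ 𝔤]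
  {𝔥 : Type*} [NormedLieAlgebra 𝔥] [FiniteDimensional ℝ 𝔥] (f : 𝔤 →ₗ⁅ℝ⁆ 𝔥)

theorem map_adExp (t : ℝ) (x z : 𝔤) : f (adExp t x z) = adExp t (f x) (f z) :=
  map_normedSpace_exp_apply (LinearMap.toContinuousLinearMap (f : 𝔤 →ₗ[ℝ] 𝔥))
    (A := t • bracketL 𝔤 x) (B := t • bracketL 𝔥 (f x)) (fun z => by simp) z

theorem map_adXi (t : ℝ) (x z : 𝔤) : f (adXi t x z) = adXi t (f x) (f z) := by
  rw [adXi_apply, adXi_apply]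
  have := (LinearMap.toContinuousLinearMap (f : 𝔤 →ₗ[ℝ] 𝔥)).intervalIntegral_comp_comm
    ((continuous_adExp_apply x z).intervalIntegrable (μ := MeasureTheory.volume) 0 t)
  refine this.symm.trans ?_
  exact intervalIntegral.integral_congr fun s _ => map_adExp f s x z

theorem dualMapOf_linearPoisson (μ : StrongDual ℝ 𝔥) (x : 𝔤) :
    dualMapOf f (linearPoisson μ (doubleDualEquiv 𝔥 (f x))) =
      linearPoisson (dualMapOf f μ) (doubleDualEquiv 𝔤 x) := by
  ext y
  rw [linearPoisson_doubleDualEquiv, linearPoisson_doubleDualEquiv]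
  change μ ⁅f x, f y⁆ = μ (f ⁅x, y⁆)
  rw [LieHom.map_lie]

theorem doubleDualEquiv_comp_dualMapOf (x : 𝔤) :
    doubleDualEquiv 𝔤 x ∘L dualMapOf f = doubleDualEquiv 𝔥 (f x) := rfl

theorem isPoissonMapOn_dualMapOf :
    IsPoissonMapOn Set.univ linearPoisson Set.univ linearPoisson (dualMapOf f) where
  mapsTo := Set.mapsTo_univ _ _
  smooth := (dualMapOf f).contDiff.contDiffOn
  push μ _ α := by
    obtain ⟨x, rfl⟩ := (doubleDualEquiv 𝔤).surjective α
    rw [fderivWithin_univ, ContinuousLinearMap.fderiv, doubleDualEquiv_comp_dualMapOf,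
      dualMapOf_linearPoisson]

theorem sprayExp_dualMapOf {n : 𝔥 × StrongDual ℝ 𝔥} {x : 𝔤} (hx : f x = n.1) :
    sprayExp (x, dualMapOf f n.2) = dualMapOf f (sprayExp n) := by
  ext z
  rw [sprayExp_apply, dualMapOf_apply, dualMapOf_apply, sprayExp_apply, map_adExp, hx]

variable {f} {X : Set (StrongDual ℝ 𝔤)} {μ : StrongDual ℝ 𝔥}

-- If f x = 0 then (f^*μ)[x, y] = μ[f x, f y] = 0 for all y, so x is in the kernel of the
-- nondegenerate form on N^*X.
omit [FiniteDimensional ℝ 𝔥] in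
theorem eq_zero_of_map_eq_zero (hX : IsPoissonTransversal linearPoisson X)
    (hμ : dualMapOf f μ ∈ X) {x : 𝔤} (hx : x ∈ coannihilatorOf (tangentSpaceOf X (dualMapOf f μ)))
    (h0 : f x = 0) : x = 0 :=
  (isPoissonTransversal_linearPoisson_iff hX.1).1 hX _ hμ x hx fun y _ => by
    rw [dualMapOf_apply, LieHom.map_lie, h0, zero_lie, map_zero]

-- Dual to the injectivity of f on N^*X: an element annihilated by the range of f^* and by TX lies
-- in ker f and in N^*X.
omit [FiniteDimensional ℝ 𝔥] in
theorem range_dualMapOf_sup (hX : IsPoissonTransversal linearPoisson X)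
    (hμ : dualMapOf f μ ∈ X) :
    (dualMapOf f).range ⊔ tangentSpaceOf X (dualMapOf f μ) = ⊤ := by
  refine Submodule.eq_top_iff'.2 fun w => mem_of_forall_coannihilator fun x hx => ?_
  have h0 : f x = 0 := SeparatingDual.eq_zero_of_forall_dual_eq_zero (R := ℝ) fun ν =>
    hx (dualMapOf f ν) (Submodule.mem_sup_left ⟨ν, rfl⟩)
  rw [eq_zero_of_map_eq_zero hX hμ (fun v hv => hx v (Submodule.mem_sup_right hv)) h0, map_zero]

theorem mem_tangentSpaceOf_preimage_dualMapOf (hX : IsPoissonTransversal linearPoisson X)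
    (hμ : dualMapOf f μ ∈ X) (v : StrongDual ℝ 𝔥) : v ∈ tangentSpaceOf (dualMapOf f ⁻¹' X) μ ↔
      dualMapOf f v ∈ tangentSpaceOf X (dualMapOf f μ) :=
  mem_tangentSpaceOf_preimage (dualMapOf f) hX.1 hμ (range_dualMapOf_sup hX hμ) v

/-- By transversality TY is the preimage of TX under f^*, and the annihilator of this preimage is
f(N^*X) by double duality. -/
theorem mem_coannihilatorOf_preimage_iff (hX : IsPoissonTransversal linearPoisson X)
    (hμ : dualMapOf f μ ∈ X) (y : 𝔥) :
    y ∈ coannihilatorOf (tangentSpaceOf (dualMapOf f ⁻¹' X) μ) ↔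
      ∃ x ∈ coannihilatorOf (tangentSpaceOf X (dualMapOf f μ)), f x = y := by
  have hT := mem_tangentSpaceOf_preimage_dualMapOf hX hμ
  constructor
  · intro hy
    suffices h : y ∈ (coannihilatorOf (tangentSpaceOf X (dualMapOf f μ))).map (f : 𝔤 →ₗ[ℝ] 𝔥) by
      exact h
    refine mem_of_forall_annihilator fun v hv => hy v ((hT v).2 ?_)
    exact mem_of_forall_coannihilator fun x hx => hv _ ⟨x, hx, rfl⟩
  · rintro ⟨x, hx, rfl⟩ v hv
    exact hx _ ((hT v).1 hv)

/-- The map f carries N^*X onto N^*Y and intertwines the two forms, since μ[f x, f z] = (f^*μ)[x,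
z]. -/
theorem IsPoissonTransversal.preimage_dualMapOf (hX : IsPoissonTransversal linearPoisson X) :
    IsPoissonTransversal linearPoisson (dualMapOf f ⁻¹' X) := by
  refine (isPoissonTransversal_linearPoisson_iff (isEmbeddedSubmanifold_preimage _ hX.1
    fun μ hμ => range_dualMapOf_sup hX hμ)).2 fun μ hμ y hy hyz => ?_
  obtain ⟨x, hx, rfl⟩ := (mem_coannihilatorOf_preimage_iff hX hμ y).1 hy
  rw [(isPoissonTransversal_linearPoisson_iff hX.1).1 hX _ hμ x hx fun z hz => ?_, map_zero]
  rw [dualMapOf_apply, LieHom.map_lie]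
  exact hyz _ ((mem_coannihilatorOf_preimage_iff hX hμ _).2 ⟨z, hz, rfl⟩)

theorem isPoissonMapOn_inducedBivector (hX : IsPoissonTransversal linearPoisson X) :
    IsPoissonMapOn (dualMapOf f ⁻¹' X) (inducedBivector linearPoisson (dualMapOf f ⁻¹' X))
      X (inducedBivector linearPoisson X) (dualMapOf f) where
  mapsTo _ hμ := hμ
  smooth := (dualMapOf f).contDiff.contDiffOn
  push μ hμ α := by
    have hY := hX.preimage_dualMapOf (f := f)
    have hd : ∀ v ∈ tangentSpaceOf (dualMapOf f ⁻¹' X) μ,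
        fderivWithin ℝ (dualMapOf f) (dualMapOf f ⁻¹' X) μ v = dualMapOf f v := fun v hv =>
      fderivWithin_apply_eq (dualMapOf f).hasFDerivAt.hasFDerivWithinAt hv
    rw [hd _ (inducedBivector_mem (hY.2 μ hμ) _),
      inducedBivector_congr (hY.2 μ hμ) (β := α ∘L dualMapOf f) fun v hv => congrArg α (hd v hv)]
    obtain ⟨ν, hν, e⟩ := exists_sub_inducedBivector_eq (hX.2 _ hμ) α
    obtain ⟨x, rfl⟩ := (doubleDualEquiv 𝔤).surjective ν
    obtain ⟨z, rfl⟩ := (doubleDualEquiv 𝔤).surjective α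
    -- If x is the conormal correction of z on the X side, then f x is that of f z on the Y side, so
    -- f(z - x) computes π_Y.
    have h1 : inducedBivector linearPoisson X (dualMapOf f μ) (doubleDualEquiv 𝔤 z) =
        dualMapOf f (linearPoisson μ (doubleDualEquiv 𝔥 (f (z - x)))) := by
      rw [dualMapOf_linearPoisson, map_sub (doubleDualEquiv 𝔤), map_sub, ← e]; abel
    rw [h1, doubleDualEquiv_comp_dualMapOf]
    congr 1
    refine inducedBivector_eq (hY.2 μ hμ) (ν := doubleDualEquiv 𝔥 (f x)) ?_ ?_ ?_
    · rw [mem_tangentSpaceOf_preimage_dualMapOf hX hμ, ← h1]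
      exact inducedBivector_mem (hX.2 _ hμ) _
    · exact (mem_coannihilatorOf_preimage_iff hX hμ _).2 ⟨x, hν, rfl⟩
    · rw [map_sub f, map_sub (doubleDualEquiv 𝔥), map_sub (linearPoisson μ)]; abel

theorem bijOn_conormal (hX : IsPoissonTransversal linearPoisson X) (hμ : dualMapOf f μ ∈ X) :
    Set.BijOn f {x | (x, dualMapOf f μ) ∈ conormalBundle X}
      {y | (y, μ) ∈ conormalBundle (dualMapOf f ⁻¹' X)} := by
  refine ⟨fun x hx => ⟨hμ, ?_⟩, fun x hx x' hx' e => ?_, fun y hy => ?_⟩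
  · exact (mem_coannihilatorOf_preimage_iff hX hμ _).2 ⟨x, hx.2, rfl⟩
  · refine sub_eq_zero.1 (eq_zero_of_map_eq_zero hX hμ (Submodule.sub_mem _ hx.2 hx'.2) ?_)
    rw [map_sub, e, sub_self]
  · obtain ⟨x, hx, rfl⟩ := (mem_coannihilatorOf_preimage_iff hX hμ _).1 hy.2
    exact ⟨x, ⟨hμ, hx⟩, rfl⟩

end Morphisms

/-! ### The bundle map between conormal bundles -/

section ConormalMap

variable {𝔤 : Type*} [NormedLieAlgebra 𝔤] [FiniteDimensional ℝ 𝔤]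
  {𝔥 : Type*} [NormedLieAlgebra 𝔥] [FiniteDimensional ℝ 𝔥] {f : 𝔤 →ₗ⁅ℝ⁆ 𝔥}
  {X : Set (StrongDual ℝ 𝔤)}

open Classical in
variable (f X) in
/-- The bundle map between conormal bundles formed by the inverses of the restrictions of `f` to
the conormal spaces of `X`. -/
def conormalMap (n : 𝔥 × StrongDual ℝ 𝔥) : 𝔤 × StrongDual ℝ 𝔤 :=
  (if h : ∃ x, (x, dualMapOf f n.2) ∈ conormalBundle X ∧ f x = n.1 then h.choose else 0,
    dualMapOf f n.2)

theorem conormalMap_spec (hX : IsPoissonTransversal linearPoisson X) {n : 𝔥 × StrongDual ℝ 𝔥}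
    (hn : n ∈ conormalBundle (dualMapOf f ⁻¹' X)) :
    conormalMap f X n ∈ conormalBundle X ∧ f (conormalMap f X n).1 = n.1 := by
  have h : ∃ x, (x, dualMapOf f n.2) ∈ conormalBundle X ∧ f x = n.1 :=
    (bijOn_conormal hX hn.1).surjOn hn
  rw [conormalMap, dif_pos h]
  exact h.choose_spec

theorem conormalMap_eq (hX : IsPoissonTransversal linearPoisson X) {n : 𝔥 × StrongDual ℝ 𝔥}
    (hn : n ∈ conormalBundle (dualMapOf f ⁻¹' X)) {x : 𝔤}
    (hx : x ∈ coannihilatorOf (tangentSpaceOf X (dualMapOf f n.2))) (e : f x = n.1) :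
    conormalMap f X n = (x, dualMapOf f n.2) :=
  Prod.ext ((bijOn_conormal hX hn.1).injOn (conormalMap_spec hX hn).1 ⟨hn.1, hx⟩
    ((conormalMap_spec hX hn).2.trans e.symm)) rfl

/-- A chart of X trivialises N^*X by injective maps A ξ from a fixed space. Composed with f and with
a left inverse of f ∘ A at the base point, they give endomorphisms of that space, invertible near
the base point; inverting them solves f x = y smoothly. -/
theorem contDiffOn_conormalMap (hX : IsPoissonTransversal linearPoisson X) :
    ContDiffOn ℝ ∞ (conormalMap f X) (conormalBundle (dualMapOf f ⁻¹' X)) := by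
  intro n₀ hn₀
  obtain ⟨Φ, L, hpΦ, h1, h2, h3⟩ := hX.1 _ hn₀.1
  let fL : 𝔤 →L[ℝ] 𝔥 := LinearMap.toContinuousLinearMap (f : 𝔤 →ₗ[ℝ] 𝔥)
  let L' := coannihilatorOf L
  let A : StrongDual ℝ 𝔤 → L' →L[ℝ] 𝔤 := fun ξ => predual (fderiv ℝ Φ ξ) ∘L L'.subtypeL
  have hA : ContDiffOn ℝ ∞ A Φ.source := by
    refine ContDiffOn.clm_comp (ContDiffOn.continuousLinearMap_comp _ ?_) contDiffOn_const
    exact h1.fderiv_of_isOpen Φ.open_source (by simp)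
  have hA_mem : ∀ ξ ∈ Φ.source, ξ ∈ X → ∀ a, A ξ a ∈ coannihilatorOf (tangentSpaceOf X ξ) := by
    intro ξ hξ hξX a v hv
    change v (predual (fderiv ℝ Φ ξ) a) = 0
    rw [apply_predual]
    exact a.2 _ ((mem_tangentSpaceOf_iff_of_chart h1 h2 h3 hξ hξX v).1 hv)
  have hA_surj : ∀ ξ ∈ Φ.source, ξ ∈ X → ∀ x ∈ coannihilatorOf (tangentSpaceOf X ξ),
      ∃ a, A ξ a = x := by
    intro ξ hξ hξX x hx
    refine ⟨⟨predual (fderiv ℝ Φ.symm (Φ ξ)) x, fun w hw => ?_⟩, ?_⟩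
    · rw [apply_predual]
      refine hx _ ((mem_tangentSpaceOf_iff_of_chart h1 h2 h3 hξ hξX _).2 ?_)
      rwa [Φ.fderiv_fderiv_symm h1 h2 hξ]
    · refine sub_eq_zero.1 (SeparatingDual.eq_zero_of_forall_dual_eq_zero (R := ℝ) fun ζ => ?_)
      change ζ (predual (fderiv ℝ Φ ξ) (predual (fderiv ℝ Φ.symm (Φ ξ)) x) - x) = 0
      simp only [map_sub, apply_predual, Φ.fderiv_symm_fderiv h1 h2 hξ, sub_self]
  have hA_inj : ∀ a, fL (A (dualMapOf f n₀.2) a) = 0 → a = 0 := by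
    intro a ha
    have h0 : A (dualMapOf f n₀.2) a = 0 :=
      eq_zero_of_map_eq_zero hX hn₀.1 (hA_mem _ hpΦ hn₀.1 a) ha
    refine Subtype.ext (SeparatingDual.eq_zero_of_forall_dual_eq_zero (R := ℝ) fun ζ => ?_)
    rw [← Φ.fderiv_fderiv_symm h1 h2 hpΦ ζ, ← apply_predual]
    exact (congrArg _ h0).trans (map_zero _)
  obtain ⟨R', hR'⟩ := (fL ∘L A (dualMapOf f n₀.2)).toLinearMap.exists_leftInverse_of_injective
    (LinearMap.ker_eq_bot'.2 hA_inj)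
  let R : 𝔥 →L[ℝ] L' := LinearMap.toContinuousLinearMap R'
  let B : StrongDual ℝ 𝔥 → L' →L[ℝ] L' := fun μ => R ∘L fL ∘L A (dualMapOf f μ)
  have hB0 : B n₀.2 = ContinuousLinearEquiv.refl ℝ L' :=
    ContinuousLinearMap.ext fun a => LinearMap.congr_fun hR' a
  have hAf : ContDiffAt ℝ ∞ (fun n : 𝔥 × StrongDual ℝ 𝔥 => A (dualMapOf f n.2)) n₀ :=
    (hA.contDiffAt (Φ.open_source.mem_nhds hpΦ)).comp n₀
      ((dualMapOf f).contDiff.comp contDiff_snd).contDiffAt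
  have hB : ContDiffAt ℝ ∞ (fun n : 𝔥 × StrongDual ℝ 𝔥 => B n.2) n₀ :=
    contDiffAt_const.clm_comp (contDiffAt_const.clm_comp hAf)
  have hBinv : ContDiffAt ℝ ∞ (fun n : 𝔥 × StrongDual ℝ 𝔥 => (B n.2).inverse) n₀ := by
    refine ContDiffAt.comp n₀ (g := ContinuousLinearMap.inverse) ?_ hB
    rw [hB0]
    exact contDiffAt_map_inverse _
  -- An ambient smooth formula for F near n₀; it agrees with F on the conormal bundle only.
  have hG : ContDiffAt ℝ ∞ (fun n : 𝔥 × StrongDual ℝ 𝔥 =>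
      (A (dualMapOf f n.2) ((B n.2).inverse (R n.1)), dualMapOf f n.2)) n₀ :=
    (hAf.clm_apply (hBinv.clm_apply (R.contDiff.comp contDiff_fst).contDiffAt)).prodMk
      ((dualMapOf f).contDiff.comp contDiff_snd).contDiffAt
  have hev : ∀ᶠ n : 𝔥 × StrongDual ℝ 𝔥 in 𝓝 n₀, dualMapOf f n.2 ∈ Φ.source ∧
      B n.2 ∈ Set.range ((↑) : (L' ≃L[ℝ] L') → L' →L[ℝ] L') := by
    refine Filter.Eventually.and ?_ (hB.continuousAt.eventually ?_)
    · exact ((dualMapOf f).continuous.comp continuous_snd).continuousAt.eventually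
        (Φ.open_source.mem_nhds hpΦ)
    · change ∀ᶠ y in 𝓝 (B n₀.2), _
      rw [hB0]; exact ContinuousLinearEquiv.nhds _
  have key : ∀ n : 𝔥 × StrongDual ℝ 𝔥, n ∈ conormalBundle (dualMapOf f ⁻¹' X) →
      dualMapOf f n.2 ∈ Φ.source ∧
        B n.2 ∈ Set.range ((↑) : (L' ≃L[ℝ] L') → L' →L[ℝ] L') →
      conormalMap f X n = (A (dualMapOf f n.2) ((B n.2).inverse (R n.1)), dualMapOf f n.2) := by
    rintro n hn ⟨hs, e, he⟩
    have hx := conormalMap_spec hX hn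
    obtain ⟨a, ha⟩ := hA_surj _ hs hn.1 _ hx.1.2
    refine Prod.ext ?_ rfl
    have h4 : R n.1 = B n.2 a := by
      rw [← hx.2]
      exact congrArg (fun z => R (f z)) ha.symm
    have h5 : (B n.2).inverse (R n.1) = a := by
      rw [h4, ← he, ContinuousLinearMap.inverse_equiv]
      exact e.symm_apply_apply a
    change (conormalMap f X n).1 = A (dualMapOf f n.2) ((B n.2).inverse (R n.1))
    rw [h5, ha]
  exact hG.contDiffWithinAt.congr_of_eventuallyEq
    (eventually_nhdsWithin_iff.2 (hev.mono fun n h hn => key n hn h)) (key n₀ hn₀ hev.self_of_nhds)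

theorem sprayExp_conormalMap (hX : IsPoissonTransversal linearPoisson X)
    {n : 𝔥 × StrongDual ℝ 𝔥} (hn : n ∈ conormalBundle (dualMapOf f ⁻¹' X)) :
    sprayExp (conormalMap f X n) = dualMapOf f (sprayExp n) :=
  sprayExp_dualMapOf f (conormalMap_spec hX hn).2

/-- On tangent vectors, differentiating f(F_1 n) = n_1 determines f((dF v)_1) rather than (dF v)_1.
This suffices: every covector in the formula is of the form f^*ζ, and f commutes with Ξ and the
bracket. -/
theorem averagedForm_conormalMap (hX : IsPoissonTransversal linearPoisson X)
    {n : 𝔥 × StrongDual ℝ 𝔥} (hn : n ∈ conormalBundle (dualMapOf f ⁻¹' X))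
    {a b : 𝔥 × StrongDual ℝ 𝔥} (ha : a ∈ tangentSpaceOf (conormalBundle (dualMapOf f ⁻¹' X)) n)
    (hb : b ∈ tangentSpaceOf (conormalBundle (dualMapOf f ⁻¹' X)) n) :
    averagedForm 𝔤 (conormalMap f X n)
        ![fderivWithin ℝ (conormalMap f X) (conormalBundle (dualMapOf f ⁻¹' X)) n a,
          fderivWithin ℝ (conormalMap f X) (conormalBundle (dualMapOf f ⁻¹' X)) n b] =
      averagedForm 𝔥 n ![a, b] := by
  set D := fderivWithin ℝ (conormalMap f X) (conormalBundle (dualMapOf f ⁻¹' X)) n with hD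
  have hF : HasFDerivWithinAt (conormalMap f X) D (conormalBundle (dualMapOf f ⁻¹' X)) n :=
    ((contDiffOn_conormalMap hX).differentiableOn (by simp) n hn).hasFDerivWithinAt
  let fL : 𝔤 →L[ℝ] 𝔥 := LinearMap.toContinuousLinearMap (f : 𝔤 →ₗ[ℝ] 𝔥)
  have hd : ∀ v ∈ tangentSpaceOf (conormalBundle (dualMapOf f ⁻¹' X)) n,
      f (D v).1 = v.1 ∧ (D v).2 = dualMapOf f v.2 := by
    intro v hv
    constructor
    · have h1 := (fL ∘L ContinuousLinearMap.fst ℝ 𝔤 (StrongDual ℝ 𝔤)).hasFDerivAt.comp_hasFDerivWithinAt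
        n hF
      have h2 : HasFDerivWithinAt _ _ (conormalBundle (dualMapOf f ⁻¹' X)) n :=
        (hasFDerivAt_fst (𝕜 := ℝ) (p := n)).hasFDerivWithinAt
      exact h1.eq_of_mem_tangentSpaceOf (h2.congr (fun m hm => (conormalMap_spec hX hm).2)
        (conormalMap_spec hX hn).2) hv
    · have h1 := (ContinuousLinearMap.snd ℝ 𝔤 (StrongDual ℝ 𝔤)).hasFDerivAt.comp_hasFDerivWithinAt
        n hF
      have h2 : HasFDerivWithinAt _ _ (conormalBundle (dualMapOf f ⁻¹' X)) n :=
        (dualMapOf f ∘L ContinuousLinearMap.snd ℝ 𝔥 (StrongDual ℝ 𝔥)).hasFDerivAt.hasFDerivWithinAt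
      exact h1.eq_of_mem_tangentSpaceOf h2 hv
  have hf := (conormalMap_spec hX hn).2
  have h2 : (conormalMap f X n).2 = dualMapOf f n.2 := rfl
  rw [averagedForm_pair, averagedForm_pair, (hd a ha).2, (hd b hb).2, h2, dualMapOf_apply,
    dualMapOf_apply, dualMapOf_apply, LieHom.map_lie, map_adXi, map_adXi, hf, (hd a ha).1,
    (hd b hb).1]

/-- Since exp ∘ F = f^* ∘ exp, one has F ∘ ψY = ψX ∘ f^* on an open set. The differentials agree
there, and the Poisson property of f^* transports to F. -/
theorem isPoissonMapOn_conormalMap (hX : IsPoissonTransversal linearPoisson X)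
    {OY : Set (𝔥 × StrongDual ℝ 𝔥)} {WY : Set (StrongDual ℝ 𝔥)}
    {ψY : StrongDual ℝ 𝔥 → 𝔥 × StrongDual ℝ 𝔥}
    (hY : IsSmoothInverseOn sprayExp (conormalBundle (dualMapOf f ⁻¹' X) ∩ OY) WY ψY)
    {OX : Set (𝔤 × StrongDual ℝ 𝔤)} {WX : Set (StrongDual ℝ 𝔤)}
    {ψX : StrongDual ℝ 𝔤 → 𝔤 × StrongDual ℝ 𝔤}
    (hX' : IsSmoothInverseOn sprayExp (conormalBundle X ∩ OX) WX ψX)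
    (hO : ∀ n ∈ conormalBundle (dualMapOf f ⁻¹' X) ∩ OY, conormalMap f X n ∈ OX) :
    IsPoissonMapOn (conormalBundle (dualMapOf f ⁻¹' X) ∩ OY)
      (pushBivector sprayExp ψY linearPoisson) (conormalBundle X ∩ OX)
      (pushBivector sprayExp ψX linearPoisson) (conormalMap f X) := by
  have hmaps : Set.MapsTo (conormalMap f X) (conormalBundle (dualMapOf f ⁻¹' X) ∩ OY)
      (conormalBundle X ∩ OX) := fun n hn => ⟨(conormalMap_spec hX hn.1).1, hO n hn⟩
  have hsm : ContDiffOn ℝ ∞ (conormalMap f X) (conormalBundle (dualMapOf f ⁻¹' X) ∩ OY) :=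
    (contDiffOn_conormalMap hX).mono Set.inter_subset_left
  refine ⟨hmaps, hsm, fun n hn α => ?_⟩
  set D := fderivWithin ℝ (conormalMap f X) (conormalBundle (dualMapOf f ⁻¹' X) ∩ OY) n
  have hF : HasFDerivWithinAt (conormalMap f X) D
      (conormalBundle (dualMapOf f ⁻¹' X) ∩ OY) (ψY (sprayExp n)) := by
    rw [hY.left_inv n hn]
    exact (hsm.differentiableOn (by simp) n hn).hasFDerivWithinAt
  have ht := sprayExp_conormalMap hX hn.1
  have h1 : HasFDerivAt (conormalMap f X ∘ ψY) (D ∘L fderiv ℝ ψY (sprayExp n)) (sprayExp n) := by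
    have := hF.comp (sprayExp n) (hY.hasFDerivAt hn).hasFDerivWithinAt (s := WY) hY.map_target
    exact this.hasFDerivAt (hY.isOpen.mem_nhds (hY.map_source n hn))
  have h2 : HasFDerivAt (ψX ∘ dualMapOf f)
      (fderiv ℝ ψX (dualMapOf f (sprayExp n)) ∘L dualMapOf f) (sprayExp n) := by
    refine HasFDerivAt.comp (sprayExp n) ?_ (dualMapOf f).hasFDerivAt
    rw [← ht]
    exact hX'.hasFDerivAt (hmaps hn)
  have h3 : conormalMap f X ∘ ψY =ᶠ[𝓝 (sprayExp n)] ψX ∘ dualMapOf f := by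
    filter_upwards [hY.isOpen.mem_nhds (hY.map_source n hn)] with w hw
    have hw' := hY.map_target w hw
    change conormalMap f X (ψY w) = ψX (dualMapOf f w)
    rw [← hX'.left_inv _ (hmaps hw'), sprayExp_conormalMap hX hw'.1, hY.right_inv w hw]
  have hcomp := (h1.congr_of_eventuallyEq h3.symm).unique h2
  rw [pushBivector_apply, pushBivector_apply, ht]
  have h4 : ∀ v, D (fderiv ℝ ψY (sprayExp n) v) =
      fderiv ℝ ψX (dualMapOf f (sprayExp n)) (dualMapOf f v) := fun v => DFunLike.congr_fun hcomp v
  rw [h4]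
  congr 1
  have h5 : (α ∘L D) ∘L fderiv ℝ ψY (sprayExp n) =
      (α ∘L fderiv ℝ ψX (dualMapOf f (sprayExp n))) ∘L dualMapOf f :=
    ContinuousLinearMap.ext fun v => congrArg α (h4 v)
  rw [h5]
  have := (isPoissonMapOn_dualMapOf f).push (sprayExp n) trivial
    (α ∘L fderiv ℝ ψX (dualMapOf f (sprayExp n)))
  rwa [fderivWithin_univ, ContinuousLinearMap.fderiv] at this

theorem exists_isNormalFormOn_conormalMap (hX : IsPoissonTransversal linearPoisson X) :
    ∃ UY PY UX PX, IsNormalFormOn (dualMapOf f ⁻¹' X) UY PY ∧ IsNormalFormOn X UX PX ∧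
      IsPoissonMapOn UY PY UX PX (conormalMap f X) := by
  have hY := hX.preimage_dualMapOf (f := f)
  obtain ⟨OX, WX, ψX, hOX, -, h0X, hψX⟩ := exists_isSmoothInverseOn_sprayExp hX isOpen_univ
    fun _ _ => trivial
  -- F is continuous only relative to the conormal bundle, so the preimage of `OX` is the trace of
  -- an ambient open `Q`. It contains the zero section because F is zero there in the fibre.
  obtain ⟨Q, hQ, hQF⟩ := (continuousOn_iff'.1 (contDiffOn_conormalMap (f := f) hX).continuousOn)
    OX hOX
  have hmemQ : ∀ n ∈ conormalBundle (dualMapOf f ⁻¹' X), n ∈ Q ↔ conormalMap f X n ∈ OX :=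
    fun n hn => by simpa [hn] using (Set.ext_iff.1 hQF n).symm
  have h0Q : ∀ μ ∈ dualMapOf f ⁻¹' X, ((0 : 𝔥), μ) ∈ Q := by
    intro μ hμ
    have hn : ((0 : 𝔥), μ) ∈ conormalBundle (dualMapOf f ⁻¹' X) := ⟨hμ, fun v _ => map_zero v⟩
    rw [hmemQ _ hn, conormalMap_eq hX hn (Submodule.zero_mem _) (map_zero f)]
    exact h0X _ hμ
  obtain ⟨OY, WY, ψY, hOY, hOYQ, h0Y, hψY⟩ := exists_isSmoothInverseOn_sprayExp hY hQ h0Q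
  exact ⟨_, _, _, _, isNormalFormOn_pushBivector hY hOY h0Y hψY,
    isNormalFormOn_pushBivector hX hOX h0X hψX, isPoissonMapOn_conormalMap hX hψY hψX
      fun n hn => (hmemQ n hn.1).1 (hOYQ hn.2)⟩

end ConormalMap

/-! ### Small solutions of a perturbed linear equation -/

section PerturbedODE

open Metric Set

variable {V : Type*} [NormedAddCommGroup V] [NormedSpace ℝ V] [CompleteSpace V]
  {A : Endo V} {f : V × V → V}

/-- The interval [-2, 2] contains t and -t for t in [-1, 2], and 1 - t for t in [0, 1]; these are
all the exponents needed. -/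
theorem exists_norm_exp_smul_le (A : Endo V) :
    ∃ M : NNReal, 1 ≤ M ∧ ∀ t ∈ Icc (-2 : ℝ) 2, ‖NormedSpace.exp (t • A)‖ ≤ M := by
  obtain ⟨C, hC⟩ := (isCompact_Icc (a := (-2 : ℝ)) (b := 2)).exists_bound_of_continuousOn
    (f := fun t : ℝ => NormedSpace.exp (t • A))
    (continuous_exp_smul.comp (by fun_prop : Continuous fun t : ℝ => (t, A))).continuousOn
  exact ⟨max 1 C.toNNReal, le_max_left _ _, fun t ht => (hC t ht).trans
    ((Real.le_coe_toNNReal C).trans (NNReal.coe_le_coe.2 (le_max_right _ _)))⟩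

omit [CompleteSpace V] in
/-- The part of `f` beyond its derivative at the origin is Lipschitz with a small constant. -/
theorem exists_ball_lipschitz_remainder
    (hf : HasStrictFDerivAt f (A ∘L ContinuousLinearMap.fst ℝ V V + ContinuousLinearMap.snd ℝ V V) 0)
    {c : ℝ} (hc : 0 < c) : ∃ δ > 0, ContinuousOn f (ball 0 δ) ∧
      ∀ p ∈ ball (0 : V × V) δ, ∀ q ∈ ball (0 : V × V) δ,
        ‖(f p - A p.1 - p.2) - (f q - A q.1 - q.2)‖ ≤ c * ‖p - q‖ := by
  obtain ⟨s, hs, h⟩ := hf.approximates_deriv_on_nhds (c := c.toNNReal) (Or.inr (Real.toNNReal_pos.2 hc))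
  obtain ⟨δ, hδ, hδs⟩ := Metric.mem_nhds_iff.1 hs
  refine ⟨δ, hδ, h.continuousOn.mono hδs, fun p hp q hq => ?_⟩
  have h1 := h p (hδs hp) q (hδs hq)
  rw [Real.coe_toNNReal c hc.le] at h1
  refine le_trans (le_of_eq ?_) h1
  congr 1
  simp only [add_apply, ContinuousLinearMap.comp_apply, ContinuousLinearMap.coe_fst',
    ContinuousLinearMap.coe_snd', map_sub]
  abel

/-- For small `w` the equation `h' = f (h, w)`, which has the equilibrium `0` for `w = 0`, has
solutions of size `O(w)` starting at the origin. -/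
theorem exists_hasDerivAt_of_hasStrictFDerivAt (h0 : f 0 = 0)
    (hf : HasStrictFDerivAt f
      (A ∘L ContinuousLinearMap.fst ℝ V V + ContinuousLinearMap.snd ℝ V V) 0) :
    ∃ C : ℝ, 0 < C ∧ ∀ᶠ w in 𝓝 (0 : V), ∃ h : ℝ → V, h 0 = 0 ∧
      ∀ t ∈ Ioo (-1 : ℝ) 2, HasDerivAt h (f (h t, w)) t ∧ ‖h t‖ ≤ C * ‖w‖ := by
  obtain ⟨M, hM1, hM⟩ := exists_norm_exp_smul_le A
  have hM1' : (1 : ℝ) ≤ M := by exact_mod_cast hM1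
  have hM0 : (0 : ℝ) < M := by linarith
  have hMn : ∀ t ∈ Icc (-1 : ℝ) 2, ‖NormedSpace.exp (t • A)‖ ≤ M := fun t ht =>
    hM t ⟨by linarith [ht.1], ht.2⟩
  have hMn' : ∀ t ∈ Icc (-1 : ℝ) 2, ‖NormedSpace.exp (-t • A)‖ ≤ M := fun t ht =>
    hM (-t) ⟨by linarith [ht.2], by linarith [ht.1]⟩
  -- With this constant, the remainder at points of size 4M²‖w‖ is at most ‖w‖.
  obtain ⟨δ, hδ, hfc, hρ⟩ := exists_ball_lipschitz_remainder hf (c := 1 / (4 * M ^ 2))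
    (by positivity)
  refine ⟨4 * M ^ 2, by positivity, ?_⟩
  have hev : ∀ᶠ w in 𝓝 (0 : V), ‖w‖ < δ / (4 * M ^ 2) :=
    (continuous_norm.tendsto' (0 : V) 0 norm_zero).eventually_lt_const (by positivity)
  filter_upwards [hev] with w hw
  rw [lt_div_iff₀ (by positivity)] at hw
  have hball : ∀ u : V, ‖u‖ ≤ 4 * M ^ 2 * ‖w‖ → ‖((u, w) : V × V)‖ ≤ 4 * M ^ 2 * ‖w‖ := by
    intro u hu
    refine max_le hu ?_
    have : (1 : ℝ) ≤ 4 * M ^ 2 := by nlinarith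
    exact le_mul_of_one_le_left (norm_nonneg _) this
  have hmem : ∀ u : V, ‖u‖ ≤ 4 * M ^ 2 * ‖w‖ → ((u, w) : V × V) ∈ ball (0 : V × V) δ := fun u hu =>
    mem_ball_zero_iff.2 ((hball u hu).trans_lt (by linarith))
  let a : NNReal := 4 * M * ‖w‖₊
  have hE : ∀ t ∈ Icc (-1 : ℝ) 2, ∀ y ∈ closedBall (0 : V) a,
      ‖NormedSpace.exp (t • A) y‖ ≤ 4 * M ^ 2 * ‖w‖ := by
    intro t ht y hy
    have hy' : ‖y‖ ≤ 4 * M * ‖w‖ := mem_closedBall_zero_iff.1 hy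
    calc ‖NormedSpace.exp (t • A) y‖ ≤ M * (4 * M * ‖w‖) :=
          ContinuousLinearMap.le_of_opNorm_le_of_le _ (hMn t ht) hy'
      _ = 4 * M ^ 2 * ‖w‖ := by ring
  -- Variation of constants, h = e^{tA} y, removes the linear part. The field for y has size at most
  -- 2M‖w‖, so over time 2 the solution stays in the ball of radius 4M‖w‖, and h in that of radius
  -- 4M²‖w‖.
  let G : ℝ → V → V := fun t y => NormedSpace.exp (-t • A)
    (f (NormedSpace.exp (t • A) y, w) - A (NormedSpace.exp (t • A) y))
  have hcont : ∀ s : ℝ, Continuous fun t : ℝ => NormedSpace.exp ((s * t) • A) := fun s =>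
    continuous_exp_smul.comp (by fun_prop : Continuous fun t : ℝ => (s * t, A))
  have hc1 : Continuous fun t : ℝ => NormedSpace.exp (t • A) := by simpa using hcont 1
  have hc2 : Continuous fun t : ℝ => NormedSpace.exp (-t • A) := by simpa using hcont (-1)
  have hPL : IsPicardLindelof G (tmin := -1) (tmax := 2) ⟨0, by norm_num⟩ 0 a 0
      (2 * M * ‖w‖₊) (M * (1 / (4 * M ^ 2) * M)) := by
    refine ⟨fun t ht => ?_, fun y hy => ?_, fun t ht y hy => ?_, ?_⟩
    · refine LipschitzOnWith.of_dist_le_mul fun y hy y' hy' => ?_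
      rw [dist_eq_norm, dist_eq_norm, ← map_sub, NNReal.coe_mul, mul_assoc]
      refine ContinuousLinearMap.le_of_opNorm_le_of_le _ (hMn' t ht) ?_
      have := hρ _ (hmem _ (hE t ht y hy)) _ (hmem _ (hE t ht y' hy'))
      refine (le_of_eq ?_).trans (this.trans ?_)
      · congr 1; simp
      · rw [NNReal.coe_mul, mul_assoc]
        push_cast
        refine mul_le_mul_of_nonneg_left ?_ (by positivity)
        have he : ((NormedSpace.exp (t • A) y, w) : V × V) - (NormedSpace.exp (t • A) y', w) =
            (NormedSpace.exp (t • A) (y - y'), 0) := by simp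
        rw [he]
        refine max_le ?_ (by simp; positivity)
        exact ContinuousLinearMap.le_of_opNorm_le _ (hMn t ht) _
    · have h1 : Continuous fun t : ℝ => NormedSpace.exp (t • A) y := hc1.clm_apply continuous_const
      refine hc2.continuousOn.clm_apply (ContinuousOn.sub (hfc.comp
        (h1.prodMk continuous_const).continuousOn fun t ht => hmem _ (hE t ht y hy))
        (A.continuous.comp h1).continuousOn)
    · have h1 := hρ _ (hmem _ (hE t ht y hy)) 0 (mem_ball_self hδ)
      simp only [h0, Prod.fst_zero, Prod.snd_zero, map_zero, sub_zero] at h1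
      have h2 : ‖f (NormedSpace.exp (t • A) y, w) - A (NormedSpace.exp (t • A) y)‖ ≤ 2 * ‖w‖ := by
        have h3 : 1 / (4 * (M : ℝ) ^ 2) * (4 * M ^ 2 * ‖w‖) = ‖w‖ := by field_simp
        have h4 := h1.trans ((mul_le_mul_of_nonneg_left (hball _ (hE t ht y hy))
          (by positivity)).trans h3.le)
        have h5 := norm_le_norm_sub_add
          (f (NormedSpace.exp (t • A) y, w) - A (NormedSpace.exp (t • A) y)) w
        linarith
      refine (ContinuousLinearMap.le_of_opNorm_le_of_le _ (hMn' t ht) h2).trans (le_of_eq ?_)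
      push_cast
      ring
    · norm_num [a]
      nlinarith [norm_nonneg w]
  -- The fixed point of the Picard operator is used directly because it comes with the bound on the
  -- size of the solution.
  obtain ⟨α, hα⟩ := ODE.FunSpace.exists_isFixedPt_next hPL (mem_closedBall_self le_rfl)
  rw [ODE.FunSpace.isFixedPt_next_iff] at hα
  let y := α.compProj
  have hy : ∀ t ∈ Icc (-1 : ℝ) 2, y t = ODE.picard G 0 0 y t := fun t ht => by
    have := hα ⟨t, ht⟩
    rwa [← ODE.FunSpace.compProj_of_mem ht] at this
  have hya : ∀ t, y t ∈ closedBall (0 : V) a := fun t => α.compProj_mem_closedBall hPL.mul_max_le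
  have hyd : ∀ t ∈ Ioo (-1 : ℝ) 2, HasDerivAt y (G t (y t)) t := by
    intro t ht
    have hI : Icc (-1 : ℝ) 2 ∈ 𝓝 t := Icc_mem_nhds ht.1 ht.2
    have h1 := ODE.hasDerivWithinAt_picard_Icc (x₀ := (0 : V)) (t₀ := 0) (by norm_num)
      hPL.continuousOn_uncurry α.continuous_compProj.continuousOn (fun t _ => hya t)
      (Ioo_subset_Icc_self ht)
    refine (h1.hasDerivAt hI).congr_of_eventuallyEq ?_
    filter_upwards [hI] with s hs using hy s hs
  refine ⟨fun t => NormedSpace.exp (t • A) (y t), ?_, fun t ht => ⟨?_, ?_⟩⟩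
  · change NormedSpace.exp ((0 : ℝ) • A) (y 0) = 0
    rw [hy 0 (by norm_num)]; simp
  · have h1 := (hasDerivAt_exp_smul_const' (𝕂 := ℝ) A t).clm_apply (hyd t ht)
    refine h1.congr_deriv ?_
    have h2 : ∀ v, NormedSpace.exp (t • A) (NormedSpace.exp (-t • A) v) = v := fun v =>
      DFunLike.congr_fun (exp_smul_mul_exp_neg_smul t A) v
    rw [h2]
    exact add_sub_cancel _ _
  · exact hE t (Ioo_subset_Icc_self ht) _ (hya t)

/-- First order expansion, in `w`, at time one of solutions of `h' = f (h, w)` of size `O(w)`. -/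
theorem eventually_norm_sub_integral_exp_le (h0 : f 0 = 0)
    (hf : HasStrictFDerivAt f
      (A ∘L ContinuousLinearMap.fst ℝ V V + ContinuousLinearMap.snd ℝ V V) 0) {C ε : ℝ}
    (hC : 0 < C) (hε : 0 < ε) :
    ∀ᶠ w in 𝓝 (0 : V), ∀ h : ℝ → V, h 0 = 0 →
      (∀ t ∈ Ioo (-1 : ℝ) 2, HasDerivAt h (f (h t, w)) t ∧ ‖h t‖ ≤ C * ‖w‖) →
      ‖h 1 - (∫ s in (0 : ℝ)..1, NormedSpace.exp (s • A)) w‖ ≤ ε * ‖w‖ := by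
  obtain ⟨M, hM1, hM⟩ := exists_norm_exp_smul_le A
  have hM1' : (1 : ℝ) ≤ M := by exact_mod_cast hM1
  obtain ⟨δ, hδ, -, hρ⟩ := exists_ball_lipschitz_remainder hf (c := ε / (M * (C + 1)))
    (by positivity)
  have hev : ∀ᶠ w in 𝓝 (0 : V), ‖w‖ < δ / (C + 1) :=
    (continuous_norm.tendsto' (0 : V) 0 norm_zero).eventually_lt_const (by positivity)
  filter_upwards [hev] with w hw h hh0 hh
  rw [lt_div_iff₀ (by positivity)] at hw
  let X : ℝ → Endo V := fun r => ∫ s in (0 : ℝ)..r, NormedSpace.exp (s • A)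
  have hc1 : Continuous fun t : ℝ => NormedSpace.exp (t • A) :=
    continuous_exp_smul.comp (by fun_prop : Continuous fun t : ℝ => (t, A))
  have hX : ∀ r, HasDerivAt X (NormedSpace.exp (r • A)) r := fun r =>
    intervalIntegral.integral_hasDerivAt_right (hc1.intervalIntegrable _ _)
      (hc1.stronglyMeasurableAtFilter _ _) hc1.continuousAt
  -- This curve runs from (∫_0^1 e^{sA} ds) w at time 0 to h 1 at time 1, and its velocity is
  -- e^{(1-t)A} applied to the nonlinear remainder. The mean value inequality then gives the
  -- estimate.
  let Z : ℝ → V := fun t => NormedSpace.exp ((1 - t) • A) (h t) + X (1 - t) w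
  have hZ : ∀ t ∈ Icc (0 : ℝ) 1, HasDerivWithinAt Z
      (NormedSpace.exp ((1 - t) • A) (f (h t, w) - A (h t) - w)) (Icc 0 1) t := by
    intro t ht
    have h1 : HasDerivAt (fun t : ℝ => 1 - t) (-1) t := by
      simpa using (hasDerivAt_id t).const_sub 1
    have h2 := (hasDerivAt_exp_smul_const (𝕂 := ℝ) A (1 - t)).scomp t h1
    have h3 := (hX (1 - t)).scomp t h1
    have h4 := (h2.clm_apply (hh t ⟨by linarith [ht.1], by linarith [ht.2]⟩).1).add
      (h3.clm_apply (hasDerivAt_const t w))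
    refine (h4.congr_deriv ?_).hasDerivWithinAt
    simp only [Function.comp_apply, neg_smul, one_smul, neg_apply, map_zero, add_zero, map_sub]
    change -(NormedSpace.exp ((1 - t) • A) (A (h t))) + _ + _ = _
    abel
  have hb : ∀ t ∈ Ico (0 : ℝ) 1,
      ‖NormedSpace.exp ((1 - t) • A) (f (h t, w) - A (h t) - w)‖ ≤ ε * ‖w‖ := by
    intro t ht
    have h1 : ‖((h t, w) : V × V)‖ ≤ (C + 1) * ‖w‖ := by
      have := (hh t ⟨by linarith [ht.1], by linarith [ht.2]⟩).2
      refine max_le ?_ ?_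
      · exact this.trans (by nlinarith [norm_nonneg w])
      · change ‖w‖ ≤ _
        nlinarith [norm_nonneg w]
    have h2 := hρ (h t, w) (mem_ball_zero_iff.2 (h1.trans_lt (by linarith))) 0 (mem_ball_self hδ)
    simp only [h0, Prod.fst_zero, Prod.snd_zero, map_zero, sub_zero] at h2
    have h3 := h2.trans (mul_le_mul_of_nonneg_left h1 (by positivity))
    refine (ContinuousLinearMap.le_of_opNorm_le_of_le _
      (hM (1 - t) ⟨by linarith [ht.2], by linarith [ht.1]⟩) h3).trans (le_of_eq ?_)
    field_simp
  have := norm_image_sub_le_of_norm_deriv_le_segment_01' hZ hb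
  simpa [Z, X, hh0] using this

end PerturbedODE

/-! ### A chart of the group modelled on its Lie algebra -/

section LieChart

variable {E : Type*} [NormedAddCommGroup E] [NormedSpace ℝ E] [CompleteSpace E]
  {G : Type*} [TopologicalSpace G] [ChartedSpace E G] [Group G] [LieGroup 𝓘(ℝ, E) ∞ G]
  {𝔤 : Type*} [NormedLieAlgebra 𝔤] [FiniteDimensional ℝ 𝔤]
  (e : 𝔤 ≃ₗ⁅ℝ⁆ GroupLieAlgebra 𝓘(ℝ, E) G)

/-- An identification of Lie algebras as an isomorphism onto the model space of the group. -/
def lieEquiv : 𝔤 ≃L[ℝ] E :=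
  LinearEquiv.toContinuousLinearEquiv (show 𝔤 ≃ₗ[ℝ] E from e.toLinearEquiv)

theorem lieEquiv_apply (x : 𝔤) : lieEquiv e x = e x := rfl

/-- A chart of a Lie group around the identity, with values in its Lie algebra. -/
def lieChart : OpenPartialHomeomorph G 𝔤 :=
  (chartAt E (1 : G)).transHomeomorph
    ((Homeomorph.subRight (chartAt E (1 : G) 1)).trans (lieEquiv e).symm.toHomeomorph)

theorem lieChart_apply (g : G) :
    lieChart e g = (lieEquiv e).symm (chartAt E (1 : G) g - chartAt E (1 : G) 1) := rfl

theorem lieChart_symm_apply (a : 𝔤) : (lieChart e).symm a =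
    (chartAt E (1 : G)).symm (lieEquiv e a + chartAt E (1 : G) 1) := rfl

theorem one_mem_lieChart_source : (1 : G) ∈ (lieChart e).source := mem_chart_source E 1

@[simp] theorem lieChart_one : lieChart e 1 = 0 := by simp [lieChart_apply]

@[simp] theorem lieChart_symm_zero : (lieChart e).symm 0 = 1 := by
  rw [← lieChart_one e, (lieChart e).left_inv (one_mem_lieChart_source e)]

theorem zero_mem_lieChart_target : (0 : 𝔤) ∈ (lieChart e).target := by
  rw [← lieChart_one e]
  exact (lieChart e).map_source (one_mem_lieChart_source e)

theorem contMDiffOn_lieChart :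
    ContMDiffOn 𝓘(ℝ, E) 𝓘(ℝ, 𝔤) ∞ (lieChart e) (lieChart e).source := by
  have h1 : ContMDiffOn 𝓘(ℝ, E) 𝓘(ℝ, E) ∞ (chartAt E (1 : G)) (chartAt E (1 : G)).source :=
    contMDiffOn_chart
  have h2 : ContDiff ℝ ∞ fun a : E => (lieEquiv e).symm (a - chartAt E (1 : G) 1) :=
    (lieEquiv e).symm.contDiff.comp (contDiff_id.sub contDiff_const)
  exact h2.contMDiff.comp_contMDiffOn h1

theorem contMDiffOn_lieChart_symm :
    ContMDiffOn 𝓘(ℝ, 𝔤) 𝓘(ℝ, E) ∞ (lieChart e).symm (lieChart e).target := by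
  have h1 : ContMDiffOn 𝓘(ℝ, E) 𝓘(ℝ, E) ∞ (chartAt E (1 : G)).symm (chartAt E (1 : G)).target :=
    contMDiffOn_chart_symm
  have h2 : ContDiff ℝ ∞ fun a : 𝔤 => lieEquiv e a + chartAt E (1 : G) 1 :=
    (lieEquiv e).contDiff.add contDiff_const
  refine h1.comp h2.contMDiff.contMDiffOn fun a ha => ?_
  simpa [lieChart] using ha

theorem hasMFDerivAt_lieChart_symm_zero :
    HasMFDerivAt 𝓘(ℝ, 𝔤) 𝓘(ℝ, E) (lieChart e).symm 0 ((lieEquiv e : 𝔤 →L[ℝ] E)) := by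
  refine ⟨(lieChart e).symm.continuousAt (zero_mem_lieChart_target e), ?_⟩
  have h1 : HasFDerivAt (fun a : 𝔤 => lieEquiv e a + chartAt E (1 : G) 1)
      (lieEquiv e : 𝔤 →L[ℝ] E) 0 := (lieEquiv e).hasFDerivAt.add_const _
  have h2 : (fun a : 𝔤 => chartAt E ((lieChart e).symm 0) ((lieChart e).symm a)) =ᶠ[𝓝 0]
      fun a : 𝔤 => lieEquiv e a + chartAt E (1 : G) 1 := by
    filter_upwards [(lieChart e).open_target.mem_nhds (zero_mem_lieChart_target e)] with a ha
    rw [lieChart_symm_zero, lieChart_symm_apply]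
    exact (chartAt E (1 : G)).right_inv (by simpa [lieChart] using ha)
  exact (h1.congr_of_eventuallyEq h2).hasFDerivWithinAt

theorem hasMFDerivAt_lieChart_one :
    HasMFDerivAt 𝓘(ℝ, E) 𝓘(ℝ, 𝔤) (lieChart e) 1 ((lieEquiv e).symm : E →L[ℝ] 𝔤) := by
  refine ⟨(lieChart e).continuousAt (one_mem_lieChart_source e), ?_⟩
  have h1 : HasFDerivAt (fun a : E => (lieEquiv e).symm (a - chartAt E (1 : G) 1))
      ((lieEquiv e).symm : E →L[ℝ] 𝔤) (chartAt E (1 : G) 1) :=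
    (lieEquiv e).symm.hasFDerivAt.comp (chartAt E (1 : G) 1)
      ((hasFDerivAt_id (𝕜 := ℝ) (chartAt E (1 : G) 1)).sub_const _)
  have h2 : (fun a : E => lieChart e ((chartAt E (1 : G)).symm a)) =ᶠ[𝓝 (chartAt E (1 : G) 1)]
      fun a : E => (lieEquiv e).symm (a - chartAt E (1 : G) 1) := by
    filter_upwards [(chartAt E (1 : G)).open_target.mem_nhds (mem_chart_target E (1 : G))] with a ha
    rw [lieChart_apply, (chartAt E (1 : G)).right_inv ha]
  exact (h1.congr_of_eventuallyEq h2).hasFDerivWithinAt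

end LieChart

/-! ### Left invariant fields and their integral curves -/

section LieGroupCalculus

variable {E : Type*} [NormedAddCommGroup E] [NormedSpace ℝ E] [CompleteSpace E]
  {G : Type*} [TopologicalSpace G] [ChartedSpace E G] [Group G] [LieGroup 𝓘(ℝ, E) ∞ G]
  {𝔤 : Type*} [NormedLieAlgebra 𝔤] [FiniteDimensional ℝ 𝔤]
  (e : 𝔤 ≃ₗ⁅ℝ⁆ GroupLieAlgebra 𝓘(ℝ, E) G)

omit [CompleteSpace E] in
theorem contMDiff_mul_left_lieGroup (g : G) :
    ContMDiff 𝓘(ℝ, E) 𝓘(ℝ, E) ∞ (fun h : G => g * h) := contMDiff_mul_left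

omit [CompleteSpace E] in
theorem hasMFDerivAt_mul_left (g h : G) : HasMFDerivAt 𝓘(ℝ, E) 𝓘(ℝ, E) (fun b : G => g * b) h
    (mfderiv 𝓘(ℝ, E) 𝓘(ℝ, E) (fun b : G => g * b) h) :=
  ((contMDiff_mul_left_lieGroup g).mdifferentiable (by simp) h).hasMFDerivAt

omit [CompleteSpace E] in
theorem mfderiv_mul_left_inv_mulInvariantVectorField (g : G) (v : GroupLieAlgebra 𝓘(ℝ, E) G) :
    (mfderiv 𝓘(ℝ, E) 𝓘(ℝ, E) (fun b : G => g⁻¹ * b) g : E →L[ℝ] E)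
      (mulInvariantVectorField (I := 𝓘(ℝ, E)) v g) = v := by
  let D : E →L[ℝ] E := mfderiv 𝓘(ℝ, E) 𝓘(ℝ, E) (fun b : G => g⁻¹ * b) g
  have h1 : HasMFDerivAt 𝓘(ℝ, E) 𝓘(ℝ, E) (fun b : G => g⁻¹ * b) (g * 1) D := by
    rw [mul_one]
    exact hasMFDerivAt_mul_left g⁻¹ g
  have h2 := h1.comp (1 : G) (hasMFDerivAt_mul_left (E := E) g 1)
  have h3 : HasMFDerivAt 𝓘(ℝ, E) 𝓘(ℝ, E) ((fun b : G => g⁻¹ * b) ∘ fun b : G => g * b) 1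
      (ContinuousLinearMap.id ℝ E) := by
    have : ((fun b : G => g⁻¹ * b) ∘ fun b : G => g * b) = id := by ext b; simp
    rw [this]
    exact hasMFDerivAt_id (1 : G)
  exact DFunLike.congr_fun (hasMFDerivAt_unique h2 h3) v

/-- Integral curves of left invariant vector fields, in terms of a chart around the identity. -/
theorem hasMFDerivAt_mulInvariantVectorField_iff {γ : ℝ → G} {t : ℝ} {x : 𝔤} :
    HasMFDerivAt 𝓘(ℝ, ℝ) 𝓘(ℝ, E) γ t ((1 : ℝ →L[ℝ] ℝ).smulRight
        (mulInvariantVectorField (I := 𝓘(ℝ, E)) (e x) (γ t))) ↔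
      ContinuousAt γ t ∧ HasDerivAt (fun s => lieChart e ((γ t)⁻¹ * γ s)) x t := by
  constructor
  · intro hγ
    refine ⟨hγ.continuousAt, ?_⟩
    have h1 := (hasMFDerivAt_mul_left (E := E) (γ t)⁻¹ (γ t)).comp t hγ
    have h2 : HasMFDerivAt 𝓘(ℝ, E) 𝓘(ℝ, 𝔤) (lieChart e) ((γ t)⁻¹ * γ t)
        ((lieEquiv e).symm : E →L[ℝ] 𝔤) := by
      rw [inv_mul_cancel]
      exact hasMFDerivAt_lieChart_one e
    have h3 : HasFDerivAt (fun s => lieChart e ((γ t)⁻¹ * γ s)) (((lieEquiv e).symm : E →L[ℝ] 𝔤) ∘L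
        (mfderiv 𝓘(ℝ, E) 𝓘(ℝ, E) (fun b : G => (γ t)⁻¹ * b) (γ t) : E →L[ℝ] E) ∘L
          ((1 : ℝ →L[ℝ] ℝ).smulRight (mulInvariantVectorField (I := 𝓘(ℝ, E)) (e x) (γ t) : E) :
            ℝ →L[ℝ] E)) t := hasMFDerivAt_iff_hasFDerivAt.1 (h2.comp t h1)
    refine h3.hasDerivAt.congr_deriv ?_
    change (lieEquiv e).symm ((mfderiv 𝓘(ℝ, E) 𝓘(ℝ, E) (fun b : G => (γ t)⁻¹ * b) (γ t) : E →L[ℝ] E)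
      ((1 : ℝ) • mulInvariantVectorField (I := 𝓘(ℝ, E)) (e x) (γ t))) = x
    rw [one_smul, mfderiv_mul_left_inv_mulInvariantVectorField]
    exact (lieEquiv e).symm_apply_apply x
  · rintro ⟨hc, hd⟩
    set u : ℝ → 𝔤 := fun s => lieChart e ((γ t)⁻¹ * γ s) with hu
    have hut : u t = 0 := by simp [hu]
    have h1 : HasMFDerivAt 𝓘(ℝ, ℝ) 𝓘(ℝ, 𝔤) u t ((1 : ℝ →L[ℝ] ℝ).smulRight x) :=
      hd.hasFDerivAt.hasMFDerivAt
    have h2 : HasMFDerivAt 𝓘(ℝ, 𝔤) 𝓘(ℝ, E) (lieChart e).symm (u t) (lieEquiv e : 𝔤 →L[ℝ] E) := by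
      rw [hut]; exact hasMFDerivAt_lieChart_symm_zero e
    let D : E →L[ℝ] E := mfderiv 𝓘(ℝ, E) 𝓘(ℝ, E) (fun b : G => γ t * b) 1
    have h3 : HasMFDerivAt 𝓘(ℝ, E) 𝓘(ℝ, E) (fun b : G => γ t * b) ((lieChart e).symm (u t)) D := by
      rw [hut, lieChart_symm_zero]; exact hasMFDerivAt_mul_left (γ t) 1
    have h4 := h3.comp t (h2.comp t h1)
    -- Continuity of γ keeps γ(t)⁻¹γ(s) in the chart domain for s near t, so γ is recovered from its
    -- chart expression.
    have hev : γ =ᶠ[𝓝 t] fun s => γ t * (lieChart e).symm (u s) := by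
      have hc' : ContinuousAt (fun s => (γ t)⁻¹ * γ s) t :=
        (contMDiff_mul_left_lieGroup (E := E) (γ t)⁻¹).continuous.continuousAt.comp hc
      filter_upwards [hc'.preimage_mem_nhds ((lieChart e).open_source.mem_nhds
        (by simpa using one_mem_lieChart_source e))] with s hs
      rw [hu, (lieChart e).left_inv hs, mul_inv_cancel_left]
    refine (h4.congr_of_eventuallyEq hev).congr_mfderiv (ContinuousLinearMap.ext_ring ?_)
    symm
    change (1 : ℝ) • D (e x) = D (lieEquiv e ((1 : ℝ) • x))
    rw [one_smul, one_smul]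
    rfl

end LieGroupCalculus

/-! ### The group law and invariant frames in the chart -/

section LieMul

variable {E : Type*} [NormedAddCommGroup E] [NormedSpace ℝ E] [CompleteSpace E]
  {G : Type*} [TopologicalSpace G] [ChartedSpace E G] [Group G] [LieGroup 𝓘(ℝ, E) ∞ G]
  {𝔤 : Type*} [NormedLieAlgebra 𝔤] [FiniteDimensional ℝ 𝔤]
  (e : 𝔤 ≃ₗ⁅ℝ⁆ GroupLieAlgebra 𝓘(ℝ, E) G)

/-- The group law in the chart around the identity. -/
def lieMul (p : 𝔤 × 𝔤) : 𝔤 := lieChart e ((lieChart e).symm p.1 * (lieChart e).symm p.2)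

/-- The open set on which the group law is defined in the chart around the identity. -/
def lieMulDomain : Set (𝔤 × 𝔤) :=
  {p | p.1 ∈ (lieChart e).target ∧ p.2 ∈ (lieChart e).target} ∩
    (fun p => (lieChart e).symm p.1 * (lieChart e).symm p.2) ⁻¹' (lieChart e).source

theorem contDiffOn_lieChart_comp {V : Type*} [NormedAddCommGroup V] [NormedSpace ℝ V] {u : V → G}
    {S : Set V} (hu : ContMDiffOn 𝓘(ℝ, V) 𝓘(ℝ, E) ∞ u S) (hS : Set.MapsTo u S (lieChart e).source) :
    ContDiffOn ℝ ∞ (fun a => lieChart e (u a)) S :=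
  contMDiffOn_iff_contDiffOn.1 ((contMDiffOn_lieChart e).comp hu hS)

theorem contMDiffOn_lieChart_symm_comp {V : Type*} [NormedAddCommGroup V] [NormedSpace ℝ V]
    {u : V → 𝔤} {S : Set V} (hu : ContDiffOn ℝ ∞ u S) (hS : Set.MapsTo u S (lieChart e).target) :
    ContMDiffOn 𝓘(ℝ, V) 𝓘(ℝ, E) ∞ (fun a => (lieChart e).symm (u a)) S :=
  (contMDiffOn_lieChart_symm e).comp hu.contMDiffOn hS

theorem contMDiffOn_mul_lieChart_symm :
    ContMDiffOn 𝓘(ℝ, 𝔤 × 𝔤) 𝓘(ℝ, E) ∞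
      (fun p : 𝔤 × 𝔤 => (lieChart e).symm p.1 * (lieChart e).symm p.2)
      {p | p.1 ∈ (lieChart e).target ∧ p.2 ∈ (lieChart e).target} :=
  (contMDiffOn_lieChart_symm_comp e contDiff_fst.contDiffOn fun _ h => h.1).mul
    (contMDiffOn_lieChart_symm_comp e contDiff_snd.contDiffOn fun _ h => h.2)

theorem isOpen_lieMulDomain : IsOpen (lieMulDomain e) :=
  (contMDiffOn_mul_lieChart_symm e).continuousOn.isOpen_inter_preimage
    (((lieChart e).open_target.preimage continuous_fst).inter
      ((lieChart e).open_target.preimage continuous_snd)) (lieChart e).open_source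

theorem contDiffOn_lieMul : ContDiffOn ℝ ∞ (lieMul e) (lieMulDomain e) :=
  contDiffOn_lieChart_comp e ((contMDiffOn_mul_lieChart_symm e).mono Set.inter_subset_left)
    fun _ h => h.2

variable {e}

theorem left_mem_lieMulDomain {a : 𝔤} (ha : a ∈ (lieChart e).target) : (a, 0) ∈ lieMulDomain e :=
  ⟨⟨ha, zero_mem_lieChart_target e⟩, by simpa using (lieChart e).map_target ha⟩

theorem right_mem_lieMulDomain {a : 𝔤} (ha : a ∈ (lieChart e).target) : (0, a) ∈ lieMulDomain e :=
  ⟨⟨zero_mem_lieChart_target e, ha⟩, by simpa using (lieChart e).map_target ha⟩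

theorem lieMul_zero_right {a : 𝔤} (ha : a ∈ (lieChart e).target) : lieMul e (a, 0) = a := by
  simp [lieMul, (lieChart e).right_inv ha]

theorem lieMul_zero_left {a : 𝔤} (ha : a ∈ (lieChart e).target) : lieMul e (0, a) = a := by
  simp [lieMul, (lieChart e).right_inv ha]

theorem hasFDerivAt_lieMul {p : 𝔤 × 𝔤} (hp : p ∈ lieMulDomain e) :
    HasFDerivAt (lieMul e) (fderiv ℝ (lieMul e) p) p :=
  (((contDiffOn_lieMul e).contDiffAt ((isOpen_lieMulDomain e).mem_nhds hp)).differentiableAt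
    (by simp)).hasFDerivAt

theorem fderiv_lieMul_left {a : 𝔤} (ha : a ∈ (lieChart e).target) (v : 𝔤) :
    fderiv ℝ (lieMul e) (a, 0) (v, 0) = v := by
  have h1 := (hasFDerivAt_lieMul (left_mem_lieMulDomain ha)).comp a
    (hasFDerivAt_prodMk_left (𝕜 := ℝ) a (0 : 𝔤))
  have h2 : HasFDerivAt (lieMul e ∘ fun b => (b, (0 : 𝔤))) (ContinuousLinearMap.id ℝ 𝔤) a :=
    (hasFDerivAt_id a).congr_of_eventuallyEq (by
      filter_upwards [(lieChart e).open_target.mem_nhds ha] with b hb using lieMul_zero_right hb)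
  exact DFunLike.congr_fun (h1.unique h2) v

theorem fderiv_lieMul_right {a : 𝔤} (ha : a ∈ (lieChart e).target) (v : 𝔤) :
    fderiv ℝ (lieMul e) (0, a) (0, v) = v := by
  have h1 := (hasFDerivAt_lieMul (right_mem_lieMulDomain ha)).comp a
    (hasFDerivAt_prodMk_right (𝕜 := ℝ) (0 : 𝔤) a)
  have h2 : HasFDerivAt (lieMul e ∘ fun b => ((0 : 𝔤), b)) (ContinuousLinearMap.id ℝ 𝔤) a :=
    (hasFDerivAt_id a).congr_of_eventuallyEq (by
      filter_upwards [(lieChart e).open_target.mem_nhds ha] with b hb using lieMul_zero_left hb)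
  exact DFunLike.congr_fun (h1.unique h2) v

variable (e)

/-- Left invariant vector fields in the chart around the identity. -/
def leftField (a : 𝔤) : Endo 𝔤 := fderiv ℝ (lieMul e) (a, 0) ∘L ContinuousLinearMap.inr ℝ 𝔤 𝔤

/-- Right invariant vector fields in the chart around the identity. -/
def rightField (a : 𝔤) : Endo 𝔤 := fderiv ℝ (lieMul e) (0, a) ∘L ContinuousLinearMap.inl ℝ 𝔤 𝔤

theorem leftField_zero : leftField e 0 = 1 :=
  ContinuousLinearMap.ext fun v => fderiv_lieMul_right (zero_mem_lieChart_target e) v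

theorem rightField_zero : rightField e 0 = 1 :=
  ContinuousLinearMap.ext fun v => fderiv_lieMul_left (zero_mem_lieChart_target e) v

theorem contDiffOn_fderiv_lieMul : ContDiffOn ℝ ∞ (fderiv ℝ (lieMul e)) (lieMulDomain e) :=
  (contDiffOn_lieMul e).fderiv_of_isOpen (isOpen_lieMulDomain e) (by simp)

theorem contDiffOn_leftField : ContDiffOn ℝ ∞ (leftField e) (lieChart e).target :=
  ((contDiffOn_fderiv_lieMul e).comp (contDiff_prodMk_left (0 : 𝔤)).contDiffOn
    fun _ ha => left_mem_lieMulDomain ha).clm_comp contDiffOn_const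

theorem contDiffOn_rightField : ContDiffOn ℝ ∞ (rightField e) (lieChart e).target :=
  ((contDiffOn_fderiv_lieMul e).comp (contDiff_prodMk_right (0 : 𝔤)).contDiffOn
    fun _ ha => right_mem_lieMulDomain ha).clm_comp contDiffOn_const

theorem hasFDerivAt_fderiv_lieMul_zero :
    HasFDerivAt (fderiv ℝ (lieMul e)) (fderiv ℝ (fderiv ℝ (lieMul e)) 0) ((0 : 𝔤), (0 : 𝔤)) :=
  (((contDiffOn_fderiv_lieMul e).contDiffAt ((isOpen_lieMulDomain e).mem_nhds
    (left_mem_lieMulDomain (zero_mem_lieChart_target e)))).differentiableAt (by simp)).hasFDerivAt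

theorem fderiv_leftField_zero (k w : 𝔤) :
    fderiv ℝ (leftField e) 0 k w = fderiv ℝ (fderiv ℝ (lieMul e)) 0 (k, 0) (0, w) := by
  have h1 := HasFDerivAt.comp (f := fun b : 𝔤 => (b, (0 : 𝔤))) (0 : 𝔤)
    (hasFDerivAt_fderiv_lieMul_zero e) (hasFDerivAt_prodMk_left (𝕜 := ℝ) (0 : 𝔤) (0 : 𝔤))
  have h2 : HasFDerivAt (leftField e) _ 0 :=
    h1.clm_comp (hasFDerivAt_const (ContinuousLinearMap.inr ℝ 𝔤 𝔤) (0 : 𝔤))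
  rw [h2.fderiv]
  simp

theorem fderiv_rightField_zero (k w : 𝔤) :
    fderiv ℝ (rightField e) 0 k w = fderiv ℝ (fderiv ℝ (lieMul e)) 0 (0, k) (w, 0) := by
  have h1 := HasFDerivAt.comp (f := fun b : 𝔤 => ((0 : 𝔤), b)) (0 : 𝔤)
    (hasFDerivAt_fderiv_lieMul_zero e) (hasFDerivAt_prodMk_right (𝕜 := ℝ) (0 : 𝔤) (0 : 𝔤))
  have h2 : HasFDerivAt (rightField e) _ 0 :=
    h1.clm_comp (hasFDerivAt_const (ContinuousLinearMap.inl ℝ 𝔤 𝔤) (0 : 𝔤))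
  rw [h2.fderiv]
  simp

/-- Both sides are the mixed second derivative of the group law at the origin, which is symmetric.
-/
theorem fderiv_rightField_zero_eq (k w : 𝔤) :
    fderiv ℝ (rightField e) 0 k w = fderiv ℝ (leftField e) 0 w k := by
  rw [fderiv_leftField_zero, fderiv_rightField_zero]
  have h2 : minSmoothness ℝ 2 ≤ (∞ : WithTop ℕ∞) := by
    simp only [minSmoothness_of_isRCLikeNormedField]; exact ENat.LEInfty.out
  exact (((contDiffOn_lieMul e).contDiffAt ((isOpen_lieMulDomain e).mem_nhds
    (left_mem_lieMulDomain (zero_mem_lieChart_target e)))).isSymmSndFDerivAt h2).eq _ _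

end LieMul

/-! ### The bracket in terms of the left invariant frame -/

section LieBracket

variable {E : Type*} [NormedAddCommGroup E] [NormedSpace ℝ E] [CompleteSpace E]
  {G : Type*} [TopologicalSpace G] [ChartedSpace E G] [Group G] [LieGroup 𝓘(ℝ, E) ∞ G]
  {𝔤 : Type*} [NormedLieAlgebra 𝔤] [FiniteDimensional ℝ 𝔤]
  (e : 𝔤 ≃ₗ⁅ℝ⁆ GroupLieAlgebra 𝓘(ℝ, E) G)

theorem mDifferentiable_lieChart_symm :
    (lieChart e).symm.MDifferentiable 𝓘(ℝ, 𝔤) 𝓘(ℝ, E) :=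
  ⟨(contMDiffOn_lieChart_symm e).mdifferentiableOn (by simp),
    (contMDiffOn_lieChart e).mdifferentiableOn (by simp)⟩

variable {e}

theorem hasFDerivAt_lieMul_leftField {a : 𝔤} (ha : a ∈ (lieChart e).target) :
    HasFDerivAt (fun b => lieMul e (a, b)) (leftField e a) 0 :=
  HasFDerivAt.comp (f := fun b : 𝔤 => (a, b)) (0 : 𝔤)
    (hasFDerivAt_lieMul (left_mem_lieMulDomain ha)) (hasFDerivAt_prodMk_right (𝕜 := ℝ) a (0 : 𝔤))

theorem lieChart_symm_lieMul {p : 𝔤 × 𝔤} (hp : p ∈ lieMulDomain e) :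
    (lieChart e).symm (lieMul e p) = (lieChart e).symm p.1 * (lieChart e).symm p.2 :=
  (lieChart e).left_inv hp.2

/-- Differentiate at b = 0 the identity expressing that the inverse chart turns the local group law
a · b into multiplication in the group. -/
theorem mfderiv_lieChart_symm_leftField {a : 𝔤} (ha : a ∈ (lieChart e).target) (w : 𝔤) :
    (mfderiv 𝓘(ℝ, 𝔤) 𝓘(ℝ, E) (lieChart e).symm a : 𝔤 →L[ℝ] E) (leftField e a w) =
      mulInvariantVectorField (I := 𝓘(ℝ, E)) (e w) ((lieChart e).symm a) := by
  let D : 𝔤 →L[ℝ] E := mfderiv 𝓘(ℝ, 𝔤) 𝓘(ℝ, E) (lieChart e).symm a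
  have h1 : HasMFDerivAt 𝓘(ℝ, 𝔤) 𝓘(ℝ, E) (lieChart e).symm (lieMul e (a, 0)) D := by
    rw [lieMul_zero_right ha]
    exact ((mDifferentiable_lieChart_symm e).mdifferentiableAt ha).hasMFDerivAt
  have h2 := h1.comp (0 : 𝔤) (hasFDerivAt_lieMul_leftField ha).hasMFDerivAt
  let L : E →L[ℝ] E := mfderiv 𝓘(ℝ, E) 𝓘(ℝ, E) (fun b : G => (lieChart e).symm a * b) 1
  have h3 : HasMFDerivAt 𝓘(ℝ, E) 𝓘(ℝ, E) (fun b : G => (lieChart e).symm a * b)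
      ((lieChart e).symm 0) L := by
    rw [lieChart_symm_zero]; exact hasMFDerivAt_mul_left _ 1
  have h4 := h3.comp (0 : 𝔤) (hasMFDerivAt_lieChart_symm_zero e)
  have h5 : ((lieChart e).symm ∘ fun b => lieMul e (a, b)) =ᶠ[𝓝 0]
      (fun b : G => (lieChart e).symm a * b) ∘ (lieChart e).symm := by
    have : ContinuousAt (fun b : 𝔤 => (a, b)) 0 := by fun_prop
    filter_upwards [this.preimage_mem_nhds
      ((isOpen_lieMulDomain e).mem_nhds (left_mem_lieMulDomain ha))] with b hb
    exact lieChart_symm_lieMul hb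
  exact DFunLike.congr_fun (hasMFDerivAt_unique h2 (h4.congr_of_eventuallyEq h5)) w

theorem mpullback_mulInvariantVectorField_lieChart_symm {a : 𝔤} (ha : a ∈ (lieChart e).target)
    (w : 𝔤) :
    VectorField.mpullback 𝓘(ℝ, 𝔤) 𝓘(ℝ, E) (lieChart e).symm
      (mulInvariantVectorField (I := 𝓘(ℝ, E)) (e w)) a = leftField e a w := by
  have h := mfderiv_lieChart_symm_leftField ha w
  let Φ : 𝔤 ≃L[ℝ] E := (mDifferentiable_lieChart_symm e).mfderiv ha
  change (ContinuousLinearMap.inverse (Φ : 𝔤 →L[ℝ] E))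
    (mulInvariantVectorField (I := 𝓘(ℝ, E)) (e w) ((lieChart e).symm a)) = leftField e a w
  rw [← h, ContinuousLinearMap.inverse_equiv]
  exact Φ.symm_apply_apply _

/-- Pulled back to the chart, the invariant fields are L(·)x and L(·)y; their bracket is the one of
vector fields on a vector space, evaluated at 0, where L is the identity. -/
theorem lie_eq_fderiv_leftField (x y : 𝔤) :
    ⁅x, y⁆ = fderiv ℝ (leftField e) 0 x y - fderiv ℝ (leftField e) 0 y x := by
  have hd : DifferentiableAt ℝ (leftField e) 0 :=
    ((contDiffOn_leftField e).contDiffAt ((lieChart e).open_target.mem_nhds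
      (zero_mem_lieChart_target e))).differentiableAt (by simp)
  have hn : minSmoothness ℝ 2 ≤ (∞ : WithTop ℕ∞) := by
    simp only [minSmoothness_of_isRCLikeNormedField]; exact ENat.LEInfty.out
  have h1 := VectorField.mpullback_mlieBracket (I := 𝓘(ℝ, 𝔤)) (I' := 𝓘(ℝ, E)) (n := ∞)
    (f := (lieChart e).symm) (x₀ := (0 : 𝔤))
    (mdifferentiableAt_mulInvariantVectorField (I := 𝓘(ℝ, E)) (e x))
    (mdifferentiableAt_mulInvariantVectorField (I := 𝓘(ℝ, E)) (e y))
    ((contMDiffOn_lieChart_symm e).contMDiffAt ((lieChart e).open_target.mem_nhds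
      (zero_mem_lieChart_target e))) hn
  have hev (w : 𝔤) : VectorField.mpullback 𝓘(ℝ, 𝔤) 𝓘(ℝ, E) (lieChart e).symm
      (mulInvariantVectorField (I := 𝓘(ℝ, E)) (e w)) =ᶠ[𝓝 0] fun a => leftField e a w := by
    filter_upwards [(lieChart e).open_target.mem_nhds (zero_mem_lieChart_target e)] with a ha
    exact mpullback_mulInvariantVectorField_lieChart_symm ha w
  have h2 : VectorField.mpullback 𝓘(ℝ, 𝔤) 𝓘(ℝ, E) (lieChart e).symm
      (VectorField.mlieBracket 𝓘(ℝ, E) (mulInvariantVectorField (I := 𝓘(ℝ, E)) (e x))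
        (mulInvariantVectorField (I := 𝓘(ℝ, E)) (e y))) 0 =
      fderiv ℝ (leftField e) 0 x y - fderiv ℝ (leftField e) 0 y x := by
    rw [h1, ← VectorField.mlieBracketWithin_univ, VectorField.mlieBracketWithin_eq_lieBracketWithin]
    refine Eq.trans (Filter.EventuallyEq.lieBracketWithin_vectorField_eq_nhds (𝕜 := ℝ)
      (E := 𝔤) (V := fun a => leftField e a x) (W := fun a => leftField e a y)
      (hev x) (hev y)) ?_
    have hf (w : 𝔤) : HasFDerivAt (fun a => leftField e a w)
        ((ContinuousLinearMap.apply ℝ 𝔤 w) ∘L fderiv ℝ (leftField e) 0) 0 :=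
      (ContinuousLinearMap.apply ℝ 𝔤 w).hasFDerivAt.comp (0 : 𝔤) hd.hasFDerivAt
    rw [VectorField.lieBracketWithin_univ, VectorField.lieBracket, (hf x).fderiv, (hf y).fderiv, leftField_zero]
    rfl
  have h3 : (VectorField.mlieBracket 𝓘(ℝ, E) (mulInvariantVectorField (I := 𝓘(ℝ, E)) (e x))
        (mulInvariantVectorField (I := 𝓘(ℝ, E)) (e y)) ((lieChart e).symm 0) : E) =
      lieEquiv e ⁅x, y⁆ := by
    rw [lieEquiv_apply, LieEquiv.map_lie, GroupLieAlgebra.bracket_def]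
    exact congrArg (fun g => (VectorField.mlieBracket 𝓘(ℝ, E)
      (mulInvariantVectorField (I := 𝓘(ℝ, E)) (e x))
        (mulInvariantVectorField (I := 𝓘(ℝ, E)) (e y)) g : E)) (lieChart_symm_zero e)
  rw [← h2]
  change ⁅x, y⁆ = ContinuousLinearMap.inverse
    (mfderiv 𝓘(ℝ, 𝔤) 𝓘(ℝ, E) (lieChart e).symm 0 : 𝔤 →L[ℝ] E)
      (VectorField.mlieBracket 𝓘(ℝ, E) (mulInvariantVectorField (I := 𝓘(ℝ, E)) (e x))
        (mulInvariantVectorField (I := 𝓘(ℝ, E)) (e y)) ((lieChart e).symm 0) : E)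
  have h4 : (mfderiv 𝓘(ℝ, 𝔤) 𝓘(ℝ, E) (lieChart e).symm 0 : 𝔤 →L[ℝ] E) =
    (lieEquiv e : 𝔤 →L[ℝ] E) := (hasMFDerivAt_lieChart_symm_zero e).mfderiv
  refine Eq.trans ?_ (congrArg₂ (fun (A : 𝔤 →L[ℝ] E) (v : E) => A.inverse v) h4.symm h3.symm)
  rw [ContinuousLinearMap.inverse_equiv]
  exact ((lieEquiv e).symm_apply_apply _).symm

end LieBracket

/-! ### One-parameter subgroups and their perturbation -/

section LieExp

variable {E : Type*} [NormedAddCommGroup E] [NormedSpace ℝ E] [CompleteSpace E]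
  {G : Type*} [TopologicalSpace G] [ChartedSpace E G] [Group G] [LieGroup 𝓘(ℝ, E) ∞ G]
  {𝔤 : Type*} [NormedLieAlgebra 𝔤] [FiniteDimensional ℝ 𝔤]
  (e : 𝔤 ≃ₗ⁅ℝ⁆ GroupLieAlgebra 𝓘(ℝ, E) G)

theorem eventually_eq_mul_lieChart_symm {γ : ℝ → G} {t : ℝ} (hγ : ContinuousAt γ t) :
    ∀ᶠ s in 𝓝 t, γ s = γ t * (lieChart e).symm (lieChart e ((γ t)⁻¹ * γ s)) := by
  have hc : ContinuousAt (fun s => (γ t)⁻¹ * γ s) t :=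
    (contMDiff_mul_left_lieGroup (E := E) (γ t)⁻¹).continuous.continuousAt.comp hγ
  filter_upwards [hc.preimage_mem_nhds ((lieChart e).open_source.mem_nhds
    (by simpa using one_mem_lieChart_source e))] with s hs
  rw [(lieChart e).left_inv hs, mul_inv_cancel_left]

/-- The differential of the left translation by the inverse of an element, in the chart. -/
theorem hasFDerivAt_lieChart_inv_mul {c : 𝔤} (hc : c ∈ (lieChart e).target) :
    ∃ N : 𝔤 →L[ℝ] 𝔤, HasFDerivAt
      (fun b => lieChart e (((lieChart e).symm c)⁻¹ * (lieChart e).symm b)) N c ∧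
      ∀ v, N (leftField e c v) = v := by
  set S := (lieChart e).target ∩
    (fun b => ((lieChart e).symm c)⁻¹ * (lieChart e).symm b) ⁻¹' (lieChart e).source with hS
  have h1 : ContMDiffOn 𝓘(ℝ, 𝔤) 𝓘(ℝ, E) ∞
      (fun b => ((lieChart e).symm c)⁻¹ * (lieChart e).symm b) (lieChart e).target :=
    (contMDiff_mul_left_lieGroup (E := E) _).comp_contMDiffOn (contMDiffOn_lieChart_symm e)
  have hSo : IsOpen S :=
    h1.continuousOn.isOpen_inter_preimage (lieChart e).open_target (lieChart e).open_source
  have hcS : c ∈ S := ⟨hc, by simpa using one_mem_lieChart_source e⟩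
  have h2 := contDiffOn_lieChart_comp e (h1.mono (Set.inter_subset_left : S ⊆ _)) fun _ h => h.2
  have h3 := ((h2.contDiffAt (hSo.mem_nhds hcS)).differentiableAt (by simp)).hasFDerivAt
  refine ⟨_, h3, fun v => ?_⟩
  have h4 : HasFDerivAt (fun b => lieChart e (((lieChart e).symm c)⁻¹ * (lieChart e).symm b))
      (fderiv ℝ (fun b => lieChart e (((lieChart e).symm c)⁻¹ * (lieChart e).symm b)) c)
      (lieMul e (c, 0)) := by rw [lieMul_zero_right hc]; exact h3
  have h5 := h4.comp (0 : 𝔤) (hasFDerivAt_lieMul_leftField hc)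
  have h6 : ((fun b => lieChart e (((lieChart e).symm c)⁻¹ * (lieChart e).symm b)) ∘
      fun b => lieMul e (c, b)) =ᶠ[𝓝 0] id := by
    have : ContinuousAt (fun b : 𝔤 => (c, b)) 0 := by fun_prop
    filter_upwards [this.preimage_mem_nhds
      ((isOpen_lieMulDomain e).mem_nhds (left_mem_lieMulDomain hc))] with b hb
    simp only [Function.comp_apply, lieChart_symm_lieMul hb, inv_mul_cancel_left, id]
    exact (lieChart e).right_inv hb.1.2
  exact DFunLike.congr_fun (h5.unique ((hasFDerivAt_id (𝕜 := ℝ) (0 : 𝔤)).congr_of_eventuallyEq h6)) v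

/-- Perturbing an integral curve of a left invariant vector field into one of another such field,
by means of the solution of an equation in the chart. -/
theorem hasMFDerivAt_mul_lieChart_symm {γ : ℝ → G} {h : ℝ → 𝔤} {t : ℝ} {x w : 𝔤}
    (hγ : HasMFDerivAt 𝓘(ℝ, ℝ) 𝓘(ℝ, E) γ t ((1 : ℝ →L[ℝ] ℝ).smulRight
      (mulInvariantVectorField (I := 𝓘(ℝ, E)) (e x) (γ t))))
    (hh : HasDerivAt h (leftField e (h t) (x + w) - rightField e (h t) x) t)
    (ht : h t ∈ (lieChart e).target) :
    HasMFDerivAt 𝓘(ℝ, ℝ) 𝓘(ℝ, E) (fun s => γ s * (lieChart e).symm (h s)) t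
      ((1 : ℝ →L[ℝ] ℝ).smulRight (mulInvariantVectorField (I := 𝓘(ℝ, E)) (e (x + w))
        (γ t * (lieChart e).symm (h t)))) := by
  have := topologicalGroup_of_lieGroup 𝓘(ℝ, E) ∞ (G := G)
  obtain ⟨hc, hd⟩ := (hasMFDerivAt_mulInvariantVectorField_iff e).1 hγ
  set a : ℝ → 𝔤 := fun s => lieChart e ((γ t)⁻¹ * γ s) with ha
  have hat : a t = 0 := by simp [ha]
  have hcs : ContinuousAt (fun s => (lieChart e).symm (h s)) t :=
    ((lieChart e).symm.continuousAt ht).comp hh.continuousAt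
  refine (hasMFDerivAt_mulInvariantVectorField_iff e
    (γ := fun s => γ s * (lieChart e).symm (h s))).2 ⟨hc.mul hcs, ?_⟩
  have hmem : (a t, h t) ∈ lieMulDomain e := by rw [hat]; exact right_mem_lieMulDomain ht
  -- The motion of γ contributes R(h)x and the motion of h contributes L(h)(x + w) - R(h)x; the
  -- right invariant terms cancel.
  have hb : HasDerivAt (fun s => lieMul e (a s, h s)) (leftField e (h t) (x + w)) t := by
    have h1 := (hasFDerivAt_lieMul hmem).comp_hasDerivAt t (hd.prodMk hh)
    refine h1.congr_deriv ?_
    have h2 : ((x, leftField e (h t) (x + w) - rightField e (h t) x) : 𝔤 × 𝔤) =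
        (x, 0) + (0, leftField e (h t) (x + w) - rightField e (h t) x) := by simp
    rw [h2, map_add, hat, fderiv_lieMul_right ht]
    change rightField e (h t) x + _ = _
    abel
  obtain ⟨N, hN, hNv⟩ := hasFDerivAt_lieChart_inv_mul e ht
  have h3 : lieMul e (a t, h t) = h t := by rw [hat, lieMul_zero_left ht]
  have h4 := HasFDerivAt.comp_hasDerivAt (x := t) (by rw [h3]; exact hN) hb
  rw [hNv] at h4
  refine h4.congr_of_eventuallyEq ?_
  have hcm : ContinuousAt (fun s => (a s, h s)) t := hd.continuousAt.prodMk hh.continuousAt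
  filter_upwards [eventually_eq_mul_lieChart_symm e hc,
    hcm.preimage_mem_nhds ((isOpen_lieMulDomain e).mem_nhds hmem)] with s hs hs2
  simp only [Function.comp_apply, lieChart_symm_lieMul hs2]
  congr 1
  change γ s = γ t * (lieChart e).symm (a s) at hs
  rw [hs]
  group

omit [CompleteSpace E] in
theorem contMDiff_mulInvariantVectorField_one (v : GroupLieAlgebra 𝓘(ℝ, E) G) :
    ContMDiff 𝓘(ℝ, E) 𝓘(ℝ, E).tangent 1
      (fun g : G => (mulInvariantVectorField (I := 𝓘(ℝ, E)) v g : TangentBundle 𝓘(ℝ, E) G)) :=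
  (contMDiff_mulInvariantVectorField v).of_le (by
    simp only [minSmoothness_of_isRCLikeNormedField]; exact one_le_two)

variable [T2Space G]

/-- Left translates of one local integral curve give the same existence time ε at every point, so
integral curves extend to all times. -/
theorem exists_isMIntegralCurve_mulInvariantVectorField (x : 𝔤) :
    ∃ γ : ℝ → G, γ 0 = 1 ∧
      IsMIntegralCurve (I := 𝓘(ℝ, E)) γ (mulInvariantVectorField (I := 𝓘(ℝ, E)) (e x)) := by
  have hv := contMDiff_mulInvariantVectorField_one (E := E) (e x)
  obtain ⟨γ, h0, hγ⟩ := exists_isMIntegralCurveAt_of_contMDiffAt_boundaryless (t₀ := 0)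
    (hv.contMDiffAt (x := (1 : G)))
  obtain ⟨ε, hε, hγ⟩ := isMIntegralCurveAt_iff'.1 hγ
  refine exists_isMIntegralCurve_of_isMIntegralCurveOn hv hε (fun g => ⟨fun s => g * γ s, by
    simp [h0], fun t ht => ?_⟩) 1
  have h1 : HasMFDerivAt 𝓘(ℝ, ℝ) 𝓘(ℝ, E) γ t _ :=
    (hγ t (by simpa [Real.ball_eq_Ioo] using ht)).hasMFDerivAt
      (Metric.isOpen_ball.mem_nhds (by simpa [Real.ball_eq_Ioo] using ht))
  obtain ⟨hc, hd⟩ := (hasMFDerivAt_mulInvariantVectorField_iff e).1 h1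
  refine ((hasMFDerivAt_mulInvariantVectorField_iff e (γ := fun s => g * γ s)).2
    ⟨(contMDiff_mul_left_lieGroup (E := E) g).continuous.continuousAt.comp hc,
      ?_⟩).hasMFDerivWithinAt
  simpa [mul_assoc] using hd

/-- Uniqueness of integral curves on an interval containing 0 and 1. Curves defined only there
suffice, as is the case for the perturbed ones. -/
theorem lieExp_eq_of_hasMFDerivAt {γ : ℝ → G} {x : 𝔤} (h0 : γ 0 = 1)
    (hγ : ∀ t ∈ Set.Ioo (-1 : ℝ) 2, HasMFDerivAt 𝓘(ℝ, ℝ) 𝓘(ℝ, E) γ t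
      ((1 : ℝ →L[ℝ] ℝ).smulRight (mulInvariantVectorField (I := 𝓘(ℝ, E)) (e x) (γ t)))) :
    lieExp (e x) = γ 1 := by
  have hex := exists_isMIntegralCurve_mulInvariantVectorField e x
  rw [lieExp, dif_pos hex]
  exact isMIntegralCurveOn_Ioo_eqOn_of_contMDiff_boundaryless (t₀ := 0) (a := -1) (b := 2)
    (by norm_num) (contMDiff_mulInvariantVectorField_one (e x))
    (hex.choose_spec.2.isMIntegralCurveOn _) (fun t ht => (hγ t ht).hasMFDerivWithinAt)
    (hex.choose_spec.1.trans h0.symm) (by norm_num)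

end LieExp

/-! ### The derivative of the exponential map -/

section LieExpDeriv

variable {E : Type*} [NormedAddCommGroup E] [NormedSpace ℝ E] [CompleteSpace E]
  {G : Type*} [TopologicalSpace G] [ChartedSpace E G] [Group G] [LieGroup 𝓘(ℝ, E) ∞ G]
  {𝔤 : Type*} [NormedLieAlgebra 𝔤] [FiniteDimensional ℝ 𝔤]
  (e : 𝔤 ≃ₗ⁅ℝ⁆ GroupLieAlgebra 𝓘(ℝ, E) G)

/-- The equation satisfied by the quotient of integral curves of two left invariant fields. -/
def quotientField (x : 𝔤) (p : 𝔤 × 𝔤) : 𝔤 := leftField e p.1 (x + p.2) - rightField e p.1 x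

theorem quotientField_zero (x : 𝔤) : quotientField e x 0 = 0 := by
  simp [quotientField, leftField_zero, rightField_zero]

/-- In the direction (k, w) the derivative is DL(k)x + L(0)w - DR(k)x. Here L(0) = 1 and DR(k)x =
DL(x)k, so the terms in k form the bracket [k, x] = [-x, k]. -/
theorem hasStrictFDerivAt_quotientField (x : 𝔤) :
    HasStrictFDerivAt (quotientField e x) (bracketL 𝔤 (-x) ∘L ContinuousLinearMap.fst ℝ 𝔤 𝔤 +
      ContinuousLinearMap.snd ℝ 𝔤 𝔤) 0 := by
  have ht : (lieChart e).target ∈ 𝓝 ((0 : 𝔤 × 𝔤).1) :=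
    (lieChart e).open_target.mem_nhds (zero_mem_lieChart_target e)
  have hL : HasStrictFDerivAt (fun p : 𝔤 × 𝔤 => leftField e p.1)
      (fderiv ℝ (leftField e) 0 ∘L ContinuousLinearMap.fst ℝ 𝔤 𝔤) 0 :=
    HasStrictFDerivAt.comp (0 : 𝔤 × 𝔤) (((contDiffOn_leftField e).contDiffAt ht).hasStrictFDerivAt
      (by simp)) hasStrictFDerivAt_fst
  have hR : HasStrictFDerivAt (fun p : 𝔤 × 𝔤 => rightField e p.1)
      (fderiv ℝ (rightField e) 0 ∘L ContinuousLinearMap.fst ℝ 𝔤 𝔤) 0 :=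
    HasStrictFDerivAt.comp (0 : 𝔤 × 𝔤) (((contDiffOn_rightField e).contDiffAt ht).hasStrictFDerivAt
      (by simp)) hasStrictFDerivAt_fst
  have h := (hL.clm_apply (hasStrictFDerivAt_snd.const_add x)).sub
    (hR.clm_apply (hasStrictFDerivAt_const x (0 : 𝔤 × 𝔤)))
  refine h.congr_fderiv (ContinuousLinearMap.ext fun p => ?_)
  have h1 := lie_eq_fderiv_leftField (e := e) p.1 x
  simp [leftField_zero, fderiv_rightField_zero_eq, bracketL_apply]
  rw [h1]
  abel

variable [T2Space G]

/-- With γ the one-parameter subgroup of x and h the small solution for w, the curve γ h is that of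
x + w; so k(w) is h at time 1, and its first order expansion is the derivative claimed. -/
theorem exists_lieExp_add (x : 𝔤) : ∃ k : 𝔤 → 𝔤, k 0 = 0 ∧ HasFDerivAt k (adXi 1 (-x)) 0 ∧
    ∀ᶠ w in 𝓝 0, lieExp (e (x + w)) = lieExp (e x) * (lieChart e).symm (k w) := by
  obtain ⟨γ, hγ0, hγ⟩ := exists_isMIntegralCurve_mulInvariantVectorField e x
  have h0 := quotientField_zero e x
  have hf := hasStrictFDerivAt_quotientField e x
  obtain ⟨C, hC, hex⟩ := exists_hasDerivAt_of_hasStrictFDerivAt h0 hf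
  obtain ⟨H, hH⟩ := hex.choice
  have hk0 : H 0 1 = 0 := by
    have := (hH.self_of_nhds.2 1 (by norm_num)).2
    simpa using this
  refine ⟨fun w => H w 1, hk0, ?_, ?_⟩
  · rw [hasFDerivAt_iff_isLittleO_nhds_zero, Asymptotics.isLittleO_iff]
    intro ε hε
    filter_upwards [hH, eventually_norm_sub_integral_exp_le h0 hf hC hε] with w hw hw2
    have := hw2 (H w) hw.1 hw.2
    simp only [zero_add, hk0, sub_zero]
    exact this
  · obtain ⟨δ, hδ, hball⟩ := Metric.mem_nhds_iff.1
      ((lieChart e).open_target.mem_nhds (zero_mem_lieChart_target e))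
    have hev : ∀ᶠ w in 𝓝 (0 : 𝔤), C * ‖w‖ < δ :=
      (Continuous.tendsto' (by fun_prop) (0 : 𝔤) 0 (by simp)).eventually_lt_const hδ
    filter_upwards [hH, hev] with w hw hwδ
    have h1 : lieExp (e x) = γ 1 := lieExp_eq_of_hasMFDerivAt e hγ0 fun t _ => hγ t
    have h2 : lieExp (e (x + w)) = γ 1 * (lieChart e).symm (H w 1) :=
      lieExp_eq_of_hasMFDerivAt e (γ := fun s => γ s * (lieChart e).symm (H w s))
        (by simp [hw.1, hγ0]) fun t ht => hasMFDerivAt_mul_lieChart_symm e (hγ t) (hw.2 t ht).1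
          (hball (by simpa using (hw.2 t ht).2.trans_lt hwδ))
    rw [h1, h2]

theorem continuous_lieExp : Continuous fun x : 𝔤 => lieExp (e x) := by
  have := topologicalGroup_of_lieGroup 𝓘(ℝ, E) ∞ (G := G)
  refine continuous_iff_continuousAt.2 fun x => ?_
  obtain ⟨k, hk0, hk, hev⟩ := exists_lieExp_add e x
  have h1 : ContinuousAt (fun w => lieExp (e x) * (lieChart e).symm (k w)) 0 := by
    refine continuousAt_const.mul (ContinuousAt.comp ?_ hk.continuousAt)
    rw [hk0]
    exact (lieChart e).symm.continuousAt (zero_mem_lieChart_target e)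
  have h2 : ContinuousAt (fun w => lieExp (e (x + w))) 0 := h1.congr (hev.mono fun _ h => h.symm)
  have h3 : ContinuousAt (fun y => y - x) x := by fun_prop
  have h4 := ContinuousAt.comp (g := fun w => lieExp (e (x + w))) (x := x) (by simpa using h2) h3
  simpa [Function.comp_def] using h4

/-- The exponential map in a translated chart. -/
def lieExpChart (g : G) (y : 𝔤) : 𝔤 := lieChart e (g⁻¹ * lieExp (e y))

/-- The domain of the exponential map in a translated chart. -/
def lieExpDomain (g : G) : Set 𝔤 := {y | g⁻¹ * lieExp (e y) ∈ (lieChart e).source}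

theorem isOpen_lieExpDomain (g : G) : IsOpen (lieExpDomain e g) :=
  (lieChart e).open_source.preimage
    ((contMDiff_mul_left_lieGroup (E := E) g⁻¹).continuous.comp (continuous_lieExp e))

variable {e}

/-- Near y the exponential in the translated chart is b ↦ a · b after k, where a is its value at y;
the derivative of this translation at 0 is L(a). -/
theorem hasFDerivAt_lieExpChart {g : G} {y : 𝔤} (hy : y ∈ lieExpDomain e g) :
    HasFDerivAt (lieExpChart e g) (leftField e (lieExpChart e g y) ∘L adXi 1 (-y)) y := by
  obtain ⟨k, hk0, hk, hev⟩ := exists_lieExp_add e y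
  have ha : lieExpChart e g y ∈ (lieChart e).target := (lieChart e).map_source hy
  have h1 := HasFDerivAt.comp (0 : 𝔤) (by rw [hk0]; exact hasFDerivAt_lieMul_leftField ha) hk
  have hc : ContinuousAt (fun w => (lieExpChart e g y, k w)) 0 :=
    continuousAt_const.prodMk hk.continuousAt
  have h2 : (fun w => lieExpChart e g (y + w)) =ᶠ[𝓝 0]
      (fun b => lieMul e (lieExpChart e g y, b)) ∘ k := by
    filter_upwards [hev, hc.preimage_mem_nhds ((isOpen_lieMulDomain e).mem_nhds
      (by rw [hk0]; exact left_mem_lieMulDomain ha))] with w hw hw2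
    simp only [Function.comp_apply, lieMul, lieExpChart, hw]
    rw [(lieChart e).left_inv hy, mul_assoc]
  have h3 := h1.congr_of_eventuallyEq h2
  have h4 := HasFDerivAt.comp (f := fun z : 𝔤 => z - y) (g := fun w => lieExpChart e g (y + w)) y
    (by simpa using h3) ((hasFDerivAt_id y).sub_const y)
  simpa [Function.comp_def] using h4

/-- Bootstrapping: by the derivative formula, n derivatives of the map give n derivatives of its
differential, hence n + 1 of the map. -/
theorem contDiffOn_lieExpChart (g : G) :
    ContDiffOn ℝ ∞ (lieExpChart e g) (lieExpDomain e g) := by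
  have hmap : Set.MapsTo (lieExpChart e g) (lieExpDomain e g) (lieChart e).target :=
    fun _ hy => (lieChart e).map_source hy
  refine contDiffOn_infty.2 fun n => ?_
  induction n with
  | zero => exact contDiffOn_zero.2 fun y hy =>
      (hasFDerivAt_lieExpChart hy).continuousAt.continuousWithinAt
  | succ n ih =>
    push_cast
    refine (contDiffOn_succ_iff_fderiv_of_isOpen (isOpen_lieExpDomain e g)).2
      ⟨fun y hy => (hasFDerivAt_lieExpChart hy).differentiableAt.differentiableWithinAt, by simp, ?_⟩
    refine ContDiffOn.congr (f := fun y => leftField e (lieExpChart e g y) ∘L adXi 1 (-y)) ?_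
      fun y hy => (hasFDerivAt_lieExpChart hy).fderiv
    refine ((((contDiffOn_leftField e).of_le ?_).comp ih hmap)).clm_comp ?_
    · exact_mod_cast le_top
    · exact (((contDiff_adXi 1).comp contDiff_neg).of_le (by exact_mod_cast le_top)).contDiffOn

end LieExpDeriv

/-! ### Regular points of the exponential map -/

section LieExpRegular

variable {𝔤 : Type*} [NormedLieAlgebra 𝔤] [FiniteDimensional ℝ 𝔤]

/-- Substitute s ↦ 1 - s. Since A_{-1} is invertible, x and -x are regular together, so the choice
of left or right trivialisation is immaterial. -/
theorem adXi_neg_apply (x y : 𝔤) : adXi 1 (-x) y = adExp (-1) x (adXi 1 x y) := by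
  rw [adXi_apply, adXi_apply, ← ContinuousLinearMap.intervalIntegral_comp_comm _
    ((continuous_adExp_apply x y).intervalIntegrable _ _)]
  have h := intervalIntegral.integral_comp_sub_left (a := 0) (b := 1)
    (fun s => adExp (-1) x (adExp s x y)) 1
  simp only [sub_zero, sub_self] at h
  rw [← h]
  refine intervalIntegral.integral_congr fun s _ => ?_
  have hs : -1 + (1 - s) = -s := by ring
  simp only [← adExp_apply_add, hs]
  simp [adExp]

theorem injective_adXi_neg_iff (x : 𝔤) :
    Function.Injective (adXi 1 (-x)) ↔ Function.Injective (adXi 1 x) := by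
  have h (z : 𝔤) (hz : Function.Injective (adXi 1 (-z))) : Function.Injective (adXi 1 z) :=
    fun a b hab => hz (by rw [adXi_neg_apply, adXi_neg_apply, hab])
  exact ⟨h x, fun hx => h (-x) (by rwa [neg_neg])⟩

theorem isOpen_setOf_injective_adXi : IsOpen {x : 𝔤 | Function.Injective (adXi 1 x)} := by
  have h : {x : 𝔤 | Function.Injective (adXi 1 x)} = (fun x : 𝔤 => adXi 1 x) ⁻¹'
      Set.range ((↑) : (𝔤 ≃L[ℝ] 𝔤) → 𝔤 →L[ℝ] 𝔤) := by
    ext x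
    constructor
    · intro hx
      exact ⟨(LinearEquiv.ofInjectiveEndo (adXi 1 x).toLinearMap hx).toContinuousLinearEquiv, rfl⟩
    · rintro ⟨Φ, hΦ⟩
      simp only at hΦ
      rw [Set.mem_ofPred_eq, ← hΦ]
      exact Φ.injective
  rw [h]
  exact ContinuousLinearEquiv.isOpen.preimage (contDiff_adXi 1).continuous

theorem injective_adXi_zero : Function.Injective (adXi 1 (0 : 𝔤)) := by
  rw [adXi_zero_right, one_smul]
  exact fun _ _ h => h

variable {E : Type*} [NormedAddCommGroup E] [NormedSpace ℝ E] [CompleteSpace E]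
  {G : Type*} [TopologicalSpace G] [ChartedSpace E G] [Group G] [LieGroup 𝓘(ℝ, E) ∞ G] [T2Space G]
  {e : 𝔤 ≃ₗ⁅ℝ⁆ GroupLieAlgebra 𝓘(ℝ, E) G}

omit [T2Space G] in
theorem mem_lieExpDomain_self (x : 𝔤) : x ∈ lieExpDomain e (lieExp (e x)) := by
  simpa [lieExpDomain] using one_mem_lieChart_source e

omit [T2Space G] in
theorem lieExpChart_self (x : 𝔤) : lieExpChart e (lieExp (e x)) x = 0 := by
  simp [lieExpChart]

theorem hasFDerivAt_lieExpChart_self (x : 𝔤) :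
    HasFDerivAt (lieExpChart e (lieExp (e x))) (adXi 1 (-x)) x := by
  have h := hasFDerivAt_lieExpChart (mem_lieExpDomain_self (e := e) x)
  rw [lieExpChart_self, leftField_zero] at h
  exact h

omit [T2Space G] in
theorem lieExp_eq_mul_lieExpChart {g : G} {y : 𝔤} (hy : y ∈ lieExpDomain e g) :
    lieExp (e y) = g * (lieChart e).symm (lieExpChart e g y) := by
  rw [lieExpChart, (lieChart e).left_inv hy, mul_inv_cancel_left]

/-- By the chain rule the invertible differential of exp factors through Ξ_{-x} first. -/
theorem injective_of_mem_lieExpRegular {x : 𝔤} (hx : x ∈ lieExpRegular e) :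
    Function.Injective (adXi 1 (-x)) := by
  let Φ : 𝔤 ≃L[ℝ] E := IsLocalDiffeomorphAt.mfderivToContinuousLinearEquiv hx (by simp)
  set g := lieExp (e x)
  let L : E →L[ℝ] E := mfderiv 𝓘(ℝ, E) 𝓘(ℝ, E) (fun b : G => g * b) 1
  have h1 : HasMFDerivAt 𝓘(ℝ, 𝔤) 𝓘(ℝ, E) (lieChart e).symm (lieExpChart e g x)
      (lieEquiv e : 𝔤 →L[ℝ] E) := by
    rw [lieExpChart_self]; exact hasMFDerivAt_lieChart_symm_zero e
  have h2 : HasMFDerivAt 𝓘(ℝ, E) 𝓘(ℝ, E) (fun b : G => g * b)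
      ((lieChart e).symm (lieExpChart e g x)) L := by
    rw [lieExpChart_self, lieChart_symm_zero]; exact hasMFDerivAt_mul_left g 1
  have h0 : HasMFDerivAt 𝓘(ℝ, 𝔤) 𝓘(ℝ, 𝔤) (lieExpChart e g) x (adXi 1 (-x) : 𝔤 →L[ℝ] 𝔤) :=
    (hasFDerivAt_lieExpChart_self x).hasMFDerivAt
  have h3 := h2.comp x (h1.comp x h0)
  let D : 𝔤 →L[ℝ] E := L ∘L (lieEquiv e : 𝔤 →L[ℝ] E) ∘L adXi 1 (-x)
  have h4 : HasMFDerivAt 𝓘(ℝ, 𝔤) 𝓘(ℝ, E) (fun y : 𝔤 => lieExp (e y)) x D := by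
    refine h3.congr_of_eventuallyEq ?_
    filter_upwards [(isOpen_lieExpDomain e g).mem_nhds (mem_lieExpDomain_self x)] with y hy
    exact lieExp_eq_mul_lieExpChart hy
  have h5 : (Φ : 𝔤 →L[ℝ] E) = D := h4.mfderiv
  have h6 : Function.Injective D := by
    rw [← h5]; exact Φ.injective
  exact Function.Injective.of_comp (f := fun v => L (lieEquiv e v)) h6

/-- The inverse function theorem in the chart translated to exp(x), where the derivative at x is
Ξ_{-x}; the local inverse is then carried back to the group. -/
theorem mem_lieExpRegular_of_injective {x : 𝔤} (hx : Function.Injective (adXi 1 (-x))) :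
    x ∈ lieExpRegular e := by
  set g := lieExp (e x)
  obtain ⟨κ, hxκ, hκD, hκf, hκ, hκs⟩ := exists_openPartialHomeomorph_of_contDiffOn
    (isOpen_lieExpDomain e g) (contDiffOn_lieExpChart g) (mem_lieExpDomain_self x)
    (LinearEquiv.ofInjectiveEndo (adXi 1 (-x)).toLinearMap hx).toContinuousLinearEquiv
    (hasFDerivAt_lieExpChart_self x).fderiv
  have hmap : ∀ y ∈ κ.source, κ y ∈ (lieChart e).target := fun y hy => by
    rw [hκf]; exact (lieChart e).map_source (hκD hy)
  have htgt : ∀ a ∈ κ.target, a ∈ (lieChart e).target := fun a ha => by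
    rw [← κ.right_inv ha]; exact hmap _ (κ.map_target ha)
  have hmul : ContMDiff 𝓘(ℝ, E) 𝓘(ℝ, E) ∞ (fun h : G => g⁻¹ * h) := contMDiff_mul_left_lieGroup g⁻¹
  have hc : ContMDiffOn 𝓘(ℝ, E) 𝓘(ℝ, 𝔤) ∞ (fun h : G => lieChart e (g⁻¹ * h))
      ((fun h : G => g⁻¹ * h) ⁻¹' (lieChart e).source) :=
    (contMDiffOn_lieChart e).comp hmul.contMDiffOn fun _ h => h
  refine ⟨{ toFun := fun y => g * (lieChart e).symm (κ y)
            invFun := fun h => κ.symm (lieChart e (g⁻¹ * h))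
            source := κ.source
            target := ((fun h : G => g⁻¹ * h) ⁻¹' (lieChart e).source) ∩
              (fun h : G => lieChart e (g⁻¹ * h)) ⁻¹' κ.target
            map_source' := fun y hy => ?_
            map_target' := fun h hh => κ.map_target hh.2
            left_inv' := fun y hy => ?_
            right_inv' := fun h hh => ?_
            open_source := κ.open_source
            open_target := hc.continuousOn.isOpen_inter_preimage
              ((lieChart e).open_source.preimage hmul.continuous) κ.open_target
            contMDiffOn_toFun := (contMDiff_mul_left_lieGroup g).comp_contMDiffOn
              (contMDiffOn_lieChart_symm_comp e hκ hmap)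
            contMDiffOn_invFun := hκs.contMDiffOn.comp (hc.mono Set.inter_subset_left)
              fun h hh => hh.2 }, hxκ, fun y hy => ?_⟩
  · simp only [Set.mem_inter_iff, Set.mem_preimage, inv_mul_cancel_left,
      (lieChart e).right_inv (hmap y hy)]
    exact ⟨(lieChart e).map_target (hmap y hy), κ.map_source hy⟩
  · simp only [inv_mul_cancel_left, (lieChart e).right_inv (hmap y hy), κ.left_inv hy]
  · simp only [κ.right_inv hh.2, (lieChart e).left_inv hh.1, mul_inv_cancel_left]
  · change lieExp (e y) = g * (lieChart e).symm (κ y)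
    rw [hκf]
    exact lieExp_eq_mul_lieExpChart (hκD hy)

/-- The exponential map of a Lie group is a local diffeomorphism at the points where its logarithmic
derivative is injective. -/
theorem mem_lieExpRegular_iff {x : 𝔤} : x ∈ lieExpRegular e ↔ Function.Injective (adXi 1 x) :=
  ⟨fun h => (injective_adXi_neg_iff x).1 (injective_of_mem_lieExpRegular h),
    fun h => mem_lieExpRegular_of_injective ((injective_adXi_neg_iff x).2 h)⟩

theorem isOpen_lieExpRegular : IsOpen (lieExpRegular e) := by
  have : lieExpRegular e = {x | Function.Injective (adXi 1 x)} :=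
    Set.ext fun _ => mem_lieExpRegular_iff
  rw [this]
  exact isOpen_setOf_injective_adXi

end LieExpRegular

end

/-! ### Assembly of the four parts -/

theorem mainTheorem6 (𝔤 : Type*) [NormedLieAlgebra 𝔤] [FiniteDimensional ℝ 𝔤] :
    -- (a) `π_𝔤` is a Poisson structure; the canonical spray is a spray, complete, with flow `φ_t`
    (IsPoissonStructureOn Set.univ (linearPoisson (𝔤 := 𝔤)) ∧
      IsPoissonSpray (canonicalSpray (𝔤 := 𝔤)) ∧
      IsCompleteFlow (sprayFlow (𝔤 := 𝔤)) canonicalSpray) ∧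
    -- (b) the averaged form is smooth and closed and is given by the explicit formula
    (ContDiff ℝ ∞ (averagedForm 𝔤) ∧
      (∀ p, extDeriv (averagedForm 𝔤) p = 0) ∧
      (∀ (x₀ x y : 𝔤) (ξ₀ ξ η : StrongDual ℝ 𝔤),
        averagedForm 𝔤 (x₀, ξ₀) ![(x, ξ), (y, η)] =
          ξ (lieXi x₀ y) - η (lieXi x₀ x) + ξ₀ ⁅lieXi x₀ x, lieXi x₀ y⁆) ∧
      (∀ x₀ : 𝔤,
        HasSum (fun n : ℕ => (((n + 1).factorial : ℝ)⁻¹) • (-lieAd x₀) ^ n) (lieXi x₀)) ∧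
      -- for every Lie group `G` integrating `𝔤`, it is symplectic exactly on `O(𝔤) × 𝔤^*`, and
      -- yields a full dual pair there
      (∀ (E : Type*) [NormedAddCommGroup E] [NormedSpace ℝ E] [CompleteSpace E]
        (G : Type*) [TopologicalSpace G] [T2Space G] [ChartedSpace E G] [Group G]
        [LieGroup 𝓘(ℝ, E) ∞ G] (e : 𝔤 ≃ₗ⁅ℝ⁆ GroupLieAlgebra 𝓘(ℝ, E) G),
        (∀ (x : 𝔤) (ξ : StrongDual ℝ 𝔤),
          IsNondegForm (averagedForm 𝔤 (x, ξ)) ↔ x ∈ lieExpRegular e) ∧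
        IsFullDualPair (lieExpRegular e ×ˢ Set.univ) (averagedForm 𝔤)
          Prod.snd linearPoisson sprayExp (fun ξ => -linearPoisson (𝔤 := 𝔤) ξ))) ∧
    -- (c) Poisson transversals and their normal form
    ((∀ X : Set (StrongDual ℝ 𝔤), IsEmbeddedSubmanifold X →
        (IsPoissonTransversal linearPoisson X ↔
          ∀ l ∈ X, ∀ x : 𝔤, (∀ v ∈ tangentSpaceOf X l, v x = 0) →
            (∀ y : 𝔤, (∀ v ∈ tangentSpaceOf X l, v y = 0) → l ⁅x, y⁆ = 0) → x = 0)) ∧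
      (∀ (x : 𝔤) (l : StrongDual ℝ 𝔤), sprayExp (x, l) = opExp (-lieCoad x) l) ∧
      (∀ X : Set (StrongDual ℝ 𝔤), IsPoissonTransversal linearPoisson X →
        ∃ U P, IsNormalFormOn X U P)) ∧
    -- (d) dual maps of Lie algebra morphisms
    (∀ (𝔥 : Type*) [NormedLieAlgebra 𝔥] [FiniteDimensional ℝ 𝔥] (f : 𝔤 →ₗ⁅ℝ⁆ 𝔥)
      (X : Set (StrongDual ℝ 𝔤)), IsPoissonTransversal linearPoisson X →
      ∀ Y : Set (StrongDual ℝ 𝔥), Y = dualMapOf f ⁻¹' X →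
      -- `f^*` is a Poisson map, transverse to `X`; `Y` is a Poisson transversal, and `f^*|_Y` is
      -- a Poisson map
      IsPoissonMapOn Set.univ linearPoisson Set.univ linearPoisson (dualMapOf f) ∧
      (∀ μ ∈ Y, (dualMapOf f).range ⊔ tangentSpaceOf X (dualMapOf f μ) = ⊤) ∧
      IsPoissonTransversal linearPoisson Y ∧
      IsPoissonMapOn Y (inducedBivector linearPoisson Y) X (inducedBivector linearPoisson X)
        (dualMapOf f) ∧
      -- `f` restricts to isomorphisms of conormal spaces
      (∀ μ ∈ Y, Set.BijOn f {x | (x, dualMapOf f μ) ∈ conormalBundle X}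
        {y | (y, μ) ∈ conormalBundle Y}) ∧
      -- the bundle map `F` covering `f^*` formed by their inverses
      ∃ F : 𝔥 × StrongDual ℝ 𝔥 → 𝔤 × StrongDual ℝ 𝔤,
        Set.MapsTo F (conormalBundle Y) (conormalBundle X) ∧
        ContDiffOn ℝ ∞ F (conormalBundle Y) ∧
        (∀ n ∈ conormalBundle Y, f (F n).1 = n.1 ∧ (F n).2 = dualMapOf f n.2) ∧
        -- the diagram commutes
        (∀ n ∈ conormalBundle Y, sprayExp (F n) = dualMapOf f (sprayExp n)) ∧
        -- `F` pulls back the two-form of `X` to that of `Y`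
        (∀ n ∈ conormalBundle Y, ∀ a ∈ tangentSpaceOf (conormalBundle Y) n,
          ∀ b ∈ tangentSpaceOf (conormalBundle Y) n,
          averagedForm 𝔤 (F n) ![fderivWithin ℝ F (conormalBundle Y) n a,
            fderivWithin ℝ F (conormalBundle Y) n b] = averagedForm 𝔥 n ![a, b]) ∧
        -- the other arrows of the diagram are Poisson maps around `Y` and `X`
        ∃ UY PY UX PX, IsNormalFormOn Y UY PY ∧ IsNormalFormOn X UX PX ∧
          IsPoissonMapOn UY PY UX PX F) := by
  refine ⟨⟨isPoissonStructureOn_linearPoisson, isPoissonSpray_canonicalSpray,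
    isCompleteFlow_sprayFlow⟩, ⟨contDiff_averagedForm, extDeriv_averagedForm, ?_, hasSum_lieXi, ?_⟩,
    ⟨fun X hX => isPoissonTransversal_linearPoisson_iff hX, ?_, ?_⟩, ?_⟩
  · intro x₀ x y ξ₀ ξ η
    rw [lieXi_eq]
    exact averagedForm_apply x₀ x y ξ₀ ξ η
  · intro E _ _ _ G _ _ _ _ _ e
    exact ⟨fun x ξ => (isNondegForm_averagedForm_iff x ξ).trans mem_lieExpRegular_iff.symm,
      isFullDualPair_averagedForm isOpen_lieExpRegular (mem_lieExpRegular_iff.2 injective_adXi_zero)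
        fun _ h => mem_lieExpRegular_iff.1 h⟩
  · intro x l
    rw [sprayExp, sprayFlow, neg_one_smul]
  · intro X hX
    obtain ⟨O, W, ψ, hO, -, h0, hψ⟩ := exists_isSmoothInverseOn_sprayExp hX isOpen_univ
      fun _ _ => trivial
    exact ⟨_, _, isNormalFormOn_pushBivector hX hO h0 hψ⟩
  · rintro 𝔥 _ _ f X hX Y rfl
    exact ⟨isPoissonMapOn_dualMapOf f, fun μ hμ => range_dualMapOf_sup hX hμ,
      hX.preimage_dualMapOf, isPoissonMapOn_inducedBivector hX, fun μ hμ => bijOn_conormal hX hμ,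
      conormalMap f X, fun n hn => (conormalMap_spec hX hn).1, contDiffOn_conormalMap hX,
      fun n hn => ⟨(conormalMap_spec hX hn).2, rfl⟩, fun n hn => sprayExp_conormalMap hX hn,
      fun n hn a ha b hb => averagedForm_conormalMap hX hn ha hb,
      exists_isNormalFormOn_conormalMap hX⟩
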